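/- Let $d\ge 2$, $\beta>\frac12$, $\alpha<0$ with $-\beta<\alpha\le\beta-1$, and $\mathbb T^d=\mathbb R^d/\mathbb Z^d$. Let $\varphi:\mathbb R^d\to[0,1]$ be smooth and radial, vanishing outside the annulus $\frac34\le|\xi|\le\frac83$, with $\sum_{j\in\mathbb Z}\varphi(2^{-j}\xi)=1$ for all $\xi\ne0$. For a (vector-valued) distribution $u=\sum_{l\in\mathbb Z^d}\hat u(l)e^{2\pi i l\cdot x}$ on $\mathbb T^d$ put $$\dot\Delta_j u=\sum_{l\in\mathbb Z^d}\varphi(2^{-j}l)\,\hat u(l)\,e^{2\pi i l\cdot x},\qquad \|u\|_{\dot B^{s}_{\infty,\infty}(\mathbb T^d)}=\sup_{j\in\mathbb Z}2^{js}\|\dot\Delta_ju\|_{L^\infty(\mathbb T^d)} .$$ Consider the generalized Navier–Stokes equations $$\partial_t v+\operatorname{div}(v\otimes v)+(-\Delta)^\beta v+\nabla p=0,\qquad \operatorname{div} v=0\qquad\text{on }\mathbb T^d .$$ Then there is $\varepsilon>0$ (depending on $d,\varphi,\beta,\alpha$) such that for every divergence-free real vector field $v_0\in \mathcal D'(\mathbb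 T^d)^d$ with $\|v_0\|_{\dot B^{-\beta-\alpha}_{\infty,\infty}(\mathbb T^d)}\le\varepsilon$ there is a mild solution $v$ on $(0,1]$ with initial datum $v_0$; that is, for every $t\in(0,1]$ the field $v(t)\in L^\infty(\mathbb T^d)$ is real and divergence-free, and $$v(t)=e^{-t(-\Delta)^\beta}v_0-\int_0^t e^{-(t-s)(-\Delta)^\beta}\,\mathbb P\operatorname{div}(v\otimes v)(s)\,ds\qquad\text{a.e. on }\mathbb T^d,$$ where $e^{-t(-\Delta)^\beta}$ is the Fourier multiplier $e^{-t(2\pi|l|)^{2\beta}}$, $\mathbb P$ is the projection onto divergence-free fields and the integral converges absolutely. Moreover $$v\in L^\infty\big((0,1];\dot B^{-\beta-\alpha}_{\infty,\infty}(\mathbb T^d)\big)\qquad\text{and}\qquad \sup_{t\in(0,1]}t^{\frac{\beta+\alpha}{2\beta}}\|v(t)\|_{L^\infty(\mathbb T^d)}<\infty .$$ -/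

import Mathlib

open MeasureTheory Filter Topology Set
open scoped ENNReal NNReal ContDiff

noncomputable section

namespace GNS

/-! ### The torus, test functions and distributions -/

/-- The torus `𝕋^d = (ℝ/ℤ)^d`. -/
abbrev Torus (d : ℕ) : Type := UnitAddTorus (Fin d)

/-- The normalised Haar (Lebesgue) measure on `𝕋^d`; it is the measure with respect to which
`UnitAddTorus.mFourierCoeff` is defined. -/
def torusMeasure (d : ℕ) : Measure (Torus d) :=
  Measure.pi fun _ : Fin d => (AddCircle.haarAddCircle : Measure UnitAddCircle)

/-- The projection `ℝ^d → 𝕋^d`. -/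
def toTorus {d : ℕ} (x : Fin d → ℝ) : Torus d := fun i => (x i : UnitAddCircle)

/-- The space `D(𝕋^d)` of (real) smooth functions on the torus: the functions whose periodic lift
to `ℝ^d` is `C^∞`. -/
def TestFunction (d : ℕ) : Submodule ℝ (Torus d → ℝ) where
  carrier := {f | ContDiff ℝ ∞ fun x : Fin d → ℝ => f (toTorus x)}
  add_mem' {f g} hf hg := by
    rw [Set.mem_ofPred_eq] at hf hg ⊢
    exact hf.add hg
  zero_mem' := by
    rw [Set.mem_ofPred_eq]
    exact contDiff_const
  smul_mem' c f hf := by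
    rw [Set.mem_ofPred_eq] at hf ⊢
    exact contDiff_const.mul hf

/-- The partial derivative `∂_i f` of a function on the torus. -/
def partialDeriv {d : ℕ} (i : Fin d) (f : Torus d → ℝ) (x : Torus d) : ℝ :=
  deriv (fun h : ℝ => f (x + toTorus (Pi.single i h))) 0

theorem partialDeriv_toTorus {d : ℕ} (i : Fin d) {f : Torus d → ℝ} (hf : f ∈ TestFunction d)
    (x : Fin d → ℝ) :
    partialDeriv i f (toTorus x) =
      fderiv ℝ (fun y : Fin d → ℝ => f (toTorus y)) x (Pi.single i 1) := by
  have hf' : ContDiff ℝ ∞ fun y : Fin d → ℝ => f (toTorus y) := hf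
  have hd : DifferentiableAt ℝ (fun y : Fin d → ℝ => f (toTorus y)) x :=
    (hf'.differentiable (by simp)).differentiableAt
  have h1 : HasDerivAt (fun h : ℝ => x + Pi.single i h) (Pi.single i (1 : ℝ)) 0 := by
    have h2 : HasDerivAt (fun h : ℝ => x + h • Pi.single i (1 : ℝ))
        ((1 : ℝ) • Pi.single i (1 : ℝ)) 0 := by
      simpa only [id] using ((hasDerivAt_id (0 : ℝ)).smul_const (Pi.single i (1 : ℝ))).const_add x
    convert h2 using 1
    · funext h
      rw [← Pi.single_smul, smul_eq_mul, mul_one]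
    · simp
  have h3 : HasFDerivAt (fun y : Fin d → ℝ => f (toTorus y))
      (fderiv ℝ (fun y : Fin d → ℝ => f (toTorus y)) x) (x + Pi.single i (0 : ℝ)) := by
    simpa using hd.hasFDerivAt
  have h4 := h3.comp_hasDerivAt (0 : ℝ) h1
  have h5 : (fun h : ℝ => f (toTorus x + toTorus (Pi.single i h))) =
      (fun y : Fin d → ℝ => f (toTorus y)) ∘ fun h : ℝ => x + Pi.single i h := by
    funext h
    simp only [Function.comp]
    congr 1
  rw [partialDeriv, h5]
  exact h4.deriv

theorem partialDeriv_mem {d : ℕ} (i : Fin d) {f : Torus d → ℝ} (hf : f ∈ TestFunction d) :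
    partialDeriv i f ∈ TestFunction d := by
  have hf' : ContDiff ℝ ∞ fun y : Fin d → ℝ => f (toTorus y) := hf
  change ContDiff ℝ ∞ fun x : Fin d → ℝ => partialDeriv i f (toTorus x)
  simp_rw [partialDeriv_toTorus i hf]
  exact (hf'.fderiv_right (m := ∞) (by simp)).clm_apply contDiff_const

/-- The partial derivative of a test function, as a test function. -/
def TestFunction.pderiv {d : ℕ} (i : Fin d) (f : TestFunction d) : TestFunction d :=
  ⟨partialDeriv i f.1, partialDeriv_mem i f.2⟩

/-- The space `D'(𝕋^d)` of (real) distributions: the linear functionals on `D(𝕋^d)` that are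
continuous for the `C^∞` topology, i.e. bounded by a `C^N` norm. -/
structure Distribution (d : ℕ) where
  /-- the underlying linear functional -/
  toLinearMap : TestFunction d →ₗ[ℝ] ℝ
  /-- continuity -/
  bound : ∃ (N : ℕ) (C : ℝ), ∀ (f : TestFunction d) (M : ℝ),
    (∀ k ≤ N, ∀ x : Fin d → ℝ, ‖iteratedFDeriv ℝ k (fun y => f.1 (toTorus y)) x‖ ≤ M) →
      |toLinearMap f| ≤ C * M

theorem contDiff_mFourier {d : ℕ} (l : Fin d → ℤ) :
    ContDiff ℝ ∞ fun x : Fin d → ℝ => UnitAddTorus.mFourier l (toTorus x) := by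
  have h : (fun x : Fin d → ℝ => UnitAddTorus.mFourier l (toTorus x)) =
      fun x : Fin d → ℝ => ∏ i : Fin d, Complex.exp (2 * Real.pi * Complex.I * l i * (x i : ℝ)) := by
    funext x
    simp only [UnitAddTorus.mFourier, toTorus, ContinuousMap.coe_mk]
    refine Finset.prod_congr rfl fun i _ => ?_
    rw [fourier_coe_apply]
    simp
  rw [h]
  refine contDiff_prod fun i _ => ?_
  refine ContDiff.cexp ?_
  refine contDiff_const.mul ?_
  exact Complex.ofRealCLM.contDiff.comp (contDiff_apply ℝ ℝ i)

/-- The test function `x ↦ cos (2π l·x)`. -/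
def cosTest {d : ℕ} (l : Fin d → ℤ) : TestFunction d :=
  ⟨fun x => (UnitAddTorus.mFourier l x).re, Complex.reCLM.contDiff.comp (contDiff_mFourier l)⟩

/-- The test function `x ↦ sin (2π l·x)`. -/
def sinTest {d : ℕ} (l : Fin d → ℤ) : TestFunction d :=
  ⟨fun x => (UnitAddTorus.mFourier l x).im, Complex.imCLM.contDiff.comp (contDiff_mFourier l)⟩

/-- The Fourier coefficient `û(l) = ⟨u, e^{-2πi l·x}⟩` of a distribution. -/
def Distribution.fourierCoeff {d : ℕ} (u : Distribution d) (l : Fin d → ℤ) : ℂ :=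
  (u.toLinearMap (cosTest l) : ℂ) - Complex.I * (u.toLinearMap (sinTest l) : ℂ)

/-! ### Vector fields, their Fourier coefficients and Besov norms -/

/-- Families of vector Fourier coefficients, indexed by `ℤ^d`. -/
abbrev Coeffs (d : ℕ) : Type := (Fin d → ℤ) → EuclideanSpace ℂ (Fin d)

/-- Fourier coefficients of a distributional vector field. -/
def distCoeffs {d : ℕ} (u : Fin d → Distribution d) : Coeffs d :=
  fun l => WithLp.toLp 2 fun k => (u k).fourierCoeff l

/-- Fourier coefficients of a vector field that is a function. -/
def funCoeffs {d : ℕ} (u : Torus d → EuclideanSpace ℝ (Fin d)) : Coeffs d :=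
  fun l => WithLp.toLp 2 fun k => UnitAddTorus.mFourierCoeff (fun x => ((u x k : ℝ) : ℂ)) l

/-- The distributional vector field `u` is divergence-free. -/
def DistDivFree {d : ℕ} (u : Fin d → Distribution d) : Prop :=
  ∀ ψ : TestFunction d, ∑ i, (u i).toLinearMap (TestFunction.pderiv i ψ) = 0

/-- The vector field `u` on the torus is divergence-free in the sense of distributions. -/
def WeakDivFree {d : ℕ} (u : Torus d → EuclideanSpace ℝ (Fin d)) : Prop :=
  ∀ ψ : TestFunction d, ∫ x, ∑ i, u x i * (TestFunction.pderiv i ψ).1 x ∂(torusMeasure d) = 0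

/-- The lattice point `l ∈ ℤ^d` as a vector of Euclidean `ℝ^d`. -/
def freq {d : ℕ} (l : Fin d → ℤ) : EuclideanSpace ℝ (Fin d) :=
  WithLp.toLp 2 fun i => (l i : ℝ)

/-- The Fourier series `∑_l e^{2πi l·x} a(l)`. -/
def fourierSeries {d : ℕ} (a : Coeffs d) (x : Torus d) : EuclideanSpace ℂ (Fin d) :=
  ∑' l : Fin d → ℤ, UnitAddTorus.mFourier l x • a l

/-- `φ` is a dyadic (Littlewood–Paley) bump: smooth, radial, with values in `[0,1]`, supported in
the annulus `3/4 ≤ |ξ| ≤ 8/3`, and `∑_{j ∈ ℤ} φ(2^{-j} ξ) = 1` for every `ξ ≠ 0`. -/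
structure IsDyadicBump {d : ℕ} (φ : EuclideanSpace ℝ (Fin d) → ℝ) : Prop where
  smooth : ContDiff ℝ ∞ φ
  radial : ∀ ξ η, ‖ξ‖ = ‖η‖ → φ ξ = φ η
  mem_Icc : ∀ ξ, φ ξ ∈ Icc (0 : ℝ) 1
  support : ∀ ξ, φ ξ ≠ 0 → 3 / 4 ≤ ‖ξ‖ ∧ ‖ξ‖ ≤ 8 / 3
  sum_eq_one : ∀ ξ, ξ ≠ 0 → HasSum (fun j : ℤ => φ ((2 : ℝ) ^ (-j) • ξ)) 1

/-- The homogeneous dyadic block `∑_l φ(2^{-j} l) a(l) e^{2πi l·x}` (a finite sum when `φ` is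
supported in an annulus). -/
def dyadicBlock {d : ℕ} (φ : EuclideanSpace ℝ (Fin d) → ℝ) (j : ℤ) (a : Coeffs d) :
    Torus d → EuclideanSpace ℂ (Fin d) :=
  fourierSeries fun l => ((φ ((2 : ℝ) ^ (-j) • freq l) : ℝ) : ℂ) • a l

/-- The norm of `Ḃ^s_{∞,∞}(𝕋^d)`: `sup_{j ∈ ℤ} 2^{js} ‖Δ̇_j u‖_{L^∞}`, for the vector field `u` with
Fourier coefficients `a`. -/
def besovNorm {d : ℕ} (φ : EuclideanSpace ℝ (Fin d) → ℝ) (s : ℝ) (a : Coeffs d) : ℝ≥0∞ :=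
  ⨆ j : ℤ, ENNReal.ofReal ((2 : ℝ) ^ ((j : ℝ) * s)) *
    eLpNorm (dyadicBlock φ j a) ∞ (torusMeasure d)

/-- `v ∈ L^∞((0,1]; Ḃ^s_{∞,∞}(𝕋^d))`: `t ↦ v(t)` is strongly (Bochner) measurable into
`Ḃ^s_{∞,∞}`, i.e. it is a.e. the limit in norm of a sequence of simple functions, and its norm is
essentially bounded. -/
def MemLinftyBesov {d : ℕ} (φ : EuclideanSpace ℝ (Fin d) → ℝ) (s : ℝ)
    (v : ℝ → Torus d → EuclideanSpace ℝ (Fin d)) : Prop :=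
  (∃ g : ℕ → SimpleFunc ℝ (Coeffs d), ∀ᵐ t ∂(volume.restrict (Ioc (0 : ℝ) 1)),
    Tendsto (fun n => besovNorm φ s (funCoeffs (v t) - g n t)) atTop (𝓝 0)) ∧
  ∃ C : ℝ≥0, ∀ᵐ t ∂(volume.restrict (Ioc (0 : ℝ) 1)), besovNorm φ s (funCoeffs (v t)) ≤ C

/-! ### The mild formulation -/

/-- `e^{-τ(-Δ)^β}` applied to the field with Fourier coefficients `a`: the multiplier is
`e^{-τ (2π|l|)^{2β}}`. For `τ > 0` the series converges absolutely if `a` has polynomial growth. -/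
def heat {d : ℕ} (β τ : ℝ) (a : Coeffs d) : Torus d → EuclideanSpace ℂ (Fin d) :=
  fourierSeries fun l =>
    ((Real.exp (-τ * (2 * Real.pi * ‖freq l‖) ^ (2 * β)) : ℝ) : ℂ) • a l

/-- The symbol `δ_{km} - l_k l_m / |l|²` of the Helmholtz–Leray projection `ℙ` (its value at `l = 0`
plays no role below, since `div` annihilates that mode). -/
def leraySymbol {d : ℕ} (l : Fin d → ℤ) (k m : Fin d) : ℝ :=
  (if k = m then 1 else 0) - (l k : ℝ) * (l m : ℝ) / ‖freq l‖ ^ 2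

/-- The Fourier coefficients of `ℙ div (u ⊗ u)`, where `(div (u ⊗ u))_m = ∑_j ∂_j (u_j u_m)`. -/
def projDivCoeffs {d : ℕ} (u : Torus d → EuclideanSpace ℝ (Fin d)) : Coeffs d :=
  fun l => WithLp.toLp 2 fun k => ∑ m, (leraySymbol l k m : ℂ) *
    ∑ j, 2 * Real.pi * Complex.I * (l j : ℂ) *
      UnitAddTorus.mFourierCoeff (fun x => ((u x j * u x m : ℝ) : ℂ)) l

/-- A real vector regarded as a complex one. -/
def complexify {d : ℕ} (y : EuclideanSpace ℝ (Fin d)) : EuclideanSpace ℂ (Fin d) :=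
  WithLp.toLp 2 fun k => ((y k : ℝ) : ℂ)

/-- `v` is a mild solution on `(0,1]`, with initial datum `v₀`, of the generalized Navier–Stokes
equations `∂_t v + div (v ⊗ v) + (-Δ)^β v + ∇p = 0`, `div v = 0` on `𝕋^d`: for every `t ∈ (0,1]`,
`v(t)` is a bounded divergence-free field and, for a.e. `x`,
`v(t) = e^{-t(-Δ)^β} v₀ - ∫_0^t e^{-(t-s)(-Δ)^β} ℙ div (v ⊗ v)(s) ds`,
the integral being absolutely convergent. -/
structure IsMildSolution {d : ℕ} (β : ℝ) (v₀ : Fin d → Distribution d)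
    (v : ℝ → Torus d → EuclideanSpace ℝ (Fin d)) : Prop where
  aestronglyMeasurable : AEStronglyMeasurable (Function.uncurry v)
    ((volume.restrict (Ioc (0 : ℝ) 1)).prod (torusMeasure d))
  memLp_top : ∀ t ∈ Ioc (0 : ℝ) 1, MemLp (v t) ∞ (torusMeasure d)
  divFree : ∀ t ∈ Ioc (0 : ℝ) 1, WeakDivFree (v t)
  intervalIntegrable : ∀ t ∈ Ioc (0 : ℝ) 1, ∀ᵐ x ∂(torusMeasure d),
    IntervalIntegrable (fun s => heat β (t - s) (projDivCoeffs (v s)) x) volume 0 t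
  eq_duhamel : ∀ t ∈ Ioc (0 : ℝ) 1, ∀ᵐ x ∂(torusMeasure d),
    complexify (v t x) = heat β t (distCoeffs v₀) x
      - ∫ s in (0 : ℝ)..t, heat β (t - s) (projDivCoeffs (v s)) x

end GNS

end

/-!
The solution is found by Kato's method. Write `s = β + α`, so that `0 < s ≤ 2β - 1` and `s < β`, and
`γ = s / (2β)`. Data bounded by `ε` in `Ḃ^{-s}_{∞,∞}` have a free evolution of size `O(ε t^{-γ})`
in `L^∞`, the Oseen operator `e^{-τ(-Δ)^β} ℙ div` has norm `O(τ^{-1/(2β)})` on `L^∞`, and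
`γ ≤ 1 - 1/(2β)`, `2γ < 1` make the Duhamel integral of a source of size `t^{-2γ}` converge with
size `t^{-γ}`. A contraction argument in the space of fields of size `O(t^{-γ})` then gives a
solution (`exists_duhamel_solution`).

The homogeneous norm does not see the mean `c` of the data, which therefore need not be small. It is
removed by a Galilean drift: one solves the equation of the mean-free part `w`, in which `(-Δ)^β` is
replaced by `(-Δ)^β + c·∇`, and `w + c` then solves the original equation. Instead of changing
variables `x ↦ x - ct`, this is checked on each Fourier mode, where the two mild formulations are
related by a scalar identity (`mild_change_drift`, `projDivMode_addConst`,
`addConst_eq_heatField_sub_duhamel`). The drift multiplies Fourier coefficients by characters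
`e^{-2πi τ l·c}`, i.e. translates, and so it affects no sup norm; all estimates are uniform in `c`.

The estimates for the multipliers are made one dyadic block at a time. A multiplier
`l ↦ m(2^{-j} l)` with `m` smooth and compactly supported acts on `C(𝕋^d)` with norm at most the
`L¹(ℝ^d)` norm of the inverse Fourier transform of `m` (`norm_synth_mul_le_of_kernel`). For the
family `m_y(ξ) = ψ(ξ) e^{-y(2π|ξ|)^{2β}}`, with `ψ` supported in an annulus, that norm is
`O(1/(1+y))` uniformly in `y ≥ 0` (`exists_block_bound`), so that the block at frequency `2^j`
decays like `1/(1 + τ 2^{2βj})`; summing over `j` gives the two estimates above (`exists_heat_le`,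
`exists_oseen_le`), and not summing gives the bound of the solution in the Besov space
(`exists_block_solution_le`). Only smoothness away from `ξ = 0` is used, so that the singularity
of `|ξ|^{2β}` and of `ℙ` at the origin plays no role.
-/
open scoped BoundedContinuousFunction

noncomputable section

namespace GNS

open UnitAddTorus

/-! ### Fourier series of continuous functions on the torus -/

instance instIsProbabilityMeasureTorusMeasure (d : ℕ) :
    IsProbabilityMeasure (torusMeasure d) := by
  unfold torusMeasure; infer_instance

instance instIsAddHaarMeasureTorusMeasure (d : ℕ) :
    (torusMeasure d).IsAddHaarMeasure := by
  unfold torusMeasure; infer_instance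

theorem mFourierCoeff_eq {d : ℕ} (f : Torus d → ℂ) (l : Fin d → ℤ) :
    mFourierCoeff f l = ∫ x, mFourier (-l) x * f x ∂(torusMeasure d) := rfl

theorem norm_mFourier_apply {d : ℕ} (l : Fin d → ℤ) (x : Torus d) : ‖mFourier l x‖ = 1 := by
  simp only [mFourier, ContinuousMap.coe_mk, norm_prod, fourier_apply, Circle.norm_coe,
    Finset.prod_const_one]

theorem integrable_continuousMap {d : ℕ} {E : Type*} [NormedAddCommGroup E]
    [SecondCountableTopologyEither (Torus d) E] (f : C(Torus d, E)) :
    Integrable f (torusMeasure d) :=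
  f.continuous.integrable_of_hasCompactSupport (HasCompactSupport.of_compactSpace _)

theorem norm_mFourierCoeff_le {d : ℕ} (f : C(Torus d, ℂ)) (l : Fin d → ℤ) :
    ‖mFourierCoeff f l‖ ≤ ‖f‖ := by
  rw [mFourierCoeff_eq]
  refine (norm_integral_le_of_norm_le_const (C := ‖f‖) (.of_forall fun x => ?_)).trans (by simp)
  rw [norm_mul, norm_mFourier_apply, one_mul]
  exact f.norm_coe_le_norm x

/-- The `l`-th Fourier coefficient as a continuous linear functional on `C(𝕋^d, ℂ)`. -/
def coeffCLM {d : ℕ} (l : Fin d → ℤ) : C(Torus d, ℂ) →L[ℂ] ℂ :=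
  LinearMap.mkContinuous
    { toFun := fun f => mFourierCoeff f l
      map_add' := fun f g => by
        simp only [mFourierCoeff_eq, ContinuousMap.coe_add, Pi.add_apply, mul_add]
        exact integral_add (integrable_continuousMap (mFourier (-l) * f))
          (integrable_continuousMap (mFourier (-l) * g))
      map_smul' := fun c f => by
        simp only [mFourierCoeff_eq, ContinuousMap.coe_smul, Pi.smul_apply, smul_eq_mul,
          RingHom.id_apply]
        rw [← integral_const_mul]
        congr 1; funext x; ring }
    1 fun f => by simpa using norm_mFourierCoeff_le f l

@[simp] theorem coeffCLM_apply {d : ℕ} (l : Fin d → ℤ) (f : C(Torus d, ℂ)) :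
    coeffCLM l f = mFourierCoeff f l := rfl

theorem mFourierCoeff_mFourier {d : ℕ} (l m : Fin d → ℤ) :
    mFourierCoeff (mFourier m : C(Torus d, ℂ)) l = if l = m then 1 else 0 := by
  have h := orthonormal_iff_ite.mp (orthonormal_mFourier (d := Fin d)) l m
  rw [ContinuousMap.inner_toLp] at h
  rw [mFourierCoeff_eq, ← h]
  refine integral_congr_ae (.of_forall fun x => ?_)
  simp only [mFourier_neg]
  rw [mul_comm]

/-- The Fourier series `∑_l a(l) e^{2πi l·x}` as a continuous function. -/
def synth {d : ℕ} (a : (Fin d → ℤ) → ℂ) : C(Torus d, ℂ) := ∑' l, a l • mFourier l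

theorem summable_synth {d : ℕ} {a : (Fin d → ℤ) → ℂ} (ha : Summable a) :
    Summable fun l => a l • (mFourier l : C(Torus d, ℂ)) := by
  refine .of_norm ?_
  simpa only [norm_smul, mFourier_norm, mul_one] using ha.norm

theorem synth_apply {d : ℕ} {a : (Fin d → ℤ) → ℂ} (ha : Summable a) (x : Torus d) :
    synth a x = ∑' l, mFourier l x * a l := by
  have h := (ContinuousMap.evalCLM ℂ x).map_tsum (summable_synth ha)
  simpa [synth, mul_comm] using h

theorem mFourierCoeff_synth {d : ℕ} {a : (Fin d → ℤ) → ℂ} (ha : Summable a) (l : Fin d → ℤ) :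
    mFourierCoeff (synth a) l = a l := by
  have h := (coeffCLM l).map_tsum (summable_synth ha)
  rw [← coeffCLM_apply, synth, h]
  simp only [map_smul, coeffCLM_apply, mFourierCoeff_mFourier, smul_eq_mul, mul_ite, mul_one,
    mul_zero]
  simp

theorem synth_mFourierCoeff {d : ℕ} {f : C(Torus d, ℂ)} (hf : Summable (mFourierCoeff f)) :
    synth (mFourierCoeff f) = f :=
  (hasSum_mFourier_series_of_summable hf).tsum_eq

theorem eq_of_mFourierCoeff_eq {d : ℕ} {f g : C(Torus d, ℂ)}
    (h : ∀ l, mFourierCoeff f l = mFourierCoeff g l) : f = g := by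
  have h0 : mFourierCoeff (f - g : C(Torus d, ℂ)) = fun _ => (0 : ℂ) := by
    funext l
    rw [← coeffCLM_apply, map_sub, coeffCLM_apply, coeffCLM_apply, h, sub_self]
  have h1 := synth_mFourierCoeff (f := f - g) (by rw [h0]; exact summable_zero)
  rw [h0] at h1
  rw [← sub_eq_zero, ← h1]
  exact (tsum_congr fun l => zero_smul ℂ (mFourier l : C(Torus d, ℂ))).trans tsum_zero

/-! ### Translations and `L¹` kernels -/

/-- The translate `x ↦ f (x - y)`. -/
def translate {d : ℕ} (y : Torus d) (f : C(Torus d, ℂ)) : C(Torus d, ℂ) :=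
  f.comp ⟨fun x => x - y, by fun_prop⟩

@[simp] theorem translate_apply {d : ℕ} (y : Torus d) (f : C(Torus d, ℂ)) (x : Torus d) :
    translate y f x = f (x - y) := rfl

theorem norm_translate_le {d : ℕ} (y : Torus d) (f : C(Torus d, ℂ)) :
    ‖translate y f‖ ≤ ‖f‖ :=
  (ContinuousMap.norm_le _ (norm_nonneg _)).2 fun _ => f.norm_coe_le_norm _

theorem continuous_translate {d : ℕ} (f : C(Torus d, ℂ)) :
    Continuous fun y : Torus d => translate y f := by
  refine ContinuousMap.continuous_of_continuous_uncurry _ ?_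
  simp only [Function.uncurry_def, translate_apply]
  fun_prop

theorem mFourier_apply_add {d : ℕ} (l : Fin d → ℤ) (x y : Torus d) :
    mFourier l (x + y) = mFourier l x * mFourier l y := by
  simp [mFourier, ← Finset.prod_mul_distrib, fourier_apply, smul_add, AddCircle.toCircle_add]

theorem mFourier_apply_neg {d : ℕ} (l : Fin d → ℤ) (x : Torus d) :
    mFourier l (-x) = mFourier (-l) x := by
  simp [mFourier, fourier_apply]

theorem mFourierCoeff_translate {d : ℕ} (y : Torus d) (f : C(Torus d, ℂ)) (l : Fin d → ℤ) :
    mFourierCoeff (translate y f) l = mFourier (-l) y * mFourierCoeff f l := by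
  have h := integral_sub_right_eq_self (μ := torusMeasure d)
    (fun x => mFourier (-l) (x + y) * f x) y
  rw [mFourierCoeff_eq, mFourierCoeff_eq, ← integral_const_mul]
  simp only [sub_add_cancel] at h
  simp only [translate_apply]
  rw [h]
  congr 1; funext x
  rw [mFourier_apply_add]; ring

theorem continuous_toTorus {d : ℕ} : Continuous (toTorus : (Fin d → ℝ) → Torus d) := by
  unfold toTorus
  refine continuous_pi fun i => ?_
  exact (AddCircle.continuous_mk' 1).comp (continuous_apply i)

theorem mFourier_toTorus {d : ℕ} (l : Fin d → ℤ) (x : Fin d → ℝ) :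
    mFourier l (toTorus x) =
      Complex.exp (2 * Real.pi * Complex.I * ∑ i, (l i : ℂ) * (x i : ℂ)) := by
  rw [Finset.mul_sum, Complex.exp_sum]
  simp only [mFourier, toTorus, ContinuousMap.coe_mk]
  refine Finset.prod_congr rfl fun i _ => ?_
  rw [fourier_coe_apply]
  congr 1; push_cast; ring

/-- **Transference**: if the symbol `m` is the restriction to `ℤ^d` of the Fourier transform of an
integrable kernel `k` on `ℝ^d`, the multiplier is the average of translates of `f` with weight `k`,
and hence bounded on `C(𝕋^d)` with norm at most `‖k‖_{L¹}`. -/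
theorem norm_synth_mul_le_of_kernel {d : ℕ} {k : EuclideanSpace ℝ (Fin d) → ℂ} (hk : Integrable k)
    {m : (Fin d → ℤ) → ℂ} (hm : ∀ l, FourierTransform.fourier k (freq l) = m l)
    (f : C(Torus d, ℂ)) (hs : Summable fun l => m l * mFourierCoeff f l) :
    ‖synth fun l => m l * mFourierCoeff f l‖ ≤ (∫ y, ‖k y‖) * ‖f‖ := by
  have hc : Continuous fun y : EuclideanSpace ℝ (Fin d) => translate (toTorus y.ofLp) f :=
    (continuous_translate f).comp (continuous_toTorus.comp (PiLp.continuous_ofLp 2 _))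
  have hint : Integrable fun y => k y • translate (toTorus y.ofLp) f :=
    hk.smul_bdd ‖f‖ hc.aestronglyMeasurable
      (.of_forall fun y => norm_translate_le _ _)
  have hcoef : ∀ l, mFourierCoeff (∫ y, k y • translate (toTorus y.ofLp) f : C(Torus d, ℂ)) l =
      m l * mFourierCoeff f l := by
    intro l
    rw [← coeffCLM_apply, ← ContinuousLinearMap.integral_comp_comm _ hint, ← hm,
      Real.fourier_eq, ← integral_mul_const]
    congr 1; funext y
    rw [map_smul, coeffCLM_apply, mFourierCoeff_translate, smul_eq_mul, Circle.smul_def,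
      smul_eq_mul, Real.fourierChar_apply, ← mFourier_apply_neg]
    have : mFourier l (-toTorus y.ofLp) =
        Complex.exp (((2 * Real.pi * -inner ℝ y (freq l) : ℝ) : ℂ) * Complex.I) := by
      have h1 : (-toTorus y.ofLp : Torus d) = toTorus (fun i => -y i) := by
        funext i; simp [toTorus]
      rw [h1, mFourier_toTorus]
      congr 1
      simp only [PiLp.inner_apply, freq, RCLike.inner_apply, conj_trivial]
      push_cast
      simp only [mul_neg, Finset.sum_neg_distrib]
      ring
    rw [this]; ring
  have h2 : synth (fun l => m l * mFourierCoeff f l) =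
      ∫ y, k y • translate (toTorus y.ofLp) f := by
    refine eq_of_mFourierCoeff_eq fun l => ?_
    rw [mFourierCoeff_synth hs, hcoef]
  rw [h2, ← integral_mul_const]
  refine norm_integral_le_of_norm_le (hk.norm.mul_const _) (.of_forall fun y => ?_)
  rw [norm_smul]
  gcongr
  exact norm_translate_le _ _

/-- Multiplying the coefficients by the phases of a translation does not increase the norm. -/
theorem norm_synth_phase_le {d : ℕ} {a : (Fin d → ℤ) → ℂ} (ha : Summable a) (y : Torus d) :
    ‖synth fun l => mFourier l y * a l‖ ≤ ‖synth a‖ := by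
  have h : synth (fun l => mFourier l y * a l) = translate (-y) (synth a) := by
    have hs : Summable fun l => mFourier l y * a l := by
      refine .of_norm ?_
      simpa only [norm_mul, norm_mFourier_apply, one_mul] using ha.norm
    refine eq_of_mFourierCoeff_eq fun l => ?_
    rw [mFourierCoeff_synth hs, mFourierCoeff_translate, mFourierCoeff_synth ha,
      ← mFourier_apply_neg, neg_neg]
  rw [h]
  exact norm_translate_le _ _

/-- Euclidean frequency space. -/
abbrev Vec (d : ℕ) : Type := EuclideanSpace ℝ (Fin d)

/-! ### Integrable kernels of smooth compactly supported symbols -/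

open scoped FourierTransform in
/-- A jointly smooth family of symbols `H(ρ, ·)`, `0 ≤ ρ ≤ 1`, supported in a common ball, has
Fourier kernels bounded in `L¹(ℝ^d)`: the derivatives of order at most `d + 1` are bounded by
compactness, which makes the kernels decay like `(1 + |w|)^{-(d+1)}`, uniformly in `ρ`. -/
theorem exists_kernel_family {d : ℕ} {H : ℝ × Vec d → ℂ} (hH : ContDiff ℝ ∞ H)
    {R : ℝ} (hR : ∀ ρ ξ, R < ‖ξ‖ → H (ρ, ξ) = 0) :
    ∃ C : ℝ, 0 ≤ C ∧ ∀ ρ ∈ Icc (0 : ℝ) 1, ∃ k : Vec d → ℂ,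
      Integrable k ∧ (∀ ξ, 𝓕 k ξ = H (ρ, ξ)) ∧ ∫ y, ‖k y‖ ≤ C := by
  -- bounds on the derivatives in `ξ`
  have hB : ∀ n : ℕ, ∃ B : ℝ, 0 ≤ B ∧ ∀ ρ ∈ Icc (0 : ℝ) 1, ∀ ξ ∈ Metric.closedBall (0 : Vec d) R,
      ‖iteratedFDeriv ℝ n (fun ξ => H (ρ, ξ)) ξ‖ ≤ B := by
    intro n
    have hK : IsCompact (Icc (0 : ℝ) 1 ×ˢ Metric.closedBall (0 : Vec d) R) :=
      isCompact_Icc.prod (isCompact_closedBall _ _)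
    have hc : Continuous (iteratedFDeriv ℝ n H) :=
      hH.continuous_iteratedFDeriv (by exact_mod_cast le_top)
    obtain ⟨B, hB⟩ := hK.exists_bound_of_continuousOn hc.continuousOn
    refine ⟨max B 0 * ‖ContinuousLinearMap.inr ℝ ℝ (Vec d)‖ ^ n, by positivity, fun ρ hρ ξ hξ => ?_⟩
    have h1 : (fun ξ => H (ρ, ξ)) =
        (fun z => H (z + (ρ, 0))) ∘ ContinuousLinearMap.inr ℝ ℝ (Vec d) := by
      funext ξ; simp
    have h2 : ContDiff ℝ n (fun z : ℝ × Vec d => H (z + (ρ, 0))) :=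
      (hH.of_le (by exact_mod_cast le_top)).comp (contDiff_id.add contDiff_const)
    rw [h1, ContinuousLinearMap.iteratedFDeriv_comp_right _ h2 _ le_rfl]
    refine (ContinuousMultilinearMap.norm_compContinuousLinearMap_le _ _).trans ?_
    rw [Finset.prod_const, Finset.card_univ, Fintype.card_fin]
    gcongr
    rw [iteratedFDeriv_comp_add_right]
    refine le_trans ?_ (le_max_left _ _)
    have h3 : ContinuousLinearMap.inr ℝ ℝ (Vec d) ξ + (ρ, 0) = (ρ, ξ) := by simp
    rw [h3]
    exact hB (ρ, ξ) ⟨hρ, hξ⟩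
  choose B hB0 hB using hB
  set vol : ℝ := volume.real (Metric.closedBall (0 : Vec d) R)
  -- the constants in `‖w‖^n ‖𝓕 f w‖ ≤ D n`
  set D : ℕ → ℝ := fun n => 2 ^ n * ∑ p ∈ Finset.range (0 + 1) ×ˢ Finset.range (n + 1), B p.2 * vol
  have hD0 : ∀ n, 0 ≤ D n := fun n =>
    mul_nonneg (by positivity) (Finset.sum_nonneg fun p _ => mul_nonneg (hB0 _) measureReal_nonneg)
  set N : ℕ := d + 1
  set Q : ℝ := ∫ w : Vec d, (1 + ‖w‖) ^ (-(N : ℝ))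
  have hQ : Integrable fun w : Vec d => (1 + ‖w‖) ^ (-(N : ℝ)) :=
    integrable_one_add_norm (by simp [N])
  have hQ0 : 0 ≤ Q := integral_nonneg fun w => by positivity
  refine ⟨2 ^ N * (D 0 + D N) * Q, mul_nonneg (mul_nonneg (by positivity)
    (add_nonneg (hD0 _) (hD0 _))) hQ0, fun ρ hρ => ?_⟩
  set f : (Vec d) → ℂ := fun ξ => H (ρ, ξ)
  have hf : ContDiff ℝ ∞ f := hH.comp (contDiff_const.prodMk contDiff_id)
  have hts : tsupport f ⊆ Metric.closedBall 0 R := by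
    refine closure_minimal (fun ξ hξ => ?_) Metric.isClosed_closedBall
    rw [mem_closedBall_zero_iff]
    by_contra h
    exact hξ (hR ρ ξ (not_le.1 h))
  have hcs : HasCompactSupport f :=
    (isCompact_closedBall (0 : Vec d) R).of_isClosed_subset (isClosed_tsupport f) hts
  set F : SchwartzMap (Vec d) ℂ := hcs.toSchwartzMap hf
  have hFf : ⇑F = f := rfl
  have hint : ∀ n : ℕ, ∫ v, ‖iteratedFDeriv ℝ n f v‖ ≤ B n * vol := by
    intro n
    have h0 : ∀ v, v ∉ Metric.closedBall (0 : Vec d) R → ‖iteratedFDeriv ℝ n f v‖ = 0 := by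
      intro v hv
      rw [norm_eq_zero]
      by_contra h
      exact hv (hts (support_iteratedFDeriv_subset n h))
    rw [← setIntegral_eq_integral_of_forall_compl_eq_zero h0]
    refine (le_abs_self _).trans ?_
    rw [← Real.norm_eq_abs]
    refine norm_setIntegral_le_of_norm_le_const (isCompact_closedBall _ _).measure_lt_top
      fun v hv => ?_
    rw [norm_norm]
    exact hB n ρ hρ v hv
  have hdecay : ∀ (n : ℕ) (w : Vec d), ‖w‖ ^ n * ‖𝓕 f w‖ ≤ D n := by
    intro n w
    have h := Real.pow_mul_norm_iteratedFDeriv_fourier_le (K := ⊤) (N := ⊤) (f := f)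
      (by exact_mod_cast hf)
      (fun k n _ _ => by
        rw [← hFf]; exact SchwartzMap.integrable_pow_mul_iteratedFDeriv volume F k n)
      (k := 0) (n := n) le_top le_top w
    rw [norm_iteratedFDeriv_zero] at h
    refine h.trans ?_
    simp only [D]
    simp only [CharP.cast_eq_zero, mul_zero, zero_add, pow_zero, one_mul]
    gcongr with p hp
    have hp1 : p.1 = 0 := by simpa using (Finset.mem_product.1 hp).1
    simpa [hp1] using hint p.2
  have hbound : ∀ w : Vec d, ‖𝓕 f w‖ ≤ 2 ^ N * (D 0 + D N) * (1 + ‖w‖) ^ (-(N : ℝ)) := by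
    intro w
    rw [Real.rpow_neg (by positivity), Real.rpow_natCast, ← div_eq_mul_inv,
      le_div_iff₀ (by positivity)]
    have h1 : (1 + ‖w‖) ^ N ≤ 2 ^ N * (1 + ‖w‖ ^ N) := by
      have h2 : (1 + ‖w‖) ^ N ≤ 2 ^ (N - 1) * (1 ^ N + ‖w‖ ^ N) :=
        add_pow_le (by norm_num) (norm_nonneg _) N
      rw [one_pow] at h2
      refine h2.trans ?_
      gcongr
      · norm_num
      · omega
    have h3 := hdecay 0 w
    have h4 := hdecay N w
    rw [pow_zero, one_mul] at h3
    calc ‖𝓕 f w‖ * (1 + ‖w‖) ^ N ≤ ‖𝓕 f w‖ * (2 ^ N * (1 + ‖w‖ ^ N)) := by gcongr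
      _ = 2 ^ N * (‖𝓕 f w‖ + ‖w‖ ^ N * ‖𝓕 f w‖) := by ring
      _ ≤ 2 ^ N * (D 0 + D N) := by gcongr
  have hk : ⇑(𝓕⁻ F : SchwartzMap (Vec d) ℂ) = fun w => 𝓕 f (-w) := by
    rw [SchwartzMap.fourierInv_coe, hFf]
    funext w
    rw [Real.fourierInv_eq_fourier_neg]
  refine ⟨⇑(𝓕⁻ F : SchwartzMap (Vec d) ℂ), (𝓕⁻ F : SchwartzMap (Vec d) ℂ).integrable,
    fun ξ => ?_, ?_⟩
  · rw [← SchwartzMap.fourier_coe, FourierTransform.fourier_fourierInv_eq]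
    rfl
  · rw [hk, integral_neg_eq_self (fun w => ‖𝓕 f w‖), ← integral_const_mul]
    refine integral_mono_of_nonneg (.of_forall fun w => norm_nonneg _) (hQ.const_mul _)
      (.of_forall hbound)

open scoped FourierTransform in
/-- Dilating the symbol does not change the `L¹` norm of the kernel. -/
theorem exists_kernel_dilation {d : ℕ} {k : Vec d → ℂ} (hk : Integrable k)
    {a : ℝ} (ha : 0 < a) : ∃ k' : Vec d → ℂ, Integrable k' ∧
      (∀ ξ, 𝓕 k' ξ = 𝓕 k (a⁻¹ • ξ)) ∧ ∫ y, ‖k' y‖ = ∫ y, ‖k y‖ := by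
  have had : (0 : ℝ) < a ^ d := by positivity
  have key : ∀ {E : Type} [NormedAddCommGroup E] [NormedSpace ℝ E]
      (g : Vec d → E), a ^ d • ∫ y, g (a • y) = ∫ y, g y := by
    intro E _ _ g
    rw [Measure.integral_comp_smul, finrank_euclideanSpace_fin, abs_of_pos (by positivity),
      smul_smul, mul_inv_cancel₀ had.ne', one_smul]
  refine ⟨fun y => a ^ d • k (a • y), ?_, fun ξ => ?_, ?_⟩
  · exact ((integrable_comp_smul_iff volume k ha.ne').2 hk).smul (a ^ d)
  · rw [Real.fourier_eq, Real.fourier_eq,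
      ← key fun y => Real.fourierChar (-inner ℝ y (a⁻¹ • ξ)) • k y, ← integral_smul]
    congr 1; funext y
    rw [smul_comm, real_inner_smul_left, real_inner_smul_right, mul_inv_cancel_left₀ ha.ne']
  · rw [← key fun y => ‖k y‖, ← integral_smul]
    congr 1; funext y
    rw [norm_smul, Real.norm_of_nonneg had.le, smul_eq_mul]

/-! ### Frequency-localized heat multipliers -/

/-- The symbol `(2π|l|)^{2β}` of `(-Δ)^β`. -/
def rate {d : ℕ} (β : ℝ) (l : Fin d → ℤ) : ℝ := (2 * Real.pi * ‖freq l‖) ^ (2 * β)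

theorem rate_nonneg {d : ℕ} (β : ℝ) (l : Fin d → ℤ) : 0 ≤ rate β l := by
  unfold rate; positivity

theorem finite_freq_le {d : ℕ} (R : ℝ) : {l : Fin d → ℤ | ‖freq l‖ ≤ R}.Finite := by
  refine (Set.finite_Icc (fun _ => -⌈R⌉) (fun _ => ⌈R⌉)).subset fun l hl => ?_
  have h : ∀ i, |(l i : ℝ)| ≤ ⌈R⌉ := fun i => by
    have := PiLp.norm_apply_le (freq l) i
    rw [Real.norm_eq_abs] at this
    exact (this.trans hl).trans (Int.le_ceil R)
  refine ⟨fun i => ?_, fun i => ?_⟩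
  · exact_mod_cast (abs_le.1 (h i)).1
  · exact_mod_cast (abs_le.1 (h i)).2

theorem summable_annulus {d : ℕ} {ψ : Vec d → ℂ} {R : ℝ}
    (hψ : ∀ ξ, ψ ξ ≠ 0 → ‖ξ‖ ≤ R) (j : ℤ) (a : (Fin d → ℤ) → ℂ) :
    Summable fun l => ψ ((2 : ℝ) ^ (-j) • freq l) * a l := by
  refine summable_of_hasFiniteSupport ((finite_freq_le (R * 2 ^ j)).subset fun l hl => ?_)
  have h := hψ _ (left_ne_zero_of_mul hl)
  rw [norm_smul, Real.norm_of_nonneg (by positivity), zpow_neg,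
    inv_mul_le_iff₀ (by positivity)] at h
  rw [mem_ofPred_eq, mul_comm]; exact h

/-- The smooth function that equals `x⁻¹ e^{-1/x}` for `x > 0` and `0` for `x ≤ 0`. -/
def invMulExpNegInv (x : ℝ) : ℝ := x⁻¹ * expNegInvGlue x

theorem contDiff_invMulExpNegInv : ContDiff ℝ ∞ invMulExpNegInv := by
  have h := expNegInvGlue.contDiff_polynomial_eval_inv_mul (n := ⊤) Polynomial.X
  simp only [Polynomial.eval_X] at h
  exact h

/-- The multiplier `ψ(2^{-j} l) e^{-τ (2π|l|)^{2β}}`, with `ψ` smooth and supported in an annulus,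
is bounded on `C(𝕋^d)` with norm `O((1 + τ 2^{2βj})⁻¹)`. -/
theorem exists_block_bound {d : ℕ} {β : ℝ} {ψ : Vec d → ℂ}
    (hψ : ContDiff ℝ ∞ ψ) (hsupp : ∀ ξ, ψ ξ ≠ 0 → 1 / 2 ≤ ‖ξ‖ ∧ ‖ξ‖ ≤ 4) :
    ∃ C : ℝ, 0 ≤ C ∧ ∀ (j : ℤ) (τ : ℝ), 0 ≤ τ → ∀ f : C(Torus d, ℂ),
      ‖synth fun l => ψ ((2 : ℝ) ^ (-j) • freq l) *
          (Real.exp (-τ * rate β l) * mFourierCoeff f l)‖ ≤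
        C * (1 + τ * ((2 : ℝ) ^ j) ^ (2 * β))⁻¹ * ‖f‖ := by
  set g : Vec d → ℝ := fun ξ => (2 * Real.pi * ‖ξ‖) ^ (2 * β)
  have hgpos : ∀ ξ : Vec d, ξ ≠ 0 → 0 < g ξ := fun ξ hξ =>
    Real.rpow_pos_of_pos (mul_pos (by positivity) (norm_pos_iff.2 hξ)) _
  -- With `ρ = 1/(1+r)`, the symbol `H(ρ, ·)` is `(1+r) ψ e^{-r g}`; it extends smoothly to `ρ = 0`.
  set H : ℝ × Vec d → ℂ := fun z =>
    ψ z.2 * ((Real.exp (g z.2) / g z.2 * invMulExpNegInv (z.1 / g z.2) : ℝ) : ℂ)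
  have hH : ContDiff ℝ ∞ H := by
    rw [contDiff_iff_contDiffAt]
    rintro ⟨ρ, ξ⟩
    by_cases hξ : ‖ξ‖ < 1 / 2
    · have h0 : H =ᶠ[𝓝 (ρ, ξ)] fun _ => 0 := by
        have : ∀ᶠ z : ℝ × Vec d in 𝓝 (ρ, ξ), ‖z.2‖ < 1 / 2 :=
          (continuous_snd.norm).continuousAt.eventually_lt continuousAt_const hξ
        filter_upwards [this] with z hz
        have : ψ z.2 = 0 := by
          by_contra h
          exact absurd (hsupp _ h).1 (not_le.2 hz)
        simp [H, this]
      exact contDiffAt_const.congr_of_eventuallyEq h0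
    · have hξ0 : ξ ≠ 0 := by
        rintro rfl
        exact hξ (by simp)
      have hg : ContDiffAt ℝ ∞ (fun z : ℝ × Vec d => g z.2) (ρ, ξ) := by
        refine ContDiffAt.rpow_const_of_ne ?_ (mul_pos (by positivity) (norm_pos_iff.2 hξ0)).ne'
        exact contDiffAt_const.mul (contDiffAt_snd.norm ℝ hξ0)
      have hg0 := (hgpos ξ hξ0).ne'
      refine (hψ.contDiffAt.comp (ρ, ξ) contDiffAt_snd).mul ?_
      refine Complex.ofRealCLM.contDiff.contDiffAt.comp (ρ, ξ) ?_
      refine (hg.exp.div hg hg0).mul ?_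
      exact contDiff_invMulExpNegInv.contDiffAt.comp (ρ, ξ) (contDiffAt_fst.div hg hg0)
  obtain ⟨C, hC0, hC⟩ := exists_kernel_family hH (R := 4) fun ρ ξ hξ => by
    have : ψ ξ = 0 := by
      by_contra h
      exact absurd (hsupp _ h).2 (not_le.2 hξ)
    simp [H, this]
  refine ⟨C, hC0, fun j τ hτ f => ?_⟩
  set N : ℝ := (2 : ℝ) ^ j
  have hN : 0 < N := by positivity
  set r : ℝ := τ * N ^ (2 * β)
  have hr : 0 ≤ r := by positivity
  obtain ⟨k, hk, hkH, hkC⟩ := hC (1 + r)⁻¹ ⟨by positivity, inv_le_one_of_one_le₀ (by linarith)⟩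
  obtain ⟨k', hk', hkk', hn⟩ := exists_kernel_dilation hk hN
  have hval : ∀ l : Fin d → ℤ, H ((1 + r)⁻¹, N⁻¹ • freq l) =
      (1 + r : ℝ) * (ψ ((2 : ℝ) ^ (-j) • freq l) * Real.exp (-τ * rate β l)) := by
    intro l
    have hNj : (2 : ℝ) ^ (-j) = N⁻¹ := zpow_neg _ _
    rw [hNj]
    by_cases h0 : ψ (N⁻¹ • freq l) = 0
    · simp [H, h0]
    have hne : N⁻¹ • freq l ≠ 0 := by
      intro h
      have := (hsupp _ h0).1
      rw [h] at this; norm_num at this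
    have hg := hgpos _ hne
    have hrate : rate β l = N ^ (2 * β) * g (N⁻¹ • freq l) := by
      simp only [rate, g, norm_smul, Real.norm_of_nonneg (inv_pos.2 hN).le]
      rw [← Real.mul_rpow hN.le (by positivity)]
      congr 1; field_simp
    simp only [H]
    rw [mul_left_comm]
    congr 1
    rw [← Complex.ofReal_mul]
    congr 1
    have hpos : 0 < (1 + r)⁻¹ / g (N⁻¹ • freq l) := by positivity
    have hx : ((1 + r)⁻¹ / g (N⁻¹ • freq l))⁻¹ = g (N⁻¹ • freq l) * (1 + r) := by
      rw [inv_div, div_inv_eq_mul]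
    simp only [invMulExpNegInv, expNegInvGlue, not_le.2 hpos, if_false]
    rw [hx, hrate]
    have : -τ * (N ^ (2 * β) * g (N⁻¹ • freq l)) =
        g (N⁻¹ • freq l) + -(g (N⁻¹ • freq l) * (1 + r)) := by
      simp only [r]; ring
    rw [this, Real.exp_add]
    generalize Real.exp (g (N⁻¹ • freq l)) = e
    generalize Real.exp (-(g (N⁻¹ • freq l) * (1 + r))) = e'
    field_simp [hg.ne']
  have hmain := norm_synth_mul_le_of_kernel hk' (m := fun l => H ((1 + r)⁻¹, N⁻¹ • freq l))
    (fun l => by rw [hkk', hkH]) f (by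
      simp only [hval, mul_assoc]
      exact (summable_annulus (fun ξ h => (hsupp ξ h).2) j _).mul_left _)
  have hscale : (synth fun l => H ((1 + r)⁻¹, N⁻¹ • freq l) * mFourierCoeff f l) =
      ((1 + r : ℝ) : ℂ) • synth fun l =>
        ψ ((2 : ℝ) ^ (-j) • freq l) * (Real.exp (-τ * rate β l) * mFourierCoeff f l) := by
    simp only [hval, synth]
    rw [← (summable_synth (summable_annulus (fun ξ h => (hsupp ξ h).2) j
      (fun l => Real.exp (-τ * rate β l) * mFourierCoeff f l))).tsum_const_smul]
    congr 1; funext l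
    rw [smul_smul]; congr 1; ring
  rw [hscale, norm_smul, Complex.norm_real, Real.norm_of_nonneg (by positivity), hn] at hmain
  rw [mul_right_comm, mul_comm, le_inv_mul_iff₀ (by positivity)]
  exact hmain.trans (by gcongr)

/-! ### Lattice sums and dyadic sums -/

theorem freq_zero {d : ℕ} : freq (0 : Fin d → ℤ) = 0 := by
  ext i; simp [freq]

theorem norm_freq_neg {d : ℕ} (l : Fin d → ℤ) : ‖freq (-l)‖ = ‖freq l‖ := by
  have : freq (-l) = -freq l := by ext i; simp [freq]
  rw [this, norm_neg]

theorem one_le_norm_freq {d : ℕ} {l : Fin d → ℤ} (hl : l ≠ 0) : 1 ≤ ‖freq l‖ := by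
  obtain ⟨i, hi⟩ := Function.ne_iff.1 hl
  have h1 := PiLp.norm_apply_le (freq l) i
  refine le_trans ?_ h1
  rw [Real.norm_eq_abs]
  have : (1 : ℤ) ≤ |l i| := Int.one_le_abs hi
  simp only [freq]
  exact_mod_cast this

theorem freq_ne_zero {d : ℕ} {l : Fin d → ℤ} (hl : l ≠ 0) : freq l ≠ 0 := fun h => by
  have := one_le_norm_freq hl
  rw [h, norm_zero] at this
  norm_num at this

theorem freq_injective {d : ℕ} : Function.Injective (freq : (Fin d → ℤ) → Vec d) := by
  intro l m h
  funext i
  have := congrArg (fun v : Vec d => v i) h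
  simpa [freq] using this

theorem exists_summable_norm_freq (d : ℕ) :
    ∃ K : ℝ, 0 < K ∧ Summable fun l : Fin d → ℤ => ‖freq l‖ ^ (-K) := by
  set L : Submodule ℤ (Vec d) :=
    Submodule.span ℤ (Set.range (EuclideanSpace.basisFun (Fin d) ℝ).toBasis)
  have hmem : ∀ l : Fin d → ℤ, freq l ∈ L := by
    intro l
    have : freq l = ∑ i, l i • (EuclideanSpace.basisFun (Fin d) ℝ).toBasis i := by
      ext j
      simp [freq, Pi.single_apply]
    rw [this]
    exact Submodule.sum_mem _ fun i _ => Submodule.smul_mem _ _ (Submodule.subset_span ⟨i, rfl⟩)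
  have h := ZLattice.summable_norm_rpow L (-((Module.finrank ℤ L : ℝ) + 1)) (by linarith)
  refine ⟨(Module.finrank ℤ L : ℝ) + 1, by positivity, ?_⟩
  exact h.comp_injective (i := fun l : Fin d → ℤ => (⟨freq l, hmem l⟩ : L)) fun l m hlm =>
    freq_injective (Subtype.ext_iff.1 hlm)

theorem summable_exp_rate {d : ℕ} {β τ : ℝ} (hβ : 0 < β) (hτ : 0 < τ) {m : ℝ} (hm : 0 ≤ m) :
    Summable fun l : Fin d → ℤ => (1 + ‖freq l‖) ^ m * Real.exp (-τ * rate β l) := by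
  obtain ⟨K, hK0, hK⟩ := exists_summable_norm_freq d
  obtain ⟨n, hn⟩ := exists_nat_ge ((m + K) / (2 * β))
  rw [div_le_iff₀ (by positivity)] at hn
  set A : ℝ := 2 ^ m * (n.factorial * (τ * (2 * Real.pi) ^ (2 * β)) ^ (-(n : ℝ)))
  have hA : 0 ≤ A := by positivity
  refine Summable.of_nonneg_of_le (fun l => by positivity)
    (f := fun l => A * ‖freq l‖ ^ (-K) + if l = 0 then 1 else 0) (fun l => ?_)
    ((hK.mul_left A).add (summable_of_hasFiniteSupport ?_))
  · by_cases hl : l = 0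
    · subst hl
      rw [freq_zero, norm_zero, if_pos rfl, add_zero, Real.one_rpow, one_mul]
      have h1 : Real.exp (-τ * rate β (0 : Fin d → ℤ)) ≤ 1 :=
        Real.exp_le_one_iff.2 (by have := rate_nonneg β (0 : Fin d → ℤ); nlinarith)
      have h2 : 0 ≤ A * (0 : ℝ) ^ (-K) := by positivity
      linarith
    · rw [if_neg hl, add_zero]
      have h1 := one_le_norm_freq hl
      set x := ‖freq l‖
      have hx : 0 < x := by linarith
      have hu : 0 < τ * rate β l := by
        unfold rate
        have : 0 < 2 * Real.pi * ‖freq l‖ := mul_pos (by positivity) hx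
        positivity
      have h2 : Real.exp (-τ * rate β l) ≤ n.factorial * (τ * rate β l) ^ (-(n : ℝ)) := by
        have := Real.pow_div_factorial_le_exp (τ * rate β l) hu.le n
        rw [neg_mul, Real.exp_neg, Real.rpow_neg hu.le, Real.rpow_natCast]
        rw [← div_eq_mul_inv, inv_le_comm₀ (Real.exp_pos _) (by positivity), inv_div]
        exact this
      have h3 : (τ * rate β l) ^ (-(n : ℝ)) =
          (τ * (2 * Real.pi) ^ (2 * β)) ^ (-(n : ℝ)) * x ^ (-(2 * β * n)) := by
        unfold rate
        rw [Real.mul_rpow (by positivity) hx.le, ← mul_assoc, Real.mul_rpow (by positivity)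
          (by positivity), ← Real.rpow_mul hx.le, mul_neg]
      have h4 : (1 + x) ^ m ≤ 2 ^ m * x ^ m := by
        rw [← Real.mul_rpow (by norm_num) hx.le]
        exact Real.rpow_le_rpow (by positivity) (by linarith) hm
      have h5 : x ^ m * x ^ (-(2 * β * n)) ≤ x ^ (-K) := by
        rw [← Real.rpow_add hx]
        exact Real.rpow_le_rpow_of_exponent_le h1 (by linarith)
      calc (1 + x) ^ m * Real.exp (-τ * rate β l)
          ≤ (2 ^ m * x ^ m) * (n.factorial * ((τ * (2 * Real.pi) ^ (2 * β)) ^ (-(n : ℝ)) *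
              x ^ (-(2 * β * n)))) := by
            rw [h3] at h2
            gcongr
        _ = A * (x ^ m * x ^ (-(2 * β * n))) := by simp only [A]; ring
        _ ≤ A * x ^ (-K) := by gcongr
  · refine (Set.finite_singleton (0 : Fin d → ℤ)).subset fun l hl => ?_
    by_contra h
    exact hl (if_neg h)

theorem summable_pow_natAbs {r : ℝ} (h0 : 0 ≤ r) (h1 : r < 1) :
    Summable fun m : ℤ => r ^ m.natAbs := by
  refine Summable.of_nat_of_neg ?_ ?_ <;> simpa using summable_geometric_of_lt_one h0 h1

theorem two_zpow_rpow_natCast (n : ℕ) (x : ℝ) : ((2 : ℝ) ^ (n : ℤ)) ^ x = ((2 : ℝ) ^ x) ^ n := by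
  rw [zpow_natCast, ← Real.rpow_natCast, ← Real.rpow_natCast, ← Real.rpow_mul (by norm_num),
    ← Real.rpow_mul (by norm_num), mul_comm]

theorem dyadic_term_le {p q : ℝ} (hp : 0 < p) (hpq : p < q) {θ : ℝ} (hθ2 : 1 / 2 ≤ θ)
    (hθ1 : θ ≤ 1) (m : ℤ) :
    ((2 : ℝ) ^ m * θ) ^ p * (1 + ((2 : ℝ) ^ m * θ) ^ q)⁻¹ ≤
      2 ^ (q - p) * max ((2 : ℝ) ^ (-(q - p))) ((2 : ℝ) ^ (-p)) ^ m.natAbs := by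
  have hθ : 0 < θ := by linarith
  have hc : (1 : ℝ) ≤ 2 ^ (q - p) := Real.one_le_rpow (by norm_num) (by linarith)
  have hN : (0 : ℝ) < 2 ^ m := by positivity
  have hx : 0 < (2 : ℝ) ^ m * θ := by positivity
  rcases le_or_gt 0 m with hm | hm
  · obtain ⟨n, rfl⟩ := Int.eq_ofNat_of_zero_le hm
    have h1 : ((2 : ℝ) ^ (n : ℤ) * θ) ^ p * (1 + ((2 : ℝ) ^ (n : ℤ) * θ) ^ q)⁻¹ ≤
        ((2 : ℝ) ^ (n : ℤ) * θ) ^ (-(q - p)) := by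
      rw [neg_sub, Real.rpow_sub hx, div_eq_mul_inv]
      gcongr
      linarith
    refine h1.trans ?_
    rw [Real.mul_rpow hN.le hθ.le, mul_comm, two_zpow_rpow_natCast, Int.natAbs_natCast]
    gcongr
    · rw [Real.rpow_neg hθ.le, ← Real.inv_rpow hθ.le]
      refine Real.rpow_le_rpow (by positivity) ?_ (by linarith)
      rw [inv_le_comm₀ hθ (by norm_num)]
      linarith
    · exact le_max_left _ _
  · obtain ⟨n, hn⟩ := Int.eq_ofNat_of_zero_le (neg_nonneg.2 hm.le)
    obtain rfl : m = -(n : ℤ) := by rw [← hn]; simp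
    have h1 : ((2 : ℝ) ^ (-(n : ℤ)) * θ) ^ p * (1 + ((2 : ℝ) ^ (-(n : ℤ)) * θ) ^ q)⁻¹ ≤
        ((2 : ℝ) ^ (-(n : ℤ)) * θ) ^ p :=
      mul_le_of_le_one_right (by positivity)
        (inv_le_one_of_one_le₀ (by linarith [Real.rpow_pos_of_pos hx q]))
    have h2 : ((2 : ℝ) ^ (-(n : ℤ)) * θ) ^ p ≤ ((2 : ℝ) ^ (-(n : ℤ))) ^ p :=
      Real.rpow_le_rpow hx.le (mul_le_of_le_one_right (by positivity) hθ1) hp.le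
    have h3 : ((2 : ℝ) ^ (-(n : ℤ))) ^ p = ((2 : ℝ) ^ (-p)) ^ n := by
      rw [zpow_neg, Real.inv_rpow (by positivity), ← Real.rpow_neg (by positivity),
        two_zpow_rpow_natCast]
    rw [h3] at h2
    refine (h1.trans h2).trans ?_
    rw [Int.natAbs_neg, Int.natAbs_natCast]
    refine le_trans ?_ (le_mul_of_one_le_left (by positivity) hc)
    gcongr
    exact le_max_right _ _

/-- The dyadic sum `∑_j 2^{jp} / (1 + t 2^{jq})` with `0 < p < q` is `O(t^{-p/q})`: it is a
two-sided geometric sum around the index `j` with `2^{jq} ≈ 1/t`. -/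
theorem exists_dyadic_sum_bound {p q : ℝ} (hp : 0 < p) (hpq : p < q) :
    ∃ C : ℝ, 0 ≤ C ∧ ∀ t : ℝ, 0 < t →
      Summable (fun j : ℤ => ((2 : ℝ) ^ j) ^ p * (1 + t * ((2 : ℝ) ^ j) ^ q)⁻¹) ∧
      ∑' j : ℤ, ((2 : ℝ) ^ j) ^ p * (1 + t * ((2 : ℝ) ^ j) ^ q)⁻¹ ≤ C * t ^ (-(p / q)) := by
  have hq : 0 < q := hp.trans hpq
  set r : ℝ := max ((2 : ℝ) ^ (-(q - p))) ((2 : ℝ) ^ (-p))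
  have hr0 : 0 ≤ r := le_max_of_le_left (by positivity)
  have hr1 : r < 1 := max_lt (Real.rpow_lt_one_of_one_lt_of_neg (by norm_num) (by linarith))
    (Real.rpow_lt_one_of_one_lt_of_neg (by norm_num) (by linarith))
  set h : ℤ → ℝ := fun m => 2 ^ (q - p) * r ^ m.natAbs
  have hh : Summable h := (summable_pow_natAbs hr0 hr1).mul_left _
  refine ⟨∑' m, h m, tsum_nonneg fun m => by positivity, fun t ht => ?_⟩
  set u : ℝ := t ^ (1 / q)
  have hu : 0 < u := by positivity
  have huq : u ^ q = t := by
    rw [← Real.rpow_mul ht.le, one_div_mul_cancel hq.ne', Real.rpow_one]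
  have hup : u ^ (-p) = t ^ (-(p / q)) := by
    rw [← Real.rpow_mul ht.le]; congr 1; ring
  obtain ⟨j₀, hj1, hj2⟩ := exists_mem_Ico_zpow (y := (2 : ℝ)) (inv_pos.2 hu) one_lt_two
  set θ : ℝ := 2 ^ j₀ * u
  have hθ1 : θ ≤ 1 := by
    have := mul_le_mul_of_nonneg_right hj1 hu.le
    rwa [inv_mul_cancel₀ hu.ne'] at this
  have hθ2 : 1 / 2 ≤ θ := by
    have := mul_le_mul_of_nonneg_right hj2.le hu.le
    rw [inv_mul_cancel₀ hu.ne', zpow_add₀ two_ne_zero, zpow_one] at this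
    simp only [θ]; linarith
  have hθ : 0 < θ := by positivity
  have hterm : ∀ j : ℤ, ((2 : ℝ) ^ j) ^ p * (1 + t * ((2 : ℝ) ^ j) ^ q)⁻¹ ≤
      t ^ (-(p / q)) * h (j - j₀) := by
    intro j
    set x : ℝ := 2 ^ (j - j₀) * θ
    have hx : 0 < x := by positivity
    have hxj : (2 : ℝ) ^ j = x * u⁻¹ := by
      simp only [x, θ, zpow_sub₀ (two_ne_zero (α := ℝ))]
      field_simp
    have e1 : ((2 : ℝ) ^ j) ^ p = x ^ p * t ^ (-(p / q)) := by
      rw [hxj, Real.mul_rpow hx.le (by positivity), Real.inv_rpow hu.le, ← Real.rpow_neg hu.le, hup]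
    have e2 : t * ((2 : ℝ) ^ j) ^ q = x ^ q := by
      rw [hxj, Real.mul_rpow hx.le (by positivity), Real.inv_rpow hu.le, huq]
      field_simp
    rw [e1, e2, mul_comm (x ^ p), mul_assoc]
    exact mul_le_mul_of_nonneg_left (dyadic_term_le hp hpq hθ2 hθ1 _) (by positivity)
  clear_value h
  have hh' : Summable fun j : ℤ => h (j - j₀) := (Equiv.subRight j₀).summable_iff.2 hh
  have hs : Summable (fun j : ℤ => ((2 : ℝ) ^ j) ^ p * (1 + t * ((2 : ℝ) ^ j) ^ q)⁻¹) :=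
    Summable.of_nonneg_of_le (fun j => by positivity) hterm (hh'.mul_left _)
  refine ⟨hs, (hs.tsum_le_tsum hterm (hh'.mul_left _)).trans_eq ?_⟩
  rw [tsum_mul_left, mul_comm]
  congr 1
  exact (Equiv.subRight j₀).tsum_eq h

/-! ### Littlewood–Paley decomposition -/

theorem hasSum_bump_freq {d : ℕ} {φ : Vec d → ℝ} (hφ : IsDyadicBump φ) {l : Fin d → ℤ}
    (hl : l ≠ 0) : HasSum (fun j : ℤ => φ ((2 : ℝ) ^ (-j) • freq l)) 1 :=
  hφ.sum_eq_one _ (freq_ne_zero hl)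

theorem bump_zero {d : ℕ} {φ : Vec d → ℝ} (hφ : IsDyadicBump φ) : φ 0 = 0 := by
  by_contra h
  have := (hφ.support 0 h).1
  norm_num at this

/-- A mean-zero Fourier series is the sum of its dyadic blocks. -/
theorem norm_synth_le_tsum_blocks {d : ℕ} {φ : Vec d → ℝ} (hφ : IsDyadicBump φ)
    {a : (Fin d → ℤ) → ℂ} (ha : Summable a) (ha0 : a 0 = 0) {b : ℤ → ℝ} (hb : Summable b)
    (hab : ∀ j : ℤ, ‖synth fun l => (φ ((2 : ℝ) ^ (-j) • freq l) : ℂ) * a l‖ ≤ b j) :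
    ‖synth a‖ ≤ ∑' j, b j := by
  have hb0 : ∀ j, 0 ≤ b j := fun j => (norm_nonneg _).trans (hab j)
  rw [ContinuousMap.norm_le _ (tsum_nonneg hb0)]
  intro x
  set F : (Fin d → ℤ) → ℤ → ℂ := fun l j =>
    mFourier l x * ((φ ((2 : ℝ) ^ (-j) • freq l) : ℂ) * a l)
  have hFsum : ∀ l, HasSum (F l) (mFourier l x * a l) := by
    intro l
    by_cases hl : l = 0
    · subst hl; simp [F, ha0, hasSum_zero]
    · have := (Complex.hasSum_ofReal.2 (hasSum_bump_freq hφ hl)).mul_right (a l)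
      rw [Complex.ofReal_one, one_mul] at this
      exact this.mul_left (mFourier l x)
  have hFnorm : ∀ l, HasSum (fun j => ‖F l j‖) ‖a l‖ := by
    intro l
    by_cases hl : l = 0
    · subst hl; simp [F, ha0, hasSum_zero]
    · have := (hasSum_bump_freq hφ hl).mul_right ‖a l‖
      rw [one_mul] at this
      refine this.congr_fun fun j => ?_
      simp only [F, norm_mul, norm_mFourier_apply, one_mul, Complex.norm_real,
        Real.norm_of_nonneg (hφ.mem_Icc _).1]
  have hFs : Summable (Function.uncurry F) := by
    refine .of_norm ((summable_prod_of_nonneg fun _ => norm_nonneg _).2 ⟨fun l => ?_, ?_⟩)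
    · exact (hFnorm l).summable
    · simpa only [Function.uncurry, (hFnorm _).tsum_eq] using ha.norm
  have hblock : ∀ j : ℤ, ∑' l, F l j =
      synth (fun l => (φ ((2 : ℝ) ^ (-j) • freq l) : ℂ) * a l) x := by
    intro j
    rw [synth_apply]
    refine Summable.of_norm_bounded ha.norm fun l => ?_
    rw [norm_mul, Complex.norm_real, Real.norm_of_nonneg (hφ.mem_Icc _).1]
    exact mul_le_of_le_one_left (norm_nonneg _) (hφ.mem_Icc _).2
  have hpt : ∀ j : ℤ, ‖∑' l, F l j‖ ≤ b j := fun j => by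
    rw [hblock]
    exact (ContinuousMap.norm_coe_le_norm _ x).trans (hab j)
  have hn : Summable fun j => ‖∑' l, F l j‖ := .of_nonneg_of_le (fun _ => norm_nonneg _) hpt hb
  calc ‖synth a x‖ = ‖∑' l, ∑' j, F l j‖ := by
        rw [synth_apply ha]; simp only [(hFsum _).tsum_eq]
    _ = ‖∑' j, ∑' l, F l j‖ := by rw [Summable.tsum_comm hFs]
    _ ≤ ∑' j, ‖∑' l, F l j‖ := norm_tsum_le_tsum_norm hn
    _ ≤ ∑' j, b j := hn.tsum_le_tsum hpt hb

theorem bump_freq_ne_zero {d : ℕ} {φ : Vec d → ℝ} (hφ : IsDyadicBump φ) {l : Fin d → ℤ} {j : ℤ}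
    (h : φ ((2 : ℝ) ^ (-j) • freq l) ≠ 0) :
    3 / 4 * (2 : ℝ) ^ j ≤ ‖freq l‖ ∧ ‖freq l‖ ≤ 8 / 3 * 2 ^ j := by
  have h1 := hφ.support _ h
  have h2 : (0 : ℝ) < 2 ^ j := by positivity
  rw [norm_smul, Real.norm_of_nonneg (by positivity), zpow_neg, inv_mul_le_iff₀ h2,
    le_inv_mul_iff₀ h2] at h1
  exact ⟨by linarith [h1.1], by linarith [h1.2]⟩

/-- Only the three blocks around `|l| ≈ 2^j` see the frequency `l`, so bounds on the blocks bound
the coefficients. -/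
theorem norm_le_of_block_le {d : ℕ} {φ : Vec d → ℝ} (hφ : IsDyadicBump φ) {s M : ℝ} (hs : 0 ≤ s)
    (hM : 0 ≤ M) {l : Fin d → ℤ} (hl : l ≠ 0) {z : ℂ}
    (hz : ∀ j : ℤ, ‖(φ ((2 : ℝ) ^ (-j) • freq l) : ℂ) * z‖ ≤ M * ((2 : ℝ) ^ j) ^ s) :
    ‖z‖ ≤ 3 * M * (2 * ‖freq l‖) ^ s := by
  have h1 := one_le_norm_freq hl
  have hl0 : 0 < ‖freq l‖ := by linarith
  obtain ⟨j₀, hj1, hj2⟩ := exists_mem_Ico_zpow (y := (2 : ℝ)) hl0 one_lt_two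
  have h2 : (0 : ℝ) < 2 ^ j₀ := by positivity
  rw [zpow_add_one₀ two_ne_zero] at hj2
  have hsupp : ∀ j ∉ Finset.Icc (j₀ - 1) (j₀ + 1), φ ((2 : ℝ) ^ (-j) • freq l) = 0 := by
    intro j hj
    by_contra h
    obtain ⟨ha, hb⟩ := bump_freq_ne_zero hφ h
    rw [Finset.mem_Icc, not_and_or, not_le, not_le] at hj
    rcases hj with hj | hj
    · have : (2 : ℝ) ^ j ≤ 2 ^ (j₀ - 2) := zpow_le_zpow_right₀ one_le_two (by omega)
      rw [zpow_sub₀ two_ne_zero] at this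
      norm_num at this
      linarith
    · have : (2 : ℝ) ^ (j₀ + 2) ≤ 2 ^ j := zpow_le_zpow_right₀ one_le_two (by omega)
      rw [zpow_add₀ two_ne_zero] at this
      norm_num at this
      linarith
  have hsum : ∑ j ∈ Finset.Icc (j₀ - 1) (j₀ + 1), φ ((2 : ℝ) ^ (-j) • freq l) = 1 :=
    (hasSum_sum_of_ne_finset_zero hsupp).unique (hasSum_bump_freq hφ hl)
  have hz' : z = ∑ j ∈ Finset.Icc (j₀ - 1) (j₀ + 1), (φ ((2 : ℝ) ^ (-j) • freq l) : ℂ) * z := by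
    rw [← Finset.sum_mul, ← Complex.ofReal_sum, hsum, Complex.ofReal_one, one_mul]
  have hj : ∀ j ∈ Finset.Icc (j₀ - 1) (j₀ + 1),
      ‖(φ ((2 : ℝ) ^ (-j) • freq l) : ℂ) * z‖ ≤ M * (2 * ‖freq l‖) ^ s := by
    intro j hj
    refine (hz j).trans ?_
    gcongr
    have : (2 : ℝ) ^ j ≤ 2 ^ (j₀ + 1) :=
      zpow_le_zpow_right₀ one_le_two (Finset.mem_Icc.1 hj).2
    rw [zpow_add_one₀ two_ne_zero] at this
    linarith
  have h3 := norm_sum_le_of_le _ hj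
  rw [← hz', Finset.sum_const, Int.card_Icc] at h3
  have : (j₀ + 1 + 1 - (j₀ - 1)).toNat = 3 := by omega
  rw [this, nsmul_eq_mul] at h3
  push_cast at h3
  linarith

/-! ### The heat semigroup with drift -/

/-- The symbol `e^{-τ (2π|l|)^{2β} - 2πi τ c·l}` of `e^{-τ((-Δ)^β + c·∇)}`. -/
def propagator {d : ℕ} (β : ℝ) (c : Fin d → ℝ) (τ : ℝ) (l : Fin d → ℤ) : ℂ :=
  mFourier l (toTorus (-τ • c)) * Real.exp (-τ * rate β l)

theorem norm_propagator {d : ℕ} (β : ℝ) (c : Fin d → ℝ) (τ : ℝ) (l : Fin d → ℤ) :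
    ‖propagator β c τ l‖ = Real.exp (-τ * rate β l) := by
  rw [propagator, norm_mul, norm_mFourier_apply, one_mul, Complex.norm_real,
    Real.norm_of_nonneg (Real.exp_pos _).le]

theorem rate_neg {d : ℕ} (β : ℝ) (l : Fin d → ℤ) : rate β (-l) = rate β l := by
  simp only [rate, norm_freq_neg]

theorem propagator_neg {d : ℕ} (β : ℝ) (c : Fin d → ℝ) (τ : ℝ) (l : Fin d → ℤ) :
    propagator β c τ (-l) = starRingEnd ℂ (propagator β c τ l) := by
  simp only [propagator, mFourier_neg, rate_neg, map_mul, Complex.conj_ofReal]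

theorem propagator_eq_exp {d : ℕ} (β : ℝ) (c : Fin d → ℝ) (τ : ℝ) (l : Fin d → ℤ) :
    propagator β c τ l = Complex.exp (-τ * (rate β l +
      2 * Real.pi * Complex.I * ∑ i, (l i : ℂ) * (c i : ℂ))) := by
  rw [propagator, mFourier_toTorus, Complex.ofReal_exp, ← Complex.exp_add]
  congr 1
  simp only [Pi.smul_apply, smul_eq_mul]
  push_cast
  have : ∀ i, (l i : ℂ) * (-(τ : ℂ) * (c i : ℂ)) = -τ * ((l i : ℂ) * (c i : ℂ)) := fun i => by ring
  simp only [this, ← Finset.mul_sum]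
  ring

theorem continuous_propagator {d : ℕ} (β : ℝ) (c : Fin d → ℝ) (l : Fin d → ℤ) :
    Continuous fun τ => propagator β c τ l := by
  simp only [propagator_eq_exp]
  fun_prop

/-- The coefficients `a` grow at most like `M (1 + |l|)^m`. -/
def GrowthLE {d : ℕ} (m M : ℝ) (a : (Fin d → ℤ) → ℂ) : Prop :=
  ∀ l, ‖a l‖ ≤ M * (1 + ‖freq l‖) ^ m

theorem summable_propagator_mul {d : ℕ} {β : ℝ} (hβ : 0 < β) (c : Fin d → ℝ) {τ : ℝ} (hτ : 0 < τ)
    {m M : ℝ} (hm : 0 ≤ m) {a : (Fin d → ℤ) → ℂ} (ha : GrowthLE m M a) :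
    Summable fun l => propagator β c τ l * a l := by
  refine Summable.of_norm_bounded ((summable_exp_rate hβ hτ hm).mul_left M) fun l => ?_
  rw [norm_mul, norm_propagator, mul_comm, ← mul_assoc]
  exact mul_le_mul_of_nonneg_right (ha l) (Real.exp_pos _).le

theorem im_synth_eq_zero {d : ℕ} {a : (Fin d → ℤ) → ℂ} (ha : Summable a)
    (h : ∀ l, a (-l) = starRingEnd ℂ (a l)) (x : Torus d) : (synth a x).im = 0 := by
  rw [← Complex.conj_eq_iff_im, synth_apply ha, Complex.conj_tsum,
    ← (Equiv.neg (Fin d → ℤ)).tsum_eq]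
  refine tsum_congr fun l => ?_
  simp only [Equiv.neg_apply, map_mul, h, Complex.conj_conj, mFourier_neg]

theorem mFourierCoeff_neg {d : ℕ} {f : C(Torus d, ℂ)} (hf : ∀ x, (f x).im = 0) (l : Fin d → ℤ) :
    mFourierCoeff f (-l) = starRingEnd ℂ (mFourierCoeff f l) := by
  rw [mFourierCoeff_eq, mFourierCoeff_eq, ← integral_conj]
  congr 1; funext x
  rw [map_mul, ← mFourier_neg, Complex.conj_eq_iff_im.2 (hf x)]

/-! ### Multiplier bounds, block by block -/

/-- A smooth cut-off equal to `1` on `3/4 ≤ |ξ| ≤ 8/3` and supported in `1/2 ≤ |ξ| ≤ 4`. -/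
def fatBump {d : ℕ} (ξ : Vec d) : ℝ :=
  Real.smoothTransition ((‖ξ‖ ^ 2 - 1 / 4) * 4) * Real.smoothTransition ((16 - ‖ξ‖ ^ 2) / 8)

theorem contDiff_fatBump {d : ℕ} : ContDiff ℝ ∞ (fatBump : Vec d → ℝ) := by
  have h : ContDiff ℝ ∞ fun ξ : Vec d => ‖ξ‖ ^ 2 := contDiff_norm_sq ℝ
  refine (Real.smoothTransition.contDiff.comp ((h.sub contDiff_const).mul contDiff_const)).mul
    (Real.smoothTransition.contDiff.comp ((contDiff_const.sub h).div_const 8))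

theorem fatBump_support {d : ℕ} {ξ : Vec d} (h : fatBump ξ ≠ 0) : 1 / 2 ≤ ‖ξ‖ ∧ ‖ξ‖ ≤ 4 := by
  have h1 := left_ne_zero_of_mul h
  have h2 := right_ne_zero_of_mul h
  rw [Ne, Real.smoothTransition.zero_iff_nonpos, not_le] at h1 h2
  have := norm_nonneg ξ
  constructor <;> nlinarith

theorem fatBump_eq_one {d : ℕ} {ξ : Vec d} (h1 : 3 / 4 ≤ ‖ξ‖) (h2 : ‖ξ‖ ≤ 8 / 3) :
    fatBump ξ = 1 := by
  have h0 := norm_nonneg ξ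
  rw [fatBump, Real.smoothTransition.one_of_one_le (by nlinarith),
    Real.smoothTransition.one_of_one_le (by nlinarith), one_mul]

theorem bump_support_wide {d : ℕ} {φ : Vec d → ℝ} (hφ : IsDyadicBump φ) {ξ : Vec d} (h : φ ξ ≠ 0) :
    1 / 2 ≤ ‖ξ‖ ∧ ‖ξ‖ ≤ 4 := by
  have := hφ.support ξ h
  constructor <;> linarith [this.1, this.2]

/-- Fourier coefficients of the dyadic block. -/
def blockCoeff {d : ℕ} (φ : Vec d → ℝ) (j : ℤ) (a : (Fin d → ℤ) → ℂ) : (Fin d → ℤ) → ℂ :=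
  fun l => (φ ((2 : ℝ) ^ (-j) • freq l) : ℂ) * a l

theorem summable_blockCoeff {d : ℕ} {φ : Vec d → ℝ} (hφ : IsDyadicBump φ) (j : ℤ)
    (a : (Fin d → ℤ) → ℂ) : Summable (blockCoeff φ j a) :=
  summable_annulus (ψ := fun ξ => (φ ξ : ℂ)) (R := 4)
    (fun _ h => (bump_support_wide hφ (by exact_mod_cast h)).2) j a

/-- The dyadic blocks are uniformly bounded on `C(𝕋^d)`. -/
theorem exists_block_le {d : ℕ} {φ : Vec d → ℝ} (hφ : IsDyadicBump φ) :
    ∃ C : ℝ, 0 ≤ C ∧ ∀ (j : ℤ) (f : C(Torus d, ℂ)),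
      ‖synth (blockCoeff φ j (mFourierCoeff f))‖ ≤ C * ‖f‖ := by
  -- at `τ = 0` the heat factor is `1`, whatever `β`
  obtain ⟨C, hC0, hC⟩ := exists_block_bound (d := d) (β := 1) (ψ := fun ξ => (φ ξ : ℂ))
    (Complex.ofRealCLM.contDiff.comp hφ.smooth) fun ξ h =>
      bump_support_wide hφ (by exact_mod_cast h)
  refine ⟨C, hC0, fun j f => ?_⟩
  have := hC j 0 le_rfl f
  simp only [neg_zero, zero_mul, Real.exp_zero, Complex.ofReal_one, one_mul, add_zero, inv_one,
    mul_one] at this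
  exact this

/-- Besov bounds on the blocks of `a` are improved by the heat flow. -/
theorem exists_heat_block_le {d : ℕ} {φ : Vec d → ℝ} (hφ : IsDyadicBump φ) (β : ℝ) :
    ∃ C : ℝ, 0 ≤ C ∧ ∀ (c : Fin d → ℝ) (a : (Fin d → ℤ) → ℂ) (j : ℤ) (t : ℝ), 0 ≤ t →
      ‖synth (blockCoeff φ j fun l => propagator β c t l * a l)‖ ≤
        C * (1 + t * ((2 : ℝ) ^ j) ^ (2 * β))⁻¹ * ‖synth (blockCoeff φ j a)‖ := by
  obtain ⟨C, hC0, hC⟩ := exists_block_bound (d := d) (β := β) (ψ := fun ξ => (fatBump ξ : ℂ))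
    (Complex.ofRealCLM.contDiff.comp contDiff_fatBump) fun ξ h =>
      fatBump_support (by exact_mod_cast h)
  refine ⟨C, hC0, fun c a j t ht => ?_⟩
  refine le_trans ?_ (hC j t ht _)
  have hs : Summable fun l => (fatBump ((2 : ℝ) ^ (-j) • freq l) : ℂ) *
      (Real.exp (-t * rate β l) * mFourierCoeff (synth (blockCoeff φ j a)) l) :=
    summable_annulus (ψ := fun ξ => (fatBump ξ : ℂ)) (R := 4)
      (fun _ h => (fatBump_support (by exact_mod_cast h)).2) j _
  refine le_trans (le_of_eq ?_) (norm_synth_phase_le hs (toTorus (-t • c)))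
  congr 2; funext l
  rw [mFourierCoeff_synth (summable_blockCoeff hφ j a)]
  simp only [blockCoeff, propagator]
  by_cases h : φ ((2 : ℝ) ^ (-j) • freq l) = 0
  · rw [h]; simp
  · rw [fatBump_eq_one (hφ.support _ h).1 (hφ.support _ h).2]
    push_cast; ring

/-- The heat flow maps data whose blocks are `O(2^{js})` to bounded functions, with norm
`O(t^{-s/(2β)})`. -/
theorem exists_heat_le {d : ℕ} {φ : Vec d → ℝ} (hφ : IsDyadicBump φ) {β s : ℝ} (hs : 0 < s)
    (hsβ : s < 2 * β) :
    ∃ C : ℝ, 0 ≤ C ∧ ∀ (c : Fin d → ℝ) (a : (Fin d → ℤ) → ℂ) (M : ℝ) (t : ℝ), 0 < t → a 0 = 0 →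
      (Summable fun l => propagator β c t l * a l) →
      (∀ j : ℤ, ‖synth (blockCoeff φ j a)‖ ≤ M * ((2 : ℝ) ^ j) ^ s) →
      ‖synth fun l => propagator β c t l * a l‖ ≤ C * M * t ^ (-(s / (2 * β))) := by
  obtain ⟨C, hC0, hC⟩ := exists_heat_block_le hφ β
  obtain ⟨D, hD0, hD⟩ := exists_dyadic_sum_bound hs hsβ
  refine ⟨C * D, by positivity, fun c a M t ht ha0 hsum hM => ?_⟩
  obtain ⟨hsm, hle⟩ := hD t ht
  have hM0 : 0 ≤ M := by
    have := (norm_nonneg _).trans (hM 0)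
    simpa using this
  have h := norm_synth_le_tsum_blocks hφ hsum (by simp [ha0])
    (b := fun j => (C * M) * (((2 : ℝ) ^ j) ^ s * (1 + t * ((2 : ℝ) ^ j) ^ (2 * β))⁻¹))
    (hsm.mul_left _) fun j => by
      refine (hC c a j t ht.le).trans ?_
      calc _ ≤ C * (1 + t * ((2 : ℝ) ^ j) ^ (2 * β))⁻¹ * (M * ((2 : ℝ) ^ j) ^ s) := by
            gcongr; exact hM j
        _ = _ := by ring
  refine h.trans ?_
  rw [tsum_mul_left]
  calc _ ≤ C * M * (D * t ^ (-(s / (2 * β)))) := by gcongr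
    _ = _ := by ring

/-! ### The symbol of `ℙ div` -/

/-- The symbol `(δ_{km} - ξ_k ξ_m / |ξ|²) 2πi ξ_j`, which is homogeneous of degree one. -/
def projDivSymbol {d : ℕ} (k m j : Fin d) (ξ : Vec d) : ℂ :=
  (((if k = m then 1 else 0) - ξ k * ξ m / ‖ξ‖ ^ 2 : ℝ) : ℂ) *
    (2 * Real.pi * Complex.I * (ξ j : ℂ))

theorem projDivSymbol_freq {d : ℕ} (k m j : Fin d) (l : Fin d → ℤ) :
    projDivSymbol k m j (freq l) =
      (leraySymbol l k m : ℂ) * (2 * Real.pi * Complex.I * (l j : ℂ)) := by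
  simp [projDivSymbol, leraySymbol, freq]

theorem projDivSymbol_neg {d : ℕ} (k m j : Fin d) (l : Fin d → ℤ) :
    projDivSymbol k m j (freq (-l)) = starRingEnd ℂ (projDivSymbol k m j (freq l)) := by
  have h : freq (-l) = -freq l := by ext i; simp [freq]
  have h2 : starRingEnd ℂ 2 = 2 := Complex.conj_ofNat 2
  rw [h]
  simp [projDivSymbol, h2]

theorem projDivSymbol_smul {d : ℕ} (k m j : Fin d) {a : ℝ} (ha : 0 < a) (ξ : Vec d) :
    projDivSymbol k m j (a • ξ) = a * projDivSymbol k m j ξ := by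
  have h : (a • ξ) k * (a • ξ) m / ‖a • ξ‖ ^ 2 = ξ k * ξ m / ‖ξ‖ ^ 2 := by
    rw [norm_smul, Real.norm_of_nonneg ha.le, PiLp.smul_apply, PiLp.smul_apply, smul_eq_mul,
      smul_eq_mul, mul_pow, ← mul_div_mul_left (ξ k * ξ m) (‖ξ‖ ^ 2) (pow_ne_zero 2 ha.ne')]
    congr 1; ring
  simp only [projDivSymbol, h]
  simp only [PiLp.smul_apply, smul_eq_mul]
  push_cast; ring

theorem norm_projDivSymbol_le {d : ℕ} (k m j : Fin d) (ξ : Vec d) :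
    ‖projDivSymbol k m j ξ‖ ≤ 4 * Real.pi * ‖ξ‖ := by
  have hk := PiLp.norm_apply_le ξ k
  have hm := PiLp.norm_apply_le ξ m
  have hj := PiLp.norm_apply_le ξ j
  have h1 : ‖ξ k * ξ m / ‖ξ‖ ^ 2‖ ≤ 1 := by
    rw [norm_div, norm_mul, norm_pow, norm_norm]
    refine div_le_one_of_le₀ ?_ (by positivity)
    rw [sq]; gcongr
  have h2 : ‖((if k = m then 1 else 0) - ξ k * ξ m / ‖ξ‖ ^ 2 : ℝ)‖ ≤ 2 := by
    refine (norm_sub_le _ _).trans ?_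
    have : ‖(if k = m then 1 else 0 : ℝ)‖ ≤ 1 := by split_ifs <;> simp
    linarith
  rw [projDivSymbol, norm_mul, Complex.norm_real]
  have h3 : ‖(2 * Real.pi * Complex.I * (ξ j : ℂ))‖ = 2 * Real.pi * ‖ξ j‖ := by
    simp [abs_of_pos Real.pi_pos]
  rw [h3]
  calc _ ≤ 2 * (2 * Real.pi * ‖ξ‖) := by gcongr
    _ = _ := by ring

theorem contDiffAt_projDivSymbol {d : ℕ} (k m j : Fin d) {ξ : Vec d} (hξ : ξ ≠ 0) :
    ContDiffAt ℝ ∞ (projDivSymbol k m j) ξ := by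
  have hc : ∀ i, ContDiffAt ℝ ∞ (fun ξ : Vec d => ξ i) ξ := fun i =>
    (EuclideanSpace.proj (𝕜 := ℝ) i).contDiff.contDiffAt
  unfold projDivSymbol
  refine ContDiffAt.mul (Complex.ofRealCLM.contDiff.contDiffAt.comp ξ
    (contDiffAt_const.sub (((hc k).mul (hc m)).div (contDiff_norm_sq ℝ).contDiffAt ?_))) ?_
  · exact pow_ne_zero 2 (norm_ne_zero_iff.2 hξ)
  · exact contDiffAt_const.mul (Complex.ofRealCLM.contDiff.contDiffAt.comp ξ (hc j))

theorem growthLE_projDivSymbol {d : ℕ} (k m j : Fin d) (f : C(Torus d, ℂ)) :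
    GrowthLE 1 (4 * Real.pi * ‖f‖) fun l => projDivSymbol k m j (freq l) * mFourierCoeff f l := by
  intro l
  rw [norm_mul, Real.rpow_one]
  have h1 := norm_projDivSymbol_le k m j (freq l)
  have h2 := norm_mFourierCoeff_le f l
  calc _ ≤ (4 * Real.pi * ‖freq l‖) * ‖f‖ := by gcongr
    _ ≤ (4 * Real.pi * (1 + ‖freq l‖)) * ‖f‖ := by gcongr; linarith
    _ = _ := by ring

/-- Block bound for `e^{-τ((-Δ)^β + c·∇)} ℙ div`. -/
theorem exists_projDiv_block_le {d : ℕ} {φ : Vec d → ℝ} (hφ : IsDyadicBump φ) (β : ℝ) :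
    ∃ C : ℝ, 0 ≤ C ∧ ∀ (k m i : Fin d) (c : Fin d → ℝ) (f : C(Torus d, ℂ)) (j : ℤ) (τ : ℝ), 0 ≤ τ →
      ‖synth (blockCoeff φ j fun l => propagator β c τ l *
          (projDivSymbol k m i (freq l) * mFourierCoeff f l))‖ ≤
        C * ((2 : ℝ) ^ j * (1 + τ * ((2 : ℝ) ^ j) ^ (2 * β))⁻¹) * ‖f‖ := by
  have key : ∀ i : Fin d × Fin d × Fin d, ∃ C : ℝ, 0 ≤ C ∧ ∀ (c : Fin d → ℝ) (f : C(Torus d, ℂ))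
      (j : ℤ) (τ : ℝ), 0 ≤ τ → ‖synth (blockCoeff φ j fun l => propagator β c τ l *
          (projDivSymbol i.1 i.2.1 i.2.2 (freq l) * mFourierCoeff f l))‖ ≤
        C * ((2 : ℝ) ^ j * (1 + τ * ((2 : ℝ) ^ j) ^ (2 * β))⁻¹) * ‖f‖ := by
    rintro ⟨k, m, i⟩
    set ψ : Vec d → ℂ := fun ξ => (φ ξ : ℂ) * projDivSymbol k m i ξ
    have hψs : ∀ ξ, ψ ξ ≠ 0 → 1 / 2 ≤ ‖ξ‖ ∧ ‖ξ‖ ≤ 4 := fun ξ h =>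
      bump_support_wide hφ (by exact_mod_cast left_ne_zero_of_mul h)
    have hψ : ContDiff ℝ ∞ ψ := by
      rw [contDiff_iff_contDiffAt]
      intro ξ
      by_cases hξ : ξ = 0
      · have h0 : ψ =ᶠ[𝓝 ξ] fun _ => 0 := by
          have : ∀ᶠ η : Vec d in 𝓝 ξ, ‖η‖ < 1 / 2 :=
            continuous_norm.continuousAt.eventually_lt continuousAt_const (by simp [hξ])
          filter_upwards [this] with η hη
          by_contra h
          exact absurd (hψs η h).1 (not_le.2 hη)
        exact contDiffAt_const.congr_of_eventuallyEq h0
      · exact (Complex.ofRealCLM.contDiff.comp hφ.smooth).contDiffAt.mul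
          (contDiffAt_projDivSymbol k m i hξ)
    obtain ⟨C, hC0, hC⟩ := exists_block_bound (β := β) hψ hψs
    refine ⟨C, hC0, fun c f j τ hτ => ?_⟩
    have h := hC j τ hτ f
    have hs : Summable fun l => ψ ((2 : ℝ) ^ (-j) • freq l) *
        (Real.exp (-τ * rate β l) * mFourierCoeff f l) :=
      summable_annulus (fun ξ h => (hψs ξ h).2) j _
    have hN : (0 : ℝ) < 2 ^ j := by positivity
    have e : synth (blockCoeff φ j fun l => propagator β c τ l *
        (projDivSymbol k m i (freq l) * mFourierCoeff f l)) =
        (((2 : ℝ) ^ j : ℝ) : ℂ) • synth fun l => mFourier l (toTorus (-τ • c)) *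
          (ψ ((2 : ℝ) ^ (-j) • freq l) * (Real.exp (-τ * rate β l) * mFourierCoeff f l)) := by
      have hs' : Summable fun l => mFourier l (toTorus (-τ • c)) *
          (ψ ((2 : ℝ) ^ (-j) • freq l) * (Real.exp (-τ * rate β l) * mFourierCoeff f l)) := by
        refine .of_norm ?_
        simpa only [norm_mul, norm_mFourier_apply, one_mul] using hs.norm
      rw [synth, synth, ← (summable_synth hs').tsum_const_smul]
      congr 1; funext l
      rw [smul_smul]; congr 1
      simp only [blockCoeff, propagator, ψ]
      rw [projDivSymbol_smul k m i (by positivity), zpow_neg]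
      have : (((2 : ℝ) ^ j : ℝ) : ℂ) ≠ 0 := by exact_mod_cast hN.ne'
      push_cast at this ⊢
      field_simp
    rw [e, norm_smul, Complex.norm_real, Real.norm_of_nonneg hN.le]
    have h' := (norm_synth_phase_le hs (toTorus (-τ • c))).trans h
    calc _ ≤ (2 : ℝ) ^ j * (C * (1 + τ * ((2 : ℝ) ^ j) ^ (2 * β))⁻¹ * ‖f‖) := by gcongr
      _ = _ := by ring
  choose C hC0 hC using key
  refine ⟨∑ i, C i, Finset.sum_nonneg fun i _ => hC0 i, fun k m i c f j τ hτ => ?_⟩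
  refine (hC (k, m, i) c f j τ hτ).trans ?_
  gcongr
  exact Finset.single_le_sum (fun i _ => hC0 i) (Finset.mem_univ _)

theorem projDivSymbol_freq_zero {d : ℕ} (k m j : Fin d) : projDivSymbol k m j (freq 0) = 0 := by
  simp [projDivSymbol, freq_zero]

/-- The operator `e^{-τ((-Δ)^β + c·∇)} ℙ div` is bounded on `C(𝕋^d)` with norm `O(τ^{-1/(2β)})`. -/
theorem exists_projDiv_le {d : ℕ} {φ : Vec d → ℝ} (hφ : IsDyadicBump φ) {β : ℝ} (hβ : 1 / 2 < β) :
    ∃ C : ℝ, 0 ≤ C ∧ ∀ (k m i : Fin d) (c : Fin d → ℝ) (f : C(Torus d, ℂ)) (τ : ℝ), 0 < τ →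
      ‖synth fun l => propagator β c τ l *
          (projDivSymbol k m i (freq l) * mFourierCoeff f l)‖ ≤ C * τ ^ (-(1 / (2 * β))) * ‖f‖ := by
  obtain ⟨C, hC0, hC⟩ := exists_projDiv_block_le hφ β
  obtain ⟨D, hD0, hD⟩ := exists_dyadic_sum_bound one_pos (show 1 < 2 * β by linarith)
  refine ⟨C * D, by positivity, fun k m i c f τ hτ => ?_⟩
  obtain ⟨hsm, hle⟩ := hD τ hτ
  simp only [Real.rpow_one] at hsm hle
  have h := norm_synth_le_tsum_blocks hφ
      (summable_propagator_mul (β := β) (by linarith) c hτ zero_le_one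
      (growthLE_projDivSymbol k m i f)) (by simp [projDivSymbol_freq_zero])
    (b := fun j => (C * ‖f‖) * ((2 : ℝ) ^ j * (1 + τ * ((2 : ℝ) ^ j) ^ (2 * β))⁻¹))
    (hsm.mul_left _) fun j => by
      refine (hC k m i c f j τ hτ.le).trans_eq ?_
      ring
  refine h.trans ?_
  rw [tsum_mul_left]
  calc _ ≤ C * ‖f‖ * (D * τ ^ (-(1 / (2 * β)))) := by gcongr
    _ = _ := by ring

/-! ### Beta integrals -/

theorem intervalIntegrable_beta {a b t : ℝ} (ha0 : 0 ≤ a) (ha : a < 1) (hb0 : 0 ≤ b) (hb : b < 1)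
    (ht : 0 < t) :
    IntervalIntegrable (fun s : ℝ => (t - s) ^ (-a) * s ^ (-b)) volume 0 t := by
  have h1 : IntervalIntegrable (fun s : ℝ => s ^ (-b)) volume 0 t :=
    intervalIntegral.intervalIntegrable_rpow' (by linarith)
  have h2 : IntervalIntegrable (fun s : ℝ => (t - s) ^ (-a)) volume 0 t := by
    have h3 : IntervalIntegrable (fun s : ℝ => s ^ (-a)) volume 0 t :=
      intervalIntegral.intervalIntegrable_rpow' (by linarith)
    have := (h3.comp_sub_left t).symm
    simpa using this
  refine ((h1.const_mul ((t / 2) ^ (-a))).add (h2.const_mul ((t / 2) ^ (-b)))).mono_fun' ?_ ?_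
  · exact (by fun_prop : Measurable fun s : ℝ => (t - s) ^ (-a) * s ^ (-b)).aestronglyMeasurable
  · rw [uIoc_of_le ht.le]
    filter_upwards [ae_restrict_mem measurableSet_Ioc] with s hs
    have hs1 : 0 ≤ t - s := by linarith [hs.2]
    have p1 : 0 ≤ (t - s) ^ (-a) := by positivity
    have p2 : 0 ≤ s ^ (-b) := Real.rpow_nonneg hs.1.le _
    rw [Real.norm_of_nonneg (mul_nonneg p1 p2)]
    rcases le_total s (t / 2) with h | h
    · have : (t - s) ^ (-a) ≤ (t / 2) ^ (-a) :=
        Real.rpow_le_rpow_of_nonpos (by positivity) (by linarith) (by linarith)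
      have h4 : (t - s) ^ (-a) * s ^ (-b) ≤ (t / 2) ^ (-a) * s ^ (-b) := by gcongr
      have h5 : 0 ≤ (t / 2) ^ (-b) * (t - s) ^ (-a) := by positivity
      linarith
    · have : s ^ (-b) ≤ (t / 2) ^ (-b) :=
        Real.rpow_le_rpow_of_nonpos (by positivity) (by linarith) (by linarith)
      have h4 : (t - s) ^ (-a) * s ^ (-b) ≤ (t / 2) ^ (-b) * (t - s) ^ (-a) := by
        rw [mul_comm]; gcongr
      have h5 : 0 ≤ (t / 2) ^ (-a) * s ^ (-b) := by positivity
      linarith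

/-- The Beta integral `∫_0^1 (1-σ)^{-a} σ^{-b} dσ`. -/
def betaConst (a b : ℝ) : ℝ := ∫ σ in (0 : ℝ)..1, (1 - σ) ^ (-a) * σ ^ (-b)

theorem betaConst_nonneg (a b : ℝ) : 0 ≤ betaConst a b :=
  intervalIntegral.integral_nonneg zero_le_one fun s hs =>
    mul_nonneg (Real.rpow_nonneg (by linarith [hs.2]) _) (Real.rpow_nonneg hs.1 _)

theorem integral_beta {a b t : ℝ} (ht : 0 < t) :
    ∫ s in (0 : ℝ)..t, (t - s) ^ (-a) * s ^ (-b) = t ^ (1 - a - b) * betaConst a b := by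
  have h := intervalIntegral.smul_integral_comp_mul_left (a := 0) (b := 1)
    (fun s : ℝ => (t - s) ^ (-a) * s ^ (-b)) t
  rw [mul_zero, mul_one] at h
  rw [← h, betaConst, smul_eq_mul, ← intervalIntegral.integral_const_mul,
    ← intervalIntegral.integral_const_mul]
  refine intervalIntegral.integral_congr fun σ hσ => ?_
  rw [uIcc_of_le zero_le_one] at hσ
  have e : t - t * σ = t * (1 - σ) := by ring
  simp only [e]
  rw [Real.mul_rpow ht.le (by linarith [hσ.2]), Real.mul_rpow ht.le hσ.1]
  have : t ^ (1 - a - b) = t * t ^ (-a) * t ^ (-b) := by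
    rw [sub_eq_add_neg, sub_eq_add_neg, Real.rpow_add ht, Real.rpow_add ht, Real.rpow_one]
  rw [this]; ring

theorem ae_mem_Ioo_of_mem_Ioc (a b : ℝ) {p : ℝ → Prop} (h : ∀ s ∈ Ioo a b, p s) :
    ∀ᵐ s : ℝ, s ∈ Ioc a b → p s := by
  filter_upwards [Measure.ae_ne volume b] with s hs hs'
  exact h s ⟨hs'.1, lt_of_le_of_ne hs'.2 hs⟩

theorem norm_integral_le_beta {E : Type*} [NormedAddCommGroup E] [NormedSpace ℝ E] {f : ℝ → E}
    {a b t A : ℝ} (ha0 : 0 ≤ a) (ha : a < 1) (hb0 : 0 ≤ b) (hb : b < 1) (ht : 0 < t)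
    (hf : ∀ s ∈ Ioo 0 t, ‖f s‖ ≤ A * ((t - s) ^ (-a) * s ^ (-b))) :
    ‖∫ s in (0 : ℝ)..t, f s‖ ≤ A * (t ^ (1 - a - b) * betaConst a b) := by
  rw [← integral_beta ht, ← intervalIntegral.integral_const_mul]
  exact intervalIntegral.norm_integral_le_of_norm_le ht.le (ae_mem_Ioo_of_mem_Ioc 0 t hf)
    ((intervalIntegrable_beta ha0 ha hb0 hb ht).const_mul A)

theorem aestronglyMeasurable_Ioc_of_continuousOn_Ioo {E : Type*} [NormedAddCommGroup E] {f : ℝ → E}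
    {a b : ℝ} (hf : ContinuousOn f (Ioo a b)) :
    AEStronglyMeasurable f (volume.restrict (Ioc a b)) := by
  rw [← restrict_Ioo_eq_restrict_Ioc]
  exact hf.aestronglyMeasurable measurableSet_Ioo

theorem intervalIntegrable_of_le_beta {E : Type*} [NormedAddCommGroup E] {f : ℝ → E}
    {a b t A : ℝ} (ha0 : 0 ≤ a) (ha : a < 1) (hb0 : 0 ≤ b) (hb : b < 1) (ht : 0 < t)
    (hfc : ContinuousOn f (Ioo 0 t))
    (hf : ∀ s ∈ Ioo 0 t, ‖f s‖ ≤ A * ((t - s) ^ (-a) * s ^ (-b))) :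
    IntervalIntegrable f volume 0 t := by
  refine ((intervalIntegrable_beta ha0 ha hb0 hb ht).const_mul A).mono_fun' ?_ ?_
  · rw [uIoc_of_le ht.le]
    exact aestronglyMeasurable_Ioc_of_continuousOn_Ioo hfc
  · rw [uIoc_of_le ht.le]
    exact (ae_restrict_iff' measurableSet_Ioc).2 (ae_mem_Ioo_of_mem_Ioc 0 t hf)

/-! ### The Oseen operators and their time continuity -/

/-- Complex vector fields with continuous components. -/
abbrev Field (d : ℕ) : Type := Fin d → C(Torus d, ℂ)

/-- Complex matrix fields with continuous components. -/
abbrev Tensor (d : ℕ) : Type := Fin d → Fin d → C(Torus d, ℂ)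

/-- Away from `τ = 0` the heat factor dominates coefficients of polynomial growth, so the series
converges uniformly and is continuous in its parameters. -/
theorem continuousOn_synth {d : ℕ} {β : ℝ} (hβ : 0 < β) (c : Fin d → ℝ) {Z : Type*}
    [TopologicalSpace Z] {S : Set Z} {τ : Z → ℝ} (hτ : ContinuousOn τ S) {δ : ℝ} (hδ : 0 < δ)
    (hδτ : ∀ z ∈ S, δ ≤ τ z) {A : Z → (Fin d → ℤ) → ℂ}
    (hA : ∀ l, ContinuousOn (fun z => A z l) S) {m M : ℝ} (hm : 0 ≤ m)
    (hM : ∀ z ∈ S, GrowthLE m M (A z)) :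
    ContinuousOn (fun z => synth fun l => propagator β c (τ z) l * A z l) S := by
  unfold synth
  refine continuousOn_tsum (u := fun l => M * ((1 + ‖freq l‖) ^ m * Real.exp (-δ * rate β l)))
    (fun l => ?_) ((summable_exp_rate hβ hδ hm).mul_left M) fun l z hz => ?_
  · exact (((continuous_propagator β c l).comp_continuousOn hτ).mul (hA l)).smul continuousOn_const
  · rw [norm_smul, mFourier_norm, mul_one, norm_mul, norm_propagator, mul_comm, ← mul_assoc]
    refine mul_le_mul (hM z hz l) ?_ (Real.exp_pos _).le ((norm_nonneg _).trans (hM z hz l))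
    rw [Real.exp_le_exp, neg_mul, neg_mul, neg_le_neg_iff]
    exact mul_le_mul_of_nonneg_right (hδτ z hz) (rate_nonneg β l)

/-- The flow `e^{-t((-Δ)^β + c·∇)} a`. -/
def heatField {d : ℕ} (β : ℝ) (c : Fin d → ℝ) (a : Fin d → (Fin d → ℤ) → ℂ) (t : ℝ) : Field d :=
  fun k => synth fun l => propagator β c t l * a k l

theorem continuousOn_heatField {d : ℕ} {β : ℝ} (hβ : 0 < β) (c : Fin d → ℝ)
    {a : Fin d → (Fin d → ℤ) → ℂ} {m M : ℝ} (hm : 0 ≤ m) (ha : ∀ k, GrowthLE m M (a k)) :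
    ContinuousOn (heatField β c a) (Ioi 0) := by
  refine continuousOn_pi.2 fun k t (ht : 0 < t) => ContinuousAt.continuousWithinAt ?_
  have h := continuousOn_synth hβ c (S := Ioi (t / 2)) (τ := fun t => t) continuousOn_id
    (half_pos ht) (fun z hz => le_of_lt hz) (A := fun _ => a k) (fun l => continuousOn_const) hm
    fun _ _ => ha k
  exact h.continuousAt (Ioi_mem_nhds (by linarith))

/-- The field `e^{-τ((-Δ)^β + c·∇)} ℙ div F`. -/
def oseen {d : ℕ} (β : ℝ) (c : Fin d → ℝ) (τ : ℝ) (F : Tensor d) : Field d := fun k =>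
  ∑ m, ∑ j, synth fun l => propagator β c τ l *
    (projDivSymbol k m j (freq l) * mFourierCoeff (F j m) l)

theorem summable_oseen {d : ℕ} {β : ℝ} (hβ : 0 < β) (c : Fin d → ℝ) {τ : ℝ} (hτ : 0 < τ)
    (k m j : Fin d) (f : C(Torus d, ℂ)) : Summable fun l =>
      propagator β c τ l * (projDivSymbol k m j (freq l) * mFourierCoeff f l) :=
  summable_propagator_mul hβ c hτ zero_le_one (growthLE_projDivSymbol k m j f)

theorem continuousOn_oseen {d : ℕ} {β : ℝ} (hβ : 0 < β) (c : Fin d → ℝ) :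
    ContinuousOn (fun z : ℝ × Tensor d => oseen β c z.1 z.2) (Ioi 0 ×ˢ univ) := by
  refine continuousOn_pi.2 fun k => continuousOn_finsetSum _ fun m _ =>
    continuousOn_finsetSum _ fun j _ => ?_
  rintro ⟨τ, F⟩ ⟨hτ : 0 < τ, -⟩
  refine ContinuousAt.continuousWithinAt ?_
  have hF : Continuous fun z : ℝ × Tensor d => z.2 j m := by fun_prop
  have h := continuousOn_synth hβ c
    (S := {z : ℝ × Tensor d | τ / 2 < z.1 ∧ ‖z.2 j m‖ < ‖F j m‖ + 1})
    (τ := fun z => z.1) continuousOn_fst (half_pos hτ) (fun z hz => hz.1.le)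
    (A := fun z l => projDivSymbol k m j (freq l) * mFourierCoeff (z.2 j m) l)
    (fun l => (continuous_const.mul ((coeffCLM l).continuous.comp hF)).continuousOn)
    zero_le_one (M := 4 * Real.pi * (‖F j m‖ + 1)) fun z hz l => by
      refine (growthLE_projDivSymbol k m j (z.2 j m) l).trans ?_
      gcongr
      exact hz.2.le
  refine h.continuousAt (IsOpen.mem_nhds ?_ ⟨half_lt_self hτ, lt_add_one _⟩)
  exact (isOpen_lt continuous_const continuous_fst).inter (isOpen_lt hF.norm continuous_const)

theorem oseen_sub {d : ℕ} {β : ℝ} (hβ : 0 < β) (c : Fin d → ℝ) {τ : ℝ} (hτ : 0 < τ)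
    (F G : Tensor d) : oseen β c τ (F - G) = oseen β c τ F - oseen β c τ G := by
  funext k
  simp only [oseen, Pi.sub_apply, ← Finset.sum_sub_distrib]
  refine Finset.sum_congr rfl fun m _ => Finset.sum_congr rfl fun j _ => ?_
  refine eq_of_mFourierCoeff_eq fun l => ?_
  rw [mFourierCoeff_synth (summable_oseen hβ c hτ k m j _), ← coeffCLM_apply, ← coeffCLM_apply,
    map_sub, map_sub, coeffCLM_apply, coeffCLM_apply, coeffCLM_apply, coeffCLM_apply,
    mFourierCoeff_synth (summable_oseen hβ c hτ k m j _),
    mFourierCoeff_synth (summable_oseen hβ c hτ k m j _)]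
  ring

theorem mFourierCoeff_oseen {d : ℕ} {β : ℝ} (hβ : 0 < β) (c : Fin d → ℝ) {τ : ℝ} (hτ : 0 < τ)
    (F : Tensor d) (k : Fin d) (l : Fin d → ℤ) : mFourierCoeff (oseen β c τ F k) l =
      propagator β c τ l * ∑ m, ∑ j, projDivSymbol k m j (freq l) * mFourierCoeff (F j m) l := by
  rw [← coeffCLM_apply, oseen, map_sum, Finset.mul_sum]
  refine Finset.sum_congr rfl fun m _ => ?_
  rw [map_sum, Finset.mul_sum]
  refine Finset.sum_congr rfl fun j _ => ?_
  rw [coeffCLM_apply, mFourierCoeff_synth (summable_oseen hβ c hτ k m j _)]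

theorem norm_tensor_apply_le {d : ℕ} (F : Tensor d) (j m : Fin d) : ‖F j m‖ ≤ ‖F‖ :=
  (norm_le_pi_norm (F j) m).trans (norm_le_pi_norm F j)

theorem exists_oseen_le {d : ℕ} {φ : Vec d → ℝ} (hφ : IsDyadicBump φ) {β : ℝ} (hβ : 1 / 2 < β) :
    ∃ K : ℝ, 0 ≤ K ∧ ∀ (c : Fin d → ℝ) (F : Tensor d) (τ : ℝ), 0 < τ →
      ‖oseen β c τ F‖ ≤ K * τ ^ (-(1 / (2 * β))) * ‖F‖ := by
  obtain ⟨C, hC0, hC⟩ := exists_projDiv_le hφ hβ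
  refine ⟨d * (d * C), by positivity, fun c F τ hτ => ?_⟩
  refine (pi_norm_le_iff_of_nonneg (by positivity)).2 fun k => ?_
  have h : ∀ m j : Fin d, ‖synth fun l => propagator β c τ l *
      (projDivSymbol k m j (freq l) * mFourierCoeff (F j m) l)‖ ≤
        C * τ ^ (-(1 / (2 * β))) * ‖F‖ := fun m j =>
    (hC k m j c (F j m) τ hτ).trans (by gcongr; exact norm_tensor_apply_le F j m)
  refine (norm_sum_le_of_le _ fun m _ => norm_sum_le_of_le _ fun j _ => h m j).trans_eq ?_
  simp only [Finset.sum_const, Finset.card_univ, Fintype.card_fin, nsmul_eq_mul]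
  ring

theorem im_oseen {d : ℕ} {β : ℝ} (hβ : 0 < β) (c : Fin d → ℝ) {τ : ℝ} (hτ : 0 < τ)
    {F : Tensor d} (hF : ∀ j m x, (F j m x).im = 0) (k : Fin d) (x : Torus d) :
    (oseen β c τ F k x).im = 0 := by
  simp only [oseen, ContinuousMap.coe_sum, Finset.sum_apply, Complex.im_sum]
  refine Finset.sum_eq_zero fun m _ => Finset.sum_eq_zero fun j _ => ?_
  refine im_synth_eq_zero (summable_oseen hβ c hτ k m j _) (fun l => ?_) x
  rw [propagator_neg, projDivSymbol_neg, mFourierCoeff_neg (hF j m), map_mul, map_mul]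

/-! ### The Duhamel integral -/

/-- `∫_0^t e^{-(t-s)((-Δ)^β + c·∇)} ℙ div G(s) ds`. -/
def duhamel {d : ℕ} (β : ℝ) (c : Fin d → ℝ) (G : ℝ → Tensor d) (t : ℝ) : Field d :=
  ∫ s in (0 : ℝ)..t, oseen β c (t - s) (G s)

/-- Rescaled to the unit interval, the integral has a domain independent of `t`, and its continuity
in `t` follows by dominated convergence. -/
theorem duhamel_eq_scaled {d : ℕ} (β : ℝ) (c : Fin d → ℝ) (G : ℝ → Tensor d) (t : ℝ) :
    duhamel β c G t = t • ∫ σ in (0 : ℝ)..1, oseen β c (t - t * σ) (G (t * σ)) := by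
  have h := intervalIntegral.smul_integral_comp_mul_left (a := 0) (b := 1)
    (fun s : ℝ => oseen β c (t - s) (G s)) t
  rw [mul_zero, mul_one] at h
  exact h.symm

/-- Estimate on the Oseen operators of order `a`. -/
def OseenBound {d : ℕ} (β : ℝ) (c : Fin d → ℝ) (K a : ℝ) : Prop :=
  ∀ (F : Tensor d) (τ : ℝ), 0 < τ → ‖oseen β c τ F‖ ≤ K * τ ^ (-a) * ‖F‖

theorem norm_oseen_le_beta {d : ℕ} {β : ℝ} {c : Fin d → ℝ} {K a b M t : ℝ}
    (hK0 : 0 ≤ K) (hK : OseenBound β c K a) (ht1 : t ≤ 1) {G : ℝ → Tensor d}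
    (hGM : ∀ s ∈ Ioc (0 : ℝ) 1, ‖G s‖ ≤ M * s ^ (-b)) :
    ∀ s ∈ Ioo 0 t, ‖oseen β c (t - s) (G s)‖ ≤ K * M * ((t - s) ^ (-a) * s ^ (-b)) := by
  intro s hs
  have hts : 0 < t - s := by linarith [hs.2]
  refine (hK _ _ hts).trans ?_
  calc _ ≤ K * (t - s) ^ (-a) * (M * s ^ (-b)) := by
        gcongr; exact hGM s ⟨hs.1, hs.2.le.trans ht1⟩
    _ = _ := by ring

theorem continuousOn_oseen_comp {d : ℕ} {β : ℝ} (hβ : 0 < β) (c : Fin d → ℝ) {t : ℝ} (ht1 : t ≤ 1)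
    {G : ℝ → Tensor d} (hG : ContinuousOn G (Ioc 0 1)) :
    ContinuousOn (fun s => oseen β c (t - s) (G s)) (Ioo 0 t) := by
  refine (continuousOn_oseen hβ c).comp (f := fun s => (t - s, G s)) ?_ fun s hs =>
    ⟨sub_pos.2 hs.2, trivial⟩
  exact (continuousOn_const.sub continuousOn_id).prodMk
    (hG.mono fun s hs => ⟨hs.1, hs.2.le.trans ht1⟩)

theorem intervalIntegrable_oseen {d : ℕ} {β : ℝ} (hβ : 0 < β) {c : Fin d → ℝ} {K a b M t : ℝ}
    (hK0 : 0 ≤ K) (hK : OseenBound β c K a) (ha0 : 0 ≤ a) (ha : a < 1) (hb0 : 0 ≤ b) (hb : b < 1)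
    (ht : 0 < t) (ht1 : t ≤ 1) {G : ℝ → Tensor d} (hG : ContinuousOn G (Ioc 0 1))
    (hGM : ∀ s ∈ Ioc (0 : ℝ) 1, ‖G s‖ ≤ M * s ^ (-b)) :
    IntervalIntegrable (fun s => oseen β c (t - s) (G s)) volume 0 t :=
  intervalIntegrable_of_le_beta ha0 ha hb0 hb ht (continuousOn_oseen_comp hβ c ht1 hG)
    (norm_oseen_le_beta hK0 hK ht1 hGM)

theorem norm_duhamel_le {d : ℕ} {β : ℝ} {c : Fin d → ℝ} {K a b M t : ℝ}
    (hK0 : 0 ≤ K) (hK : OseenBound β c K a) (ha0 : 0 ≤ a) (ha : a < 1) (hb0 : 0 ≤ b) (hb : b < 1)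
    (ht : 0 < t) (ht1 : t ≤ 1) {G : ℝ → Tensor d}
    (hGM : ∀ s ∈ Ioc (0 : ℝ) 1, ‖G s‖ ≤ M * s ^ (-b)) :
    ‖duhamel β c G t‖ ≤ K * M * (t ^ (1 - a - b) * betaConst a b) :=
  norm_integral_le_beta ha0 ha hb0 hb ht (norm_oseen_le_beta hK0 hK ht1 hGM)

theorem continuousOn_duhamel {d : ℕ} {β : ℝ} (hβ : 0 < β) {c : Fin d → ℝ} {K a b M : ℝ}
    (hK0 : 0 ≤ K) (hK : OseenBound β c K a) (ha0 : 0 ≤ a) (ha : a < 1) (hb0 : 0 ≤ b) (hb : b < 1)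
    (hM0 : 0 ≤ M) {G : ℝ → Tensor d} (hG : ContinuousOn G (Ioc 0 1))
    (hGM : ∀ s ∈ Ioc (0 : ℝ) 1, ‖G s‖ ≤ M * s ^ (-b)) :
    ContinuousOn (duhamel β c G) (Ioc 0 1) := by
  intro t₀ ht₀
  have e : duhamel β c G =
      fun t => t • ∫ σ in (0 : ℝ)..1, oseen β c (t - t * σ) (G (t * σ)) := by
    funext t; exact duhamel_eq_scaled β c G t
  rw [e]
  refine continuousWithinAt_id.smul ?_
  have hsub : ∀ t ∈ Ioc (0 : ℝ) 1, ∀ σ ∈ Ioo (0 : ℝ) 1, 0 < t - t * σ ∧ t * σ ∈ Ioc (0 : ℝ) 1 := by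
    intro t ht σ hσ
    refine ⟨by nlinarith [ht.1, hσ.2], by nlinarith [ht.1, hσ.1], ?_⟩
    nlinarith [ht.1, ht.2, hσ.1, hσ.2]
  refine intervalIntegral.continuousWithinAt_of_dominated_interval
    (bound := fun σ => (K * M * (t₀ / 2) ^ (-(a + b))) * ((1 - σ) ^ (-a) * σ ^ (-b)))
    ?_ ?_ ((intervalIntegrable_beta ha0 ha hb0 hb one_pos).const_mul _) ?_
  · filter_upwards [self_mem_nhdsWithin] with t ht
    rw [uIoc_of_le zero_le_one]
    refine aestronglyMeasurable_Ioc_of_continuousOn_Ioo ?_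
    refine (continuousOn_oseen hβ c).comp (f := fun σ => (t - t * σ, G (t * σ))) ?_ fun σ hσ =>
      ⟨(hsub t ht σ hσ).1, trivial⟩
    refine ContinuousOn.prodMk (by fun_prop) ?_
    exact hG.comp (by fun_prop) fun σ hσ => (hsub t ht σ hσ).2
  · have h2 : ∀ᶠ t in 𝓝[Ioc 0 1] t₀, t₀ / 2 < t :=
      mem_nhdsWithin_of_mem_nhds (Ioi_mem_nhds (by linarith [ht₀.1]))
    filter_upwards [self_mem_nhdsWithin, h2] with t ht ht2
    rw [uIoc_of_le zero_le_one]
    refine ae_mem_Ioo_of_mem_Ioc 0 1 fun σ hσ => ?_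
    have h3 := norm_oseen_le_beta hK0 hK ht.2 hGM (t * σ)
      ⟨mul_pos ht.1 hσ.1, by nlinarith [ht.1, hσ.2]⟩
    refine h3.trans ?_
    have e1 : t - t * σ = t * (1 - σ) := by ring
    rw [e1, Real.mul_rpow ht.1.le (by linarith [hσ.2]), Real.mul_rpow ht.1.le hσ.1.le]
    have e2 : t ^ (-a) * (1 - σ) ^ (-a) * (t ^ (-b) * σ ^ (-b)) =
        t ^ (-(a + b)) * ((1 - σ) ^ (-a) * σ ^ (-b)) := by
      rw [neg_add, Real.rpow_add ht.1]; ring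
    rw [e2, ← mul_assoc]
    have p : 0 ≤ (1 - σ) ^ (-a) * σ ^ (-b) :=
      mul_nonneg (Real.rpow_nonneg (by linarith [hσ.2]) _) (Real.rpow_nonneg hσ.1.le _)
    refine mul_le_mul_of_nonneg_right (mul_le_mul_of_nonneg_left ?_ (by positivity)) p
    exact Real.rpow_le_rpow_of_nonpos (by linarith [ht₀.1]) ht2.le (by linarith)
  · rw [uIoc_of_le zero_le_one]
    refine ae_mem_Ioo_of_mem_Ioc 0 1 fun σ hσ => ?_
    have h4 : ContinuousOn (fun t => oseen β c (t - t * σ) (G (t * σ))) (Ioc 0 1) := by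
      refine (continuousOn_oseen hβ c).comp (f := fun t => (t - t * σ, G (t * σ))) ?_ fun t ht =>
        ⟨(hsub t ht σ hσ).1, trivial⟩
      refine ContinuousOn.prodMk (by fun_prop) ?_
      exact hG.comp (by fun_prop) fun t ht => (hsub t ht σ hσ).2
    exact h4 t₀ ht₀

theorem im_duhamel {d : ℕ} {β : ℝ} (hβ : 0 < β) {c : Fin d → ℝ} {t : ℝ} (ht : 0 < t)
    {G : ℝ → Tensor d} (hI : IntervalIntegrable (fun s => oseen β c (t - s) (G s)) volume 0 t)
    (hG : ∀ s ∈ Ioo 0 t, ∀ j m x, (G s j m x).im = 0) (k : Fin d) (x : Torus d) :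
    (duhamel β c G t k x).im = 0 := by
  set L : Field d →L[ℝ] ℝ := Complex.imCLM ∘L
    ((ContinuousMap.evalCLM ℂ x ∘L ContinuousLinearMap.proj (R := ℂ) k :
      Field d →L[ℂ] ℂ).restrictScalars ℝ)
  have h : L (duhamel β c G t) = ∫ s in (0 : ℝ)..t, L (oseen β c (t - s) (G s)) :=
    (L.intervalIntegral_comp_comm hI).symm
  have h0 : ∫ s in (0 : ℝ)..t, L (oseen β c (t - s) (G s)) = ∫ s in (0 : ℝ)..t, (0 : ℝ) := by
    refine intervalIntegral.integral_congr_ae ?_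
    rw [uIoc_of_le ht.le]
    exact ae_mem_Ioo_of_mem_Ioc 0 t fun s hs =>
      im_oseen hβ c (sub_pos.2 hs.2) (hG s hs) k x
  rw [h0, intervalIntegral.integral_zero] at h
  exact h

/-! ### The fixed point -/

/-- The tensor product `u ⊗ w`. -/
def tensor {d : ℕ} (u w : Field d) : Tensor d := fun j m => u j * w m

theorem norm_tensor_le {d : ℕ} (u w : Field d) : ‖tensor u w‖ ≤ ‖u‖ * ‖w‖ := by
  refine (pi_norm_le_iff_of_nonneg (by positivity)).2 fun j =>
    (pi_norm_le_iff_of_nonneg (by positivity)).2 fun m => (norm_mul_le _ _).trans ?_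
  gcongr
  · exact norm_le_pi_norm u j
  · exact norm_le_pi_norm w m

theorem norm_tensor_self_sub_le {d : ℕ} (u w : Field d) :
    ‖tensor u u - tensor w w‖ ≤ (‖u‖ + ‖w‖) * ‖u - w‖ := by
  have h : tensor u u - tensor w w = tensor (u - w) u + tensor w (u - w) := by
    funext j m
    simp only [tensor, Pi.sub_apply, Pi.add_apply]
    ring
  rw [h]
  refine (norm_add_le _ _).trans ?_
  have h1 := norm_tensor_le (u - w) u
  have h2 := norm_tensor_le w (u - w)
  linarith

theorem continuous_tensor_self {d : ℕ} : Continuous fun u : Field d => tensor u u :=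
  continuous_pi fun j => continuous_pi fun m => (continuous_apply j).mul (continuous_apply m)

theorem im_tensor_self {d : ℕ} {u : Field d} (hu : ∀ k x, (u k x).im = 0) (j m : Fin d)
    (x : Torus d) : (tensor u u j m x).im = 0 := by
  simp [tensor, hu]

theorem duhamel_sub {d : ℕ} {β : ℝ} (hβ : 0 < β) {c : Fin d → ℝ} {t : ℝ} (ht : 0 < t)
    {G G' : ℝ → Tensor d} (hI : IntervalIntegrable (fun s => oseen β c (t - s) (G s)) volume 0 t)
    (hI' : IntervalIntegrable (fun s => oseen β c (t - s) (G' s)) volume 0 t) :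
    duhamel β c G t - duhamel β c G' t = duhamel β c (fun s => G s - G' s) t := by
  rw [duhamel, duhamel, duhamel, ← intervalIntegral.integral_sub hI hI']
  refine intervalIntegral.integral_congr_ae ?_
  rw [uIoc_of_le ht.le]
  exact ae_mem_Ioo_of_mem_Ioc 0 t fun s hs => (oseen_sub hβ c (sub_pos.2 hs.2) _ _).symm

/-- The contraction principle for bounded continuous profiles with values in a closed set. -/
theorem exists_profile_fixedPoint {T E : Type*} [TopologicalSpace T] [NormedAddCommGroup E]
    [CompleteSpace E] {Ψ : (T → E) → T → E} {A : Set E} (hA : IsClosed A) (hA0 : 0 ∈ A) {r : ℝ}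
    (hr : 0 ≤ r)
    (hmap : ∀ W : T → E, Continuous W → (∀ t, ‖W t‖ ≤ r) → (∀ t, W t ∈ A) →
      Continuous (Ψ W) ∧ (∀ t, ‖Ψ W t‖ ≤ r) ∧ ∀ t, Ψ W t ∈ A)
    (hlip : ∀ W W' : T → E, Continuous W → Continuous W' → (∀ t, ‖W t‖ ≤ r) → (∀ t, ‖W' t‖ ≤ r) →
      ∀ D, 0 ≤ D → (∀ t, ‖W t - W' t‖ ≤ D) → ∀ t, ‖Ψ W t - Ψ W' t‖ ≤ D / 2) :
    ∃ W : T → E, Continuous W ∧ (∀ t, ‖W t‖ ≤ r) ∧ (∀ t, W t ∈ A) ∧ ∀ t, Ψ W t = W t := by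
  set S : Set (T →ᵇ E) := {W | (∀ t, ‖W t‖ ≤ r) ∧ ∀ t, W t ∈ A}
  have hSc : IsClosed S := by
    have : S = (⋂ t, {W | ‖W t‖ ≤ r}) ∩ ⋂ t, {W | W t ∈ A} := by ext; simp [S]
    rw [this]
    refine (isClosed_iInter fun t => isClosed_le ?_ continuous_const).inter
      (isClosed_iInter fun t => hA.preimage ?_)
    · exact (continuous_eval_const t).norm
    · exact continuous_eval_const t
  have : CompleteSpace S := hSc.isComplete.completeSpace_coe
  have hm : ∀ W : S, _ := fun W => hmap W.1 W.1.continuous W.2.1 W.2.2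
  set Φ : S → S := fun W =>
    ⟨BoundedContinuousFunction.ofNormedAddCommGroup _ (hm W).1 r (hm W).2.1, (hm W).2⟩
  have hΦ : ∀ W t, (Φ W).1 t = Ψ W.1 t := fun W t => rfl
  have hc : ContractingWith (1 / 2) Φ := by
    refine ⟨by norm_num, LipschitzWith.of_dist_le_mul fun W W' => ?_⟩
    rw [Subtype.dist_eq, BoundedContinuousFunction.dist_le (by positivity)]
    intro t
    rw [dist_eq_norm, hΦ, hΦ]
    refine (hlip _ _ W.1.continuous W'.1.continuous W.2.1 W'.2.1 (dist W W') dist_nonneg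
      (fun t => ?_) t).trans_eq ?_
    · rw [← dist_eq_norm]
      exact BoundedContinuousFunction.dist_coe_le_dist t
    · have : (((1 / 2 : ℝ≥0)) : ℝ) = 1 / 2 := by norm_num
      rw [this]; ring
  have : Nonempty S := ⟨⟨0, fun t => by simpa using hr, fun t => hA0⟩⟩
  obtain ⟨W, hW⟩ : ∃ W, Φ W = W := ⟨_, hc.fixedPoint_isFixedPt⟩
  refine ⟨W.1, W.1.continuous, W.2.1, W.2.2, fun t => ?_⟩
  rw [← hΦ, hW]

/-- The field `w(t) = t^{-γ} W(t)` with weighted profile `W`, extended by zero. -/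
def unweight {d : ℕ} (γ : ℝ) (W : Ioc (0 : ℝ) 1 → Field d) (t : ℝ) : Field d :=
  open Classical in if h : t ∈ Ioc (0 : ℝ) 1 then t ^ (-γ) • W ⟨t, h⟩ else 0

theorem unweight_apply {d : ℕ} (γ : ℝ) (W : Ioc (0 : ℝ) 1 → Field d) {t : ℝ}
    (h : t ∈ Ioc (0 : ℝ) 1) : unweight γ W t = t ^ (-γ) • W ⟨t, h⟩ := dif_pos h

theorem continuousOn_unweight {d : ℕ} (γ : ℝ) {W : Ioc (0 : ℝ) 1 → Field d} (hW : Continuous W) :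
    ContinuousOn (unweight γ W) (Ioc 0 1) := by
  rw [continuousOn_iff_continuous_domRestrict]
  have : (Ioc (0 : ℝ) 1).domRestrict (unweight γ W) =
      fun t : Ioc (0 : ℝ) 1 => (t : ℝ) ^ (-γ) • W t := by
    funext t; exact unweight_apply γ W t.2
  rw [this]
  exact (continuous_subtype_val.rpow_const fun t => Or.inl t.2.1.ne').smul hW

theorem norm_unweight_le {d : ℕ} (γ : ℝ) {W : Ioc (0 : ℝ) 1 → Field d} {M : ℝ}
    (hW : ∀ t, ‖W t‖ ≤ M) : ∀ t ∈ Ioc (0 : ℝ) 1, ‖unweight γ W t‖ ≤ M * t ^ (-γ) := by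
  intro t ht
  have p : 0 ≤ t ^ (-γ) := Real.rpow_nonneg ht.1.le _
  rw [unweight_apply γ W ht, norm_smul, Real.norm_of_nonneg p, mul_comm]
  gcongr
  exact hW _

theorem norm_tensor_weight_le {d : ℕ} {γ M : ℝ} {w : ℝ → Field d}
    (hw : ∀ t ∈ Ioc (0 : ℝ) 1, ‖w t‖ ≤ M * t ^ (-γ)) :
    ∀ t ∈ Ioc (0 : ℝ) 1, ‖tensor (w t) (w t)‖ ≤ (M * M) * t ^ (-(2 * γ)) := by
  intro t ht
  have e : t ^ (-(2 * γ)) = t ^ (-γ) * t ^ (-γ) := by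
    rw [← Real.rpow_add ht.1]; congr 1; ring
  rw [e]
  refine (norm_tensor_le _ _).trans ?_
  have h := hw t ht
  calc _ ≤ (M * t ^ (-γ)) * (M * t ^ (-γ)) :=
        mul_le_mul h h (norm_nonneg _) ((norm_nonneg _).trans h)
    _ = _ := by ring

/-- In the weighted space the Duhamel integral of a source of size `M s^{-2γ}` is bounded by a
multiple of `M`; this is where the subcriticality `γ ≤ 1 - a` enters. -/
theorem weighted_norm_duhamel_le {d : ℕ} {β : ℝ} {c : Fin d → ℝ} {K a γ M t : ℝ}
    (hK0 : 0 ≤ K) (hK : OseenBound β c K a) (ha0 : 0 ≤ a) (ha : a < 1) (hγ0 : 0 ≤ γ)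
    (hγ : 2 * γ < 1) (hγa : γ ≤ 1 - a) (hM : 0 ≤ M) (ht : 0 < t) (ht1 : t ≤ 1) {G : ℝ → Tensor d}
    (hGM : ∀ s ∈ Ioc (0 : ℝ) 1, ‖G s‖ ≤ M * s ^ (-(2 * γ))) :
    t ^ γ * ‖duhamel β c G t‖ ≤ K * betaConst a (2 * γ) * M := by
  have h := norm_duhamel_le hK0 hK ha0 ha (by linarith) hγ ht ht1 hGM
  have hB := betaConst_nonneg a (2 * γ)
  have hp : t ^ γ * t ^ (1 - a - 2 * γ) ≤ 1 := by
    rw [← Real.rpow_add ht]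
    exact Real.rpow_le_one ht.le ht1 (by linarith)
  calc _ ≤ t ^ γ * (K * M * (t ^ (1 - a - 2 * γ) * betaConst a (2 * γ))) := by gcongr
    _ = K * betaConst a (2 * γ) * M * (t ^ γ * t ^ (1 - a - 2 * γ)) := by ring
    _ ≤ K * betaConst a (2 * γ) * M * 1 := by gcongr
    _ = _ := mul_one _

theorem im_heatField {d : ℕ} {β : ℝ} (hβ : 0 < β) (c : Fin d → ℝ)
    {a : Fin d → (Fin d → ℤ) → ℂ} {m M : ℝ} (hm : 0 ≤ m) (ha : ∀ k, GrowthLE m M (a k))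
    (hconj : ∀ k l, a k (-l) = starRingEnd ℂ (a k l)) {t : ℝ} (ht : 0 < t) (k : Fin d)
    (x : Torus d) : (heatField β c a t k x).im = 0 := by
  refine im_synth_eq_zero (summable_propagator_mul hβ c ht hm (ha k)) (fun l => ?_) x
  rw [propagator_neg, hconj, map_mul]

/-- **Small-data fixed point**: the Duhamel equation with drift `c` has a solution of size
`O(t^{-γ})` whenever the free evolution of the data is small in that weighted norm. -/
theorem exists_duhamel_solution {d : ℕ} {β : ℝ} (hβ : 0 < β) {c : Fin d → ℝ} {K a γ E : ℝ}
    (hK0 : 0 ≤ K) (hK : OseenBound β c K a) (ha0 : 0 ≤ a) (ha : a < 1) (hγ0 : 0 ≤ γ)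
    (hγ : 2 * γ < 1) (hγa : γ ≤ 1 - a) (hE0 : 0 ≤ E)
    (hsmall : 8 * (K * betaConst a (2 * γ)) * E ≤ 1)
    {u₀ : Fin d → (Fin d → ℤ) → ℂ} {m M : ℝ} (hm : 0 ≤ m) (hu₀ : ∀ k, GrowthLE m M (u₀ k))
    (hconj : ∀ k l, u₀ k (-l) = starRingEnd ℂ (u₀ k l))
    (hheat : ∀ t ∈ Ioc (0 : ℝ) 1, ‖heatField β c u₀ t‖ ≤ E * t ^ (-γ)) :
    ∃ w : ℝ → Field d, ContinuousOn w (Ioc 0 1) ∧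
      (∀ t ∈ Ioc (0 : ℝ) 1, ‖w t‖ ≤ 2 * E * t ^ (-γ)) ∧
      (∀ t ∈ Ioc (0 : ℝ) 1, ∀ k x, (w t k x).im = 0) ∧
      ∀ t ∈ Ioc (0 : ℝ) 1,
        w t = heatField β c u₀ t - duhamel β c (fun s => tensor (w s) (w s)) t := by
  set κ : ℝ := K * betaConst a (2 * γ)
  have hκ : 0 ≤ κ := mul_nonneg hK0 (betaConst_nonneg _ _)
  -- properties of the source term of a profile `W` of size at most `2E`
  have hsrcC : ∀ W : Ioc (0 : ℝ) 1 → Field d, Continuous W →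
      ContinuousOn (fun s => tensor (unweight γ W s) (unweight γ W s)) (Ioc 0 1) := fun W hW =>
    continuous_tensor_self.comp_continuousOn (continuousOn_unweight γ hW)
  have hsrcN : ∀ W : Ioc (0 : ℝ) 1 → Field d, (∀ t, ‖W t‖ ≤ 2 * E) → ∀ s ∈ Ioc (0 : ℝ) 1,
      ‖tensor (unweight γ W s) (unweight γ W s)‖ ≤ (2 * E * (2 * E)) * s ^ (-(2 * γ)) :=
    fun W hW => norm_tensor_weight_le (norm_unweight_le γ hW)
  have hint : ∀ W : Ioc (0 : ℝ) 1 → Field d, Continuous W → (∀ t, ‖W t‖ ≤ 2 * E) →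
      ∀ t ∈ Ioc (0 : ℝ) 1, IntervalIntegrable
        (fun s => oseen β c (t - s) (tensor (unweight γ W s) (unweight γ W s))) volume 0 t :=
    fun W hW hWE t ht => intervalIntegrable_oseen hβ hK0 hK ha0 ha (by linarith) hγ ht.1 ht.2
      (hsrcC W hW) (hsrcN W hWE)
  set rhs : (Ioc (0 : ℝ) 1 → Field d) → ℝ → Field d := fun W t =>
    heatField β c u₀ t - duhamel β c (fun s => tensor (unweight γ W s) (unweight γ W s)) t
  have hwt : ∀ t : Ioc (0 : ℝ) 1, (t : ℝ) ^ γ * (t : ℝ) ^ (-γ) = 1 := fun t => by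
    rw [← Real.rpow_add t.2.1, add_neg_cancel, Real.rpow_zero]
  have hpos : ∀ t : Ioc (0 : ℝ) 1, 0 ≤ (t : ℝ) ^ γ := fun t => Real.rpow_nonneg t.2.1.le _
  have hAc : IsClosed {u : Field d | ∀ k x, (u k x).im = 0} := by
    have : {u : Field d | ∀ k x, (u k x).im = 0} = ⋂ k, ⋂ x, {u | (u k x).im = 0} := by
      ext; simp
    rw [this]
    refine isClosed_iInter fun k => isClosed_iInter fun x => ?_
    exact isClosed_eq (Complex.continuous_im.comp ((continuous_eval_const x).comp
      (continuous_apply k))) continuous_const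
  have hprofile : ∃ W : Ioc (0 : ℝ) 1 → Field d, Continuous W ∧ (∀ t, ‖W t‖ ≤ 2 * E) ∧
      (∀ t, W t ∈ {u : Field d | ∀ k x, (u k x).im = 0}) ∧
        ∀ t : Ioc (0 : ℝ) 1, (t : ℝ) ^ γ • rhs W t = W t := by
    refine exists_profile_fixedPoint
      (Ψ := fun (W : Ioc (0 : ℝ) 1 → Field d) (t : Ioc (0 : ℝ) 1) => (t : ℝ) ^ γ • rhs W t) hAc
      (fun k x => by simp) (by positivity) (fun W hW hWE hWr => ?_)
      (fun W W' hW hW' hWE hWE' D hD0 hD t => ?_)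
    · refine ⟨?_, fun t => ?_, fun t k x => ?_⟩
      · have hc : ContinuousOn (rhs W) (Ioc 0 1) :=
          ((continuousOn_heatField hβ c hm hu₀).mono fun t ht => ht.1).sub
            (continuousOn_duhamel hβ hK0 hK ha0 ha (by linarith) hγ (by positivity) (hsrcC W hW)
              (hsrcN W hWE))
        exact (continuous_subtype_val.rpow_const fun t => Or.inl t.2.1.ne').smul
          (continuousOn_iff_continuous_domRestrict.1 hc)
      · rw [norm_smul, Real.norm_of_nonneg (hpos t)]
        have h1 := weighted_norm_duhamel_le hK0 hK ha0 ha hγ0 hγ hγa (by positivity) t.2.1 t.2.2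
          (hsrcN W hWE)
        have h2 : (t : ℝ) ^ γ * ‖heatField β c u₀ t‖ ≤ E := by
          calc _ ≤ (t : ℝ) ^ γ * (E * (t : ℝ) ^ (-γ)) :=
                mul_le_mul_of_nonneg_left (hheat t t.2) (hpos t)
            _ = E * ((t : ℝ) ^ γ * (t : ℝ) ^ (-γ)) := by ring
            _ = E := by rw [hwt, mul_one]
        have h3 : (t : ℝ) ^ γ * ‖rhs W t‖ ≤ (t : ℝ) ^ γ * (‖heatField β c u₀ t‖ + ‖duhamel β c
            (fun s => tensor (unweight γ W s) (unweight γ W s)) t‖) :=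
          mul_le_mul_of_nonneg_left (norm_sub_le _ _) (hpos t)
        nlinarith
      · have hreal : ∀ s ∈ Ioc (0 : ℝ) 1, ∀ k x, (unweight γ W s k x).im = 0 := by
          intro s hs k x
          have := hWr ⟨s, hs⟩ k x
          rw [unweight_apply γ W hs]
          simp [this]
        have h1 := im_heatField hβ c hm hu₀ hconj t.2.1 k x
        have h2 := im_duhamel hβ t.2.1 (hint W hW hWE t t.2) (fun s hs => im_tensor_self
          (hreal s ⟨hs.1, hs.2.le.trans t.2.2⟩)) k x
        simp only [rhs, Pi.smul_apply, Pi.sub_apply, ContinuousMap.smul_apply,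
          ContinuousMap.sub_apply, Complex.real_smul, Complex.mul_im, Complex.sub_im, h1, h2,
          Complex.ofReal_im]
        simp
    · have e0 : (t : ℝ) ^ γ • rhs W t - (t : ℝ) ^ γ • rhs W' t =
          (t : ℝ) ^ γ • (rhs W t - rhs W' t) := (smul_sub _ _ _).symm
      change ‖(t : ℝ) ^ γ • rhs W t - (t : ℝ) ^ γ • rhs W' t‖ ≤ D / 2
      rw [e0, norm_smul, Real.norm_of_nonneg (hpos t)]
      have e1 : rhs W t - rhs W' t = -(duhamel β c (fun s =>
          tensor (unweight γ W s) (unweight γ W s) -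
            tensor (unweight γ W' s) (unweight γ W' s)) t) := by
        rw [← duhamel_sub hβ t.2.1 (hint W hW hWE t t.2) (hint W' hW' hWE' t t.2)]
        simp only [rhs]; abel
      rw [e1, norm_neg]
      have hdiff : ∀ s ∈ Ioc (0 : ℝ) 1, ‖tensor (unweight γ W s) (unweight γ W s) -
          tensor (unweight γ W' s) (unweight γ W' s)‖ ≤ (4 * E * D) * s ^ (-(2 * γ)) := by
        intro s hs
        have p : 0 ≤ s ^ (-γ) := Real.rpow_nonneg hs.1.le _
        refine (norm_tensor_self_sub_le _ _).trans ?_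
        have h1 := norm_unweight_le γ hWE s hs
        have h2 := norm_unweight_le γ hWE' s hs
        have h3 : ‖unweight γ W s - unweight γ W' s‖ ≤ D * s ^ (-γ) := by
          have e2 : s ^ (-γ) • W ⟨s, hs⟩ - s ^ (-γ) • W' ⟨s, hs⟩ =
              s ^ (-γ) • (W ⟨s, hs⟩ - W' ⟨s, hs⟩) := (smul_sub _ _ _).symm
          rw [unweight_apply γ _ hs, unweight_apply γ _ hs, e2, norm_smul,
            Real.norm_of_nonneg p, mul_comm]
          exact mul_le_mul_of_nonneg_right (hD _) p
        have e : s ^ (-(2 * γ)) = s ^ (-γ) * s ^ (-γ) := by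
          rw [← Real.rpow_add hs.1]; congr 1; ring
        calc _ ≤ (2 * E * s ^ (-γ) + 2 * E * s ^ (-γ)) * (D * s ^ (-γ)) := by gcongr
          _ = _ := by rw [e]; ring
      refine (weighted_norm_duhamel_le hK0 hK ha0 ha hγ0 hγ hγa (by positivity) t.2.1 t.2.2
        hdiff).trans ?_
      calc K * betaConst a (2 * γ) * (4 * E * D) = (8 * κ * E) * D / 2 := by simp only [κ]; ring
        _ ≤ 1 * D / 2 := by gcongr
        _ = _ := by ring
  obtain ⟨W, hWc, hW1, hW2, hfix⟩ := hprofile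
  refine ⟨unweight γ W, continuousOn_unweight γ hWc, norm_unweight_le γ hW1, fun t ht k x => ?_,
    fun t ht => ?_⟩
  · rw [unweight_apply γ _ ht]
    have := hW2 ⟨t, ht⟩ k x
    simp [this]
  · have h := hfix ⟨t, ht⟩
    rw [unweight_apply γ _ ht, ← h, smul_smul, mul_comm, hwt ⟨t, ht⟩, one_smul]

/-! ### Fourier coefficients of distributions -/

theorem cosTest_neg {d : ℕ} (l : Fin d → ℤ) : cosTest (-l) = cosTest l := by
  apply Subtype.ext
  funext x
  simp [cosTest, mFourier_neg]

theorem sinTest_neg {d : ℕ} (l : Fin d → ℤ) : sinTest (-l) = -sinTest l := by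
  apply Subtype.ext
  funext x
  simp [sinTest, mFourier_neg]

theorem fourierCoeff_neg {d : ℕ} (u : Distribution d) (l : Fin d → ℤ) :
    u.fourierCoeff (-l) = starRingEnd ℂ (u.fourierCoeff l) := by
  simp [Distribution.fourierCoeff, cosTest_neg, sinTest_neg]

theorem im_fourierCoeff_zero {d : ℕ} (u : Distribution d) : (u.fourierCoeff 0).im = 0 := by
  have h := fourierCoeff_neg u 0
  rw [neg_zero] at h
  exact Complex.conj_eq_iff_im.1 h.symm

theorem toTorus_single_mFourier {d : ℕ} (l : Fin d → ℤ) (i : Fin d) (h : ℝ) :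
    mFourier l (toTorus (Pi.single i h)) =
      Complex.exp (2 * Real.pi * Complex.I * (l i : ℂ) * (h : ℂ)) := by
  rw [mFourier_toTorus, Finset.sum_eq_single i]
  · rw [Pi.single_eq_same]; congr 1; ring
  · intro j _ hj; rw [Pi.single_eq_of_ne hj]; simp
  · simp

theorem hasDerivAt_mFourier {d : ℕ} (l : Fin d → ℤ) (i : Fin d) (x : Torus d) :
    HasDerivAt (fun h : ℝ => mFourier l (x + toTorus (Pi.single i h)))
      (2 * Real.pi * Complex.I * (l i : ℂ) * mFourier l x) 0 := by
  simp only [mFourier_apply_add, toTorus_single_mFourier]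
  have h1 : HasDerivAt (fun h : ℝ => 2 * Real.pi * Complex.I * (l i : ℂ) * (h : ℂ))
      (2 * Real.pi * Complex.I * (l i : ℂ) * 1) 0 :=
    (Complex.ofRealCLM.hasDerivAt (x := (0 : ℝ))).const_mul _
  refine (h1.cexp.const_mul (mFourier l x)).congr_deriv ?_
  simp only [Complex.ofReal_zero, mul_zero, Complex.exp_zero]
  ring

theorem pderiv_cosTest {d : ℕ} (l : Fin d → ℤ) (i : Fin d) :
    TestFunction.pderiv i (cosTest l) = (-(2 * Real.pi * l i)) • sinTest l := by
  apply Subtype.ext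
  funext x
  have h := (Complex.reCLM.hasFDerivAt.comp_hasDerivAt (0 : ℝ) (hasDerivAt_mFourier l i x)).deriv
  refine Eq.trans h ?_
  simp [sinTest]

theorem pderiv_sinTest {d : ℕ} (l : Fin d → ℤ) (i : Fin d) :
    TestFunction.pderiv i (sinTest l) = (2 * Real.pi * l i) • cosTest l := by
  apply Subtype.ext
  funext x
  have h := (Complex.imCLM.hasFDerivAt.comp_hasDerivAt (0 : ℝ) (hasDerivAt_mFourier l i x)).deriv
  refine Eq.trans h ?_
  simp [cosTest]

/-- On the Fourier side `div u = 0` means `l · û(l) = 0`. -/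
theorem sum_mul_fourierCoeff_eq_zero {d : ℕ} {u : Fin d → Distribution d} (hu : DistDivFree u)
    (l : Fin d → ℤ) : ∑ i, (l i : ℂ) * (u i).fourierCoeff l = 0 := by
  have h1 := hu (cosTest l)
  have h2 := hu (sinTest l)
  simp only [pderiv_cosTest, pderiv_sinTest, map_smul, smul_eq_mul] at h1 h2
  have e1 : ∑ i, (l i : ℝ) * (u i).toLinearMap (sinTest l) = 0 := by
    have : -(2 * Real.pi) * ∑ i, (l i : ℝ) * (u i).toLinearMap (sinTest l) = 0 := by
      rw [Finset.mul_sum, ← h1]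
      exact Finset.sum_congr rfl fun i _ => by ring
    exact (mul_eq_zero.1 this).resolve_left (by simp [Real.pi_ne_zero])
  have e2 : ∑ i, (l i : ℝ) * (u i).toLinearMap (cosTest l) = 0 := by
    have : (2 * Real.pi) * ∑ i, (l i : ℝ) * (u i).toLinearMap (cosTest l) = 0 := by
      rw [Finset.mul_sum, ← h2]
      exact Finset.sum_congr rfl fun i _ => by ring
    exact (mul_eq_zero.1 this).resolve_left (by simp [Real.pi_ne_zero])
  have e3 : ∑ i, (l i : ℂ) * (u i).fourierCoeff l =
      ((∑ i, (l i : ℝ) * (u i).toLinearMap (cosTest l) : ℝ) : ℂ) -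
        Complex.I * ((∑ i, (l i : ℝ) * (u i).toLinearMap (sinTest l) : ℝ) : ℂ) := by
    push_cast
    rw [Finset.mul_sum, ← Finset.sum_sub_distrib]
    exact Finset.sum_congr rfl fun i _ => by rw [Distribution.fourierCoeff]; ring
  rw [e3, e1, e2]; simp

/-! ### Weakly divergence-free fields -/

theorem continuous_testFunction {d : ℕ} (ψ : TestFunction d) : Continuous ψ.1 := by
  have hq : IsOpenQuotientMap (toTorus : (Fin d → ℝ) → Torus d) := by
    have h : (toTorus : (Fin d → ℝ) → Torus d) =
        Pi.map fun _ => (QuotientAddGroup.mk : ℝ → UnitAddCircle) := rfl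
    rw [h]
    exact IsOpenQuotientMap.piMap fun _ => QuotientAddGroup.isOpenQuotientMap_mk
  exact hq.isQuotientMap.continuous_iff.2
    (show ContDiff ℝ ∞ fun x => ψ.1 (toTorus x) from ψ.2).continuous

/-- A test function as a complex continuous function. -/
def testToC {d : ℕ} (ψ : TestFunction d) : C(Torus d, ℂ) :=
  ⟨fun x => (ψ.1 x : ℂ), Complex.continuous_ofReal.comp (continuous_testFunction ψ)⟩

theorem surjective_toTorus {d : ℕ} : Function.Surjective (toTorus : (Fin d → ℝ) → Torus d) := by
  intro x
  choose y hy using fun i => QuotientAddGroup.mk_surjective (x i)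
  exact ⟨y, funext hy⟩

theorem hasDerivAt_testFunction {d : ℕ} (ψ : TestFunction d) (i : Fin d) (x : Torus d) (h : ℝ) :
    HasDerivAt (fun h : ℝ => ψ.1 (x + toTorus (Pi.single i h)))
      ((TestFunction.pderiv i ψ).1 (x + toTorus (Pi.single i h))) h := by
  obtain ⟨y, rfl⟩ := surjective_toTorus x
  have hadd : ∀ z w : Fin d → ℝ, toTorus z + toTorus w = toTorus (z + w) := fun z w => by
    funext i; simp [toTorus]
  have hψ : ContDiff ℝ ∞ fun x : Fin d → ℝ => ψ.1 (toTorus x) := ψ.2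
  have h1 : HasDerivAt (fun h : ℝ => y + Pi.single i h) (Pi.single i (1 : ℝ)) h :=
    (ContinuousLinearMap.single ℝ (fun _ : Fin d => ℝ) i).hasDerivAt.const_add y
  have h2 := (hψ.differentiable (by simp) (y + Pi.single i h)).hasFDerivAt.comp_hasDerivAt h h1
  simp only [hadd]
  change HasDerivAt _ (partialDeriv i ψ.1 (toTorus (y + Pi.single i h))) h
  rw [partialDeriv_toTorus i ψ.2]
  exact h2

/-- Integration by parts on the torus, from translation invariance of the Haar measure. -/
theorem mFourierCoeff_pderiv {d : ℕ} (ψ : TestFunction d) (i : Fin d) (l : Fin d → ℤ) :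
    mFourierCoeff (testToC (TestFunction.pderiv i ψ)) l =
      2 * Real.pi * Complex.I * (l i : ℂ) * mFourierCoeff (testToC ψ) l := by
  -- differentiate `∫ e_{-l}(x) ψ(x + h e_i) dx = e^{2πi l_i h} ψ̂(l)` at `h = 0`
  have hL : HasDerivAt (fun h : ℝ => ∫ x, mFourier (-l) x *
      testToC ψ (x + toTorus (Pi.single i h)) ∂(torusMeasure d))
      (∫ x, mFourier (-l) x * testToC (TestFunction.pderiv i ψ) (x + toTorus (Pi.single i 0))
        ∂(torusMeasure d)) 0 := by
    have hcont : ∀ (f : C(Torus d, ℂ)) (h : ℝ),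
        Continuous fun x => mFourier (-l) x * f (x + toTorus (Pi.single i h)) := fun f h => by
      fun_prop
    refine (hasDerivAt_integral_of_dominated_loc_of_deriv_le
      (F := fun (h : ℝ) x => mFourier (-l) x * testToC ψ (x + toTorus (Pi.single i h)))
      (F' := fun (h : ℝ) x => mFourier (-l) x *
        testToC (TestFunction.pderiv i ψ) (x + toTorus (Pi.single i h)))
      (bound := fun _ => ‖testToC (TestFunction.pderiv i ψ)‖) (s := univ) univ_mem
      (.of_forall fun h => (hcont _ h).aestronglyMeasurable)
      ((hcont _ _).integrable_of_hasCompactSupport (HasCompactSupport.of_compactSpace _))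
      (hcont _ _).aestronglyMeasurable (.of_forall fun x h _ => ?_) (integrable_const _)
      (.of_forall fun x h _ => ?_)).2
    · rw [norm_mul, norm_mFourier_apply, one_mul]
      exact ContinuousMap.norm_coe_le_norm _ _
    · exact ((hasDerivAt_testFunction ψ i x h).ofReal_comp).const_mul _
  have hR : (fun h : ℝ => ∫ x, mFourier (-l) x *
      testToC ψ (x + toTorus (Pi.single i h)) ∂(torusMeasure d)) =
      fun h : ℝ => mFourier l (0 + toTorus (Pi.single i h)) * mFourierCoeff (testToC ψ) l := by
    funext h
    have := mFourierCoeff_translate (-toTorus (Pi.single i h)) (testToC ψ) l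
    rw [mFourierCoeff_eq, mFourier_apply_neg, neg_neg] at this
    simp only [translate_apply, sub_neg_eq_add] at this
    rw [this, zero_add]
  rw [hR] at hL
  have h2 := hL.unique ((hasDerivAt_mFourier l i 0).mul_const _)
  have h0 : (toTorus (Pi.single i (0 : ℝ)) : Torus d) = 0 := by
    rw [Pi.single_zero]; funext i; simp [toTorus]
  have h3 : mFourier l (0 : Torus d) = 1 := by
    have := mFourier_toTorus l 0
    have e : (toTorus (0 : Fin d → ℝ) : Torus d) = 0 := by funext i; simp [toTorus]
    rw [e] at this
    simpa using this
  rw [h0, h3] at h2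
  simp only [add_zero, mul_one] at h2
  rw [mFourierCoeff_eq, h2]

theorem hasSum_parseval {d : ℕ} (f g : C(Torus d, ℂ)) :
    HasSum (fun l => starRingEnd ℂ (mFourierCoeff f l) * mFourierCoeff g l)
      (∫ x, starRingEnd ℂ (f x) * g x ∂(torusMeasure d)) := by
  set F : Lp ℂ 2 (torusMeasure d) := ContinuousMap.toLp 2 (torusMeasure d) ℂ f
  set G : Lp ℂ 2 (torusMeasure d) := ContinuousMap.toLp 2 (torusMeasure d) ℂ g
  have h : HasSum (fun l => starRingEnd ℂ (mFourierCoeff F l) * mFourierCoeff G l)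
      (∫ x, starRingEnd ℂ (F x) * G x ∂(torusMeasure d)) :=
    hasSum_prod_mFourierCoeff (d := Fin d) F G
  have hF : ∀ l, mFourierCoeff F l = mFourierCoeff f l := mFourierCoeff_toLp f
  have hG : ∀ l, mFourierCoeff G l = mFourierCoeff g l := mFourierCoeff_toLp g
  simp only [hF, hG] at h
  have e : ∫ x, starRingEnd ℂ (F x) * G x ∂(torusMeasure d) =
      ∫ x, starRingEnd ℂ (f x) * g x ∂(torusMeasure d) := by
    refine integral_congr_ae ?_
    filter_upwards [ContinuousMap.coeFn_toLp (p := 2) (𝕜 := ℂ) (torusMeasure d) f,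
      ContinuousMap.coeFn_toLp (p := 2) (𝕜 := ℂ) (torusMeasure d) g] with x h1 h2
    rw [h1, h2]
  rwa [e] at h

/-- If `l · û(l) = 0` for all `l`, then `u` is weakly divergence-free, by Parseval's identity. -/
theorem weakDivFree_of_coeff {d : ℕ} {u : Torus d → EuclideanSpace ℝ (Fin d)} {V : Field d}
    (hV : ∀ k x, V k x = ((u x k : ℝ) : ℂ))
    (hdiv : ∀ l : Fin d → ℤ, ∑ k, (l k : ℂ) * mFourierCoeff (V k) l = 0) : WeakDivFree u := by
  intro ψ
  have h1 := hasSum_sum (s := Finset.univ) fun i (_ : i ∈ Finset.univ) =>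
    hasSum_parseval (V i) (testToC (TestFunction.pderiv i ψ))
  have h2 : ∀ l : Fin d → ℤ, ∑ i, starRingEnd ℂ (mFourierCoeff (V i) l) *
      mFourierCoeff (testToC (TestFunction.pderiv i ψ)) l = 0 := by
    intro l
    have h3 := congrArg (starRingEnd ℂ) (hdiv l)
    rw [map_sum, map_zero] at h3
    calc _ = 2 * Real.pi * Complex.I * mFourierCoeff (testToC ψ) l *
          ∑ k, starRingEnd ℂ ((l k : ℂ) * mFourierCoeff (V k) l) := by
          rw [Finset.mul_sum]
          refine Finset.sum_congr rfl fun i _ => ?_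
          rw [mFourierCoeff_pderiv, map_mul, map_intCast]
          ring
      _ = 0 := by rw [h3, mul_zero]
  simp only [h2] at h1
  have h4 := h1.unique hasSum_zero
  rw [← integral_finsetSum] at h4
  · have h5 : ∀ x, ∑ i, starRingEnd ℂ (V i x) * testToC (TestFunction.pderiv i ψ) x =
        ((∑ i, u x i * (TestFunction.pderiv i ψ).1 x : ℝ) : ℂ) := by
      intro x
      push_cast
      refine Finset.sum_congr rfl fun i _ => ?_
      rw [hV, Complex.conj_ofReal]; rfl
    simp only [h5] at h4
    rw [integral_complex_ofReal] at h4
    exact_mod_cast h4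
  · intro i _
    exact (((Complex.continuous_conj.comp (V i).continuous).mul (ContinuousMap.continuous _))
      ).integrable_of_hasCompactSupport (HasCompactSupport.of_compactSpace _)

/-! ### Changing the drift in a scalar Duhamel formula -/

/-- If `y` solves `y' = -(λ + κ) y - n`, `y(0) = a`, in mild form, then it solves
`y' = -λ y - (n + κ y)` in mild form. -/
theorem mild_change_drift {lam κ a : ℂ} {n y : ℝ → ℂ} {M b : ℝ} (hb0 : 0 ≤ b) (hb : b < 1)
    (hn : ContinuousOn n (Ioc 0 1)) (hnM : ∀ s ∈ Ioc (0 : ℝ) 1, ‖n s‖ ≤ M * s ^ (-b))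
    (hy : ∀ t ∈ Ioc (0 : ℝ) 1, y t = Complex.exp (-t * (lam + κ)) * a -
      ∫ s in (0 : ℝ)..t, Complex.exp (-(t - s : ℝ) * (lam + κ)) * n s)
    {t : ℝ} (ht : t ∈ Ioc (0 : ℝ) 1) :
    y t = Complex.exp (-t * lam) * a -
      ∫ s in (0 : ℝ)..t, Complex.exp (-(t - s : ℝ) * lam) * (n s + κ * y s) := by
  have hnI : IntervalIntegrable n volume 0 1 := by
    refine intervalIntegrable_of_le_beta (a := 0) (A := M) le_rfl one_pos hb0 hb one_pos
      (hn.mono Ioo_subset_Ioc_self) fun s hs => ?_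
    rw [neg_zero, Real.rpow_zero, one_mul]
    exact hnM s (Ioo_subset_Ioc_self hs)
  have hmulI : ∀ g : ℝ → ℂ, Continuous g → IntervalIntegrable (fun s => g s * n s) volume 0 1 :=
    fun g hg => hnI.continuousOn_mul hg.continuousOn
  have hsub : ∀ {T : ℝ}, T ∈ Icc (0 : ℝ) 1 → uIcc 0 T ⊆ uIcc (0 : ℝ) 1 := fun {T} hT => by
    rw [uIcc_of_le hT.1, uIcc_of_le zero_le_one]; exact Icc_subset_Icc_right hT.2
  set g : ℝ → ℂ := fun s => Complex.exp (s * (lam + κ)) * n s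
  have hgI : IntervalIntegrable g volume 0 1 := hmulI _ (by fun_prop)
  set J : ℝ → ℂ := fun t => ∫ s in (0 : ℝ)..t, g s
  have hJc : ContinuousOn J (Icc 0 1) := by
    have := intervalIntegral.continuousOn_primitive_interval' hgI (left_mem_uIcc)
    rwa [uIcc_of_le zero_le_one] at this
  have hgc : ContinuousOn g (Ioc 0 1) :=
    (by fun_prop : Continuous fun s : ℝ => Complex.exp (s * (lam + κ))).continuousOn.mul hn
  have hJd : ∀ s ∈ Ioo (0 : ℝ) 1, HasDerivAt J (g s) s := by
    intro s hs
    refine intervalIntegral.integral_hasDerivAt_right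
      (hgI.mono_set (hsub ⟨hs.1.le, hs.2.le⟩)) ?_ ?_
    · exact (hgc.mono Ioo_subset_Ioc_self).stronglyMeasurableAtFilter isOpen_Ioo s hs
    · exact (hgc.mono Ioo_subset_Ioc_self).continuousAt (isOpen_Ioo.mem_nhds hs)
  have hyJ : ∀ t ∈ Ioc (0 : ℝ) 1, y t = Complex.exp (-t * (lam + κ)) * (a - J t) := by
    intro t ht
    rw [hy t ht, mul_sub, ← intervalIntegral.integral_const_mul]
    congr 2; funext s
    rw [← mul_assoc, ← Complex.exp_add]
    congr 2; push_cast; ring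
  have hE : ∀ u v : ℂ, Complex.exp u * Complex.exp v = Complex.exp (u + v) := fun u v =>
    (Complex.exp_add u v).symm
  -- `Q(s) = e^{sλ} y(s)` has derivative `-e^{sλ} (n(s) + κ y(s))`
  set Q : ℝ → ℂ := fun s => Complex.exp (-s * κ) * (a - J s)
  have hQd : ∀ s ∈ Ioo (0 : ℝ) t,
      HasDerivAt Q (-(Complex.exp (s * lam) * (n s + κ * y s))) s := by
    intro s hs
    have hs1 : s ∈ Ioo (0 : ℝ) 1 := ⟨hs.1, hs.2.trans_le ht.2⟩
    have h1 : HasDerivAt (fun s : ℝ => -(s : ℂ) * κ) (-1 * κ) s :=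
      ((Complex.ofRealCLM.hasDerivAt (x := s)).neg).mul_const κ
    refine (h1.cexp.mul ((hJd s hs1).const_sub a)).congr_deriv ?_
    rw [hyJ s (Ioo_subset_Ioc_self hs1)]
    have e1 : Complex.exp (s * lam) * Complex.exp (-s * (lam + κ)) = Complex.exp (-s * κ) := by
      rw [hE]; congr 1; ring
    have e2 : Complex.exp (-s * κ) * Complex.exp (s * (lam + κ)) = Complex.exp (s * lam) := by
      rw [hE]; congr 1; ring
    simp only [g]
    linear_combination (κ * (a - J s)) * e1 - n s * e2
  have hQc : ContinuousOn Q (Icc 0 t) :=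
    (by fun_prop : Continuous fun s : ℝ => Complex.exp (-s * κ)).continuousOn.mul
      (continuousOn_const.sub (hJc.mono (Icc_subset_Icc_right ht.2)))
  have hQI : IntervalIntegrable (fun s => -(Complex.exp (s * lam) * (n s + κ * y s)))
      volume 0 t := by
    have hI1 : IntervalIntegrable (fun s => Complex.exp (s * lam) * n s) volume 0 t :=
      (hmulI _ (by fun_prop)).mono_set (hsub ⟨ht.1.le, ht.2⟩)
    have hI2 : IntervalIntegrable (fun s => κ * Q s) volume 0 t := by
      refine ContinuousOn.intervalIntegrable ?_
      rw [uIcc_of_le ht.1.le]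
      exact continuousOn_const.mul hQc
    refine (hI1.add hI2).neg.congr ?_
    rw [uIoc_of_le ht.1.le]
    intro s hs
    have hs1 : s ∈ Ioc (0 : ℝ) 1 := ⟨hs.1, hs.2.trans ht.2⟩
    have e1 : Complex.exp (s * lam) * Complex.exp (-s * (lam + κ)) = Complex.exp (-s * κ) := by
      rw [hE]; congr 1; ring
    simp only [Pi.neg_apply, Q]
    rw [hyJ s hs1]
    linear_combination (κ * (a - J s)) * e1
  have hFTC := intervalIntegral.integral_eq_sub_of_hasDerivAt_of_le ht.1.le hQc hQd hQI
  rw [intervalIntegral.integral_neg] at hFTC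
  have hQ0 : Q 0 = a := by simp [Q, J]
  have e3 : ∫ s in (0 : ℝ)..t, Complex.exp (-(t - s : ℝ) * lam) * (n s + κ * y s) =
      Complex.exp (-t * lam) * ∫ s in (0 : ℝ)..t, Complex.exp (s * lam) * (n s + κ * y s) := by
    rw [← intervalIntegral.integral_const_mul]
    congr 1; funext s
    rw [← mul_assoc, hE]
    congr 2; push_cast; ring
  have e4 : y t = Complex.exp (-t * lam) * Q t := by
    rw [hyJ t ht]
    simp only [Q]
    rw [← mul_assoc, hE]
    congr 2; ring
  rw [e3, e4]
  rw [hQ0] at hFTC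
  linear_combination (-Complex.exp (-t * lam)) * hFTC

/-! ### Besov norms in terms of scalar blocks -/

theorem fourierSeries_eq {d : ℕ} {a : Coeffs d} (ha : ∀ k, Summable fun l => a l k) (x : Torus d) :
    fourierSeries a x = WithLp.toLp 2 fun k => synth (fun l => a l k) x := by
  have h1 : ∀ k, HasSum (fun l => mFourier l x * a l k) (synth (fun l => a l k) x) := by
    intro k
    rw [synth_apply (ha k)]
    refine Summable.hasSum (.of_norm ?_)
    simpa only [norm_mul, norm_mFourier_apply, one_mul] using (ha k).norm
  have h2 : HasSum (fun l => fun k => mFourier l x * a l k)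
      (fun k => synth (fun l => a l k) x) := Pi.hasSum.2 h1
  have h3 := h2.mapL (PiLp.continuousLinearEquiv 2 ℂ fun _ : Fin d => ℂ).symm.toContinuousLinearMap
  exact h3.tsum_eq

theorem dyadicBlock_eq {d : ℕ} {φ : Vec d → ℝ} (hφ : IsDyadicBump φ) (j : ℤ) (a : Coeffs d)
    (x : Torus d) : dyadicBlock φ j a x =
      WithLp.toLp 2 fun k => synth (blockCoeff φ j fun l => a l k) x := by
  have h : ∀ k, (fun l => (((φ ((2 : ℝ) ^ (-j) • freq l) : ℝ) : ℂ) • a l) k) =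
      blockCoeff φ j fun l => a l k := fun k => by
    funext l
    rw [PiLp.smul_apply, smul_eq_mul, blockCoeff]
  rw [dyadicBlock, fourierSeries_eq]
  · simp only [h]
  · intro k
    rw [h]
    exact summable_blockCoeff hφ j _

theorem continuous_dyadicBlock {d : ℕ} {φ : Vec d → ℝ} (hφ : IsDyadicBump φ) (j : ℤ)
    (a : Coeffs d) : Continuous (dyadicBlock φ j a) := by
  have : dyadicBlock φ j a = fun x =>
      WithLp.toLp 2 fun k => synth (blockCoeff φ j fun l => a l k) x :=
    funext fun x => dyadicBlock_eq hφ j a x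
  rw [this]
  exact (PiLp.continuous_toLp 2 _).comp (continuous_pi fun k => ContinuousMap.continuous _)

/-- For continuous functions on the torus the essential supremum bounds every value. -/
theorem norm_le_of_eLpNorm_top_le {d : ℕ} {E : Type*} [NormedAddCommGroup E] {f : Torus d → E}
    (hf : Continuous f) {C : ℝ} (hC : 0 ≤ C)
    (h : eLpNorm f ∞ (torusMeasure d) ≤ ENNReal.ofReal C) (x : Torus d) : ‖f x‖ ≤ C := by
  have h1 : ∀ᵐ x ∂(torusMeasure d), ‖f x‖ ≤ C := by
    filter_upwards [ae_le_eLpNormEssSup (f := f) (μ := torusMeasure d)] with x hx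
    rw [eLpNorm_exponent_top] at h
    have := hx.trans h
    rwa [← ofReal_norm, ENNReal.ofReal_le_ofReal_iff hC] at this
  have h2 : Dense {x | ‖f x‖ ≤ C} := Measure.dense_of_ae h1
  have h3 : IsClosed {x | ‖f x‖ ≤ C} := isClosed_le hf.norm continuous_const
  have h4 : {x | ‖f x‖ ≤ C} = univ := by rw [← h3.closure_eq]; exact h2.closure_eq
  have h5 : x ∈ {x | ‖f x‖ ≤ C} := by rw [h4]; trivial
  exact h5

theorem two_rpow_mul_neg (j : ℤ) (s : ℝ) :
    (2 : ℝ) ^ ((j : ℝ) * -s) = (((2 : ℝ) ^ j) ^ s)⁻¹ := by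
  rw [Real.rpow_mul (by norm_num), Real.rpow_intCast, Real.rpow_neg (by positivity)]

theorem block_le_of_besovNorm_le {d : ℕ} {φ : Vec d → ℝ} (hφ : IsDyadicBump φ) {s ε : ℝ}
    (hε : 0 ≤ ε) {a : Coeffs d} (h : besovNorm φ (-s) a ≤ ENNReal.ofReal ε) (j : ℤ) (k : Fin d) :
    ‖synth (blockCoeff φ j fun l => a l k)‖ ≤ ε * ((2 : ℝ) ^ j) ^ s := by
  have hN : 0 < ((2 : ℝ) ^ j) ^ s := by positivity
  have h1 := (le_iSup _ j).trans h
  rw [two_rpow_mul_neg] at h1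
  have h2 : eLpNorm (dyadicBlock φ j a) ∞ (torusMeasure d) ≤
      ENNReal.ofReal (ε * ((2 : ℝ) ^ j) ^ s) := by
    have hp : ENNReal.ofReal (((2 : ℝ) ^ j) ^ s) ≠ 0 := by simpa using hN
    rw [ENNReal.ofReal_inv_of_pos hN, mul_comm, ← div_eq_mul_inv,
      ENNReal.div_le_iff hp ENNReal.ofReal_ne_top] at h1
    rwa [ENNReal.ofReal_mul hε]
  rw [ContinuousMap.norm_le _ (by positivity)]
  intro x
  have h3 := norm_le_of_eLpNorm_top_le (continuous_dyadicBlock hφ j a) (by positivity) h2 x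
  rw [dyadicBlock_eq hφ] at h3
  exact (PiLp.norm_apply_le (WithLp.toLp 2 fun k =>
    synth (blockCoeff φ j fun l => a l k) x) k).trans h3

theorem norm_toLp_le {d : ℕ} {𝕜 : Type*} [RCLike 𝕜] {y : Fin d → 𝕜} {C : ℝ}
    (hy : ∀ k, ‖y k‖ ≤ C) : ‖(WithLp.toLp 2 y : EuclideanSpace 𝕜 (Fin d))‖ ≤ d * C := by
  rw [EuclideanSpace.norm_eq]
  refine (Real.sqrt_le_sqrt
    (Finset.sum_sq_le_sq_sum_of_nonneg fun k _ => norm_nonneg (y k))).trans ?_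
  rw [Real.sqrt_sq (Finset.sum_nonneg fun k _ => norm_nonneg (y k))]
  exact (Finset.sum_le_sum fun k _ => hy k).trans_eq (by simp)

theorem besovNorm_le {d : ℕ} {φ : Vec d → ℝ} (hφ : IsDyadicBump φ) {s C : ℝ} {a : Coeffs d}
    (h : ∀ j k, ‖synth (blockCoeff φ j fun l => a l k)‖ ≤ C * ((2 : ℝ) ^ j) ^ s) :
    besovNorm φ (-s) a ≤ ENNReal.ofReal (d * C) := by
  refine iSup_le fun j => ?_
  have hN : 0 < ((2 : ℝ) ^ j) ^ s := by positivity
  have h1 : eLpNorm (dyadicBlock φ j a) ∞ (torusMeasure d) ≤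
      ENNReal.ofReal (d * (C * ((2 : ℝ) ^ j) ^ s)) := by
    rw [eLpNorm_exponent_top]
    refine eLpNormEssSup_le_of_ae_bound (.of_forall fun x => ?_)
    rw [dyadicBlock_eq hφ]
    exact norm_toLp_le fun k => (ContinuousMap.norm_coe_le_norm _ x).trans (h j k)
  rw [two_rpow_mul_neg]
  calc _ ≤ ENNReal.ofReal ((((2 : ℝ) ^ j) ^ s)⁻¹) *
        ENNReal.ofReal (d * (C * ((2 : ℝ) ^ j) ^ s)) := by gcongr
    _ = ENNReal.ofReal (d * C) := by
      rw [← ENNReal.ofReal_mul (by positivity)]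
      congr 1
      field_simp

/-- The dyadic block as a bounded operator on `C(𝕋^d)`. -/
def blockCLM {d : ℕ} {φ : Vec d → ℝ} (hφ : IsDyadicBump φ) (j : ℤ) :
    C(Torus d, ℂ) →L[ℂ] C(Torus d, ℂ) :=
  LinearMap.mkContinuous
    { toFun := fun f => synth (blockCoeff φ j (mFourierCoeff f))
      map_add' := fun f g => by
        refine eq_of_mFourierCoeff_eq fun l => ?_
        rw [← coeffCLM_apply l (_ + _), map_add, coeffCLM_apply, coeffCLM_apply]
        simp only [mFourierCoeff_synth (summable_blockCoeff hφ j _), blockCoeff]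
        rw [← coeffCLM_apply, map_add, coeffCLM_apply, coeffCLM_apply, mul_add]
      map_smul' := fun c f => by
        refine eq_of_mFourierCoeff_eq fun l => ?_
        rw [RingHom.id_apply, ← coeffCLM_apply l (c • _), map_smul, coeffCLM_apply]
        simp only [mFourierCoeff_synth (summable_blockCoeff hφ j _), blockCoeff]
        rw [← coeffCLM_apply, map_smul, coeffCLM_apply, smul_eq_mul, smul_eq_mul]
        ring }
    (exists_block_le hφ).choose fun f => (exists_block_le hφ).choose_spec.2 j f

theorem blockCLM_apply {d : ℕ} {φ : Vec d → ℝ} (hφ : IsDyadicBump φ) (j : ℤ)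
    (f : C(Torus d, ℂ)) : blockCLM hφ j f = synth (blockCoeff φ j (mFourierCoeff f)) := rfl

theorem blockCLM_synth {d : ℕ} {φ : Vec d → ℝ} (hφ : IsDyadicBump φ) (j : ℤ)
    {a : (Fin d → ℤ) → ℂ} (ha : Summable a) :
    blockCLM hφ j (synth a) = synth (blockCoeff φ j a) := by
  rw [blockCLM_apply, funext (mFourierCoeff_synth ha)]

/-- The blocks of very low frequency only see the mean, hence vanish. -/
theorem blockCoeff_eq_zero {d : ℕ} {φ : Vec d → ℝ} (hφ : IsDyadicBump φ) {j : ℤ} (hj : j < -2)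
    (a : (Fin d → ℤ) → ℂ) : blockCoeff φ j a = 0 := by
  funext l
  by_cases h : φ ((2 : ℝ) ^ (-j) • freq l) = 0
  · simp only [blockCoeff, h, Complex.ofReal_zero, zero_mul, Pi.zero_apply]
  · exfalso
    by_cases hl : l = 0
    · subst hl
      rw [freq_zero, smul_zero] at h
      exact h (bump_zero hφ)
    · have h1 := (bump_freq_ne_zero hφ h).2
      have h2 := one_le_norm_freq hl
      have h3 : (2 : ℝ) ^ j ≤ 2 ^ (-3 : ℤ) := zpow_le_zpow_right₀ one_le_two (by omega)
      norm_num at h3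
      linarith

theorem synth_zero {d : ℕ} : synth (0 : (Fin d → ℤ) → ℂ) = 0 :=
  eq_of_mFourierCoeff_eq fun l => by
    rw [mFourierCoeff_synth (a := (0 : (Fin d → ℤ) → ℂ)) summable_zero, ← coeffCLM_apply, map_zero,
      Pi.zero_apply]

theorem quarter_le_two_zpow {j : ℤ} (hj : ¬j < -2) : (1 / 4 : ℝ) ≤ 2 ^ j := by
  have h : (2 : ℝ) ^ (-2 : ℤ) ≤ 2 ^ j := zpow_le_zpow_right₀ one_le_two (not_lt.1 hj)
  norm_num at h ⊢
  exact h

/-- On the torus, `L^∞` embeds into the Besov space of negative regularity `-s`. -/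
theorem exists_block_le_besov {d : ℕ} {φ : Vec d → ℝ} (hφ : IsDyadicBump φ) {s : ℝ} (hs : 0 ≤ s) :
    ∃ C : ℝ, 0 ≤ C ∧ ∀ (j : ℤ) (f : C(Torus d, ℂ)),
      ‖synth (blockCoeff φ j (mFourierCoeff f))‖ ≤ C * ‖f‖ * ((2 : ℝ) ^ j) ^ s := by
  obtain ⟨C, hC0, hC⟩ := exists_block_le hφ
  refine ⟨C * 4 ^ s, by positivity, fun j f => ?_⟩
  by_cases hj : j < -2
  · rw [blockCoeff_eq_zero hφ hj, synth_zero, norm_zero]; positivity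
  · refine (hC j f).trans ?_
    have h1 : 1 ≤ 4 ^ s * ((2 : ℝ) ^ j) ^ s := by
      rw [← Real.mul_rpow (by norm_num) (by positivity)]
      exact Real.one_le_rpow (by linarith [quarter_le_two_zpow hj]) hs
    calc C * ‖f‖ ≤ C * ‖f‖ * (4 ^ s * ((2 : ℝ) ^ j) ^ s) :=
          le_mul_of_one_le_right (by positivity) h1
      _ = _ := by ring

/-- Besov bound on the Oseen operators: the block `2^j / (1 + τ 2^{2βj})` is at most a multiple of
`2^{js} τ^{-θ}` when `1 - s ≤ 2βθ`. -/
theorem exists_oseen_block_le {d : ℕ} {φ : Vec d → ℝ} (hφ : IsDyadicBump φ) {β s θ : ℝ}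
    (hβ : 0 < β) (hθ0 : 0 ≤ θ) (hθ1 : θ ≤ 1) (hs : 1 - s ≤ 2 * β * θ) :
    ∃ C : ℝ, 0 ≤ C ∧ ∀ (c : Fin d → ℝ) (F : Tensor d) (k : Fin d) (j : ℤ) (τ : ℝ), 0 < τ →
      ‖blockCLM hφ j (oseen β c τ F k)‖ ≤ C * ((2 : ℝ) ^ j) ^ s * τ ^ (-θ) * ‖F‖ := by
  obtain ⟨C, hC0, hC⟩ := exists_projDiv_block_le hφ β
  set e : ℝ := 1 - s - 2 * β * θ
  have he : e ≤ 0 := by simp only [e]; linarith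
  refine ⟨d * (d * (C * (1 / 4) ^ e)), by positivity, fun c F k j τ hτ => ?_⟩
  by_cases hj : j < -2
  · rw [blockCLM_apply, blockCoeff_eq_zero hφ hj, synth_zero, norm_zero]; positivity
  set N : ℝ := (2 : ℝ) ^ j
  have hN4 : 1 / 4 ≤ N := quarter_le_two_zpow hj
  have hN : 0 < N := by linarith
  have hscalar : N * (1 + τ * N ^ (2 * β))⁻¹ ≤ (1 / 4) ^ e * N ^ s * τ ^ (-θ) := by
    set y := τ * N ^ (2 * β)
    have hy : 0 < y := by positivity
    have h1 : (1 + y)⁻¹ ≤ y ^ (-θ) := by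
      rw [Real.rpow_neg hy.le]
      refine inv_anti₀ (by positivity) ?_
      calc y ^ θ ≤ (1 + y) ^ θ := Real.rpow_le_rpow hy.le (by linarith) hθ0
        _ ≤ (1 + y) ^ (1 : ℝ) := Real.rpow_le_rpow_of_exponent_le (by linarith) hθ1
        _ = 1 + y := Real.rpow_one _
    have h2 : N * y ^ (-θ) = N ^ e * N ^ s * τ ^ (-θ) := by
      simp only [y]
      rw [Real.mul_rpow hτ.le (by positivity), ← Real.rpow_mul hN.le, ← Real.rpow_add hN]
      have : N ^ (e + s) = N * N ^ (2 * β * -θ) := by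
        nth_rewrite 2 [← Real.rpow_one N]
        rw [← Real.rpow_add hN]; congr 1; simp only [e]; ring
      rw [this]; ring
    have h3 : N ^ e ≤ (1 / 4) ^ e := Real.rpow_le_rpow_of_nonpos (by norm_num) hN4 he
    calc _ ≤ N * y ^ (-θ) := by gcongr
      _ = N ^ e * N ^ s * τ ^ (-θ) := h2
      _ ≤ _ := by gcongr
  have hterm : ∀ m i : Fin d, ‖blockCLM hφ j (synth fun l => propagator β c τ l *
      (projDivSymbol k m i (freq l) * mFourierCoeff (F i m) l))‖ ≤
        C * (1 / 4) ^ e * (N ^ s * τ ^ (-θ)) * ‖F‖ := by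
    intro m i
    rw [blockCLM_synth hφ j (summable_oseen hβ c hτ k m i _)]
    calc _ ≤ C * (N * (1 + τ * N ^ (2 * β))⁻¹) * ‖F i m‖ := hC k m i c (F i m) j τ hτ.le
      _ ≤ C * ((1 / 4) ^ e * N ^ s * τ ^ (-θ)) * ‖F‖ := by
        gcongr
        exact norm_tensor_apply_le F i m
      _ = _ := by ring
  have hsum : blockCLM hφ j (oseen β c τ F k) = ∑ m, ∑ i, blockCLM hφ j
      (synth fun l => propagator β c τ l *
        (projDivSymbol k m i (freq l) * mFourierCoeff (F i m) l)) := by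
    simp only [oseen, map_sum]
  rw [hsum]
  refine (norm_sum_le_of_le _ fun m _ => norm_sum_le_of_le _ fun i _ => hterm m i).trans_eq ?_
  simp only [Finset.sum_const, Finset.card_univ, Fintype.card_fin, nsmul_eq_mul]
  ring

/-- Besov bound on the Duhamel integral. -/
theorem norm_block_duhamel_le {d : ℕ} {φ : Vec d → ℝ} (hφ : IsDyadicBump φ) {β C s θ b M t : ℝ}
    {c : Fin d → ℝ} {G : ℝ → Tensor d} (hC0 : 0 ≤ C)
    (hC : ∀ (F : Tensor d) (k : Fin d) (j : ℤ) (τ : ℝ), 0 < τ →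
      ‖blockCLM hφ j (oseen β c τ F k)‖ ≤ C * ((2 : ℝ) ^ j) ^ s * τ ^ (-θ) * ‖F‖)
    (hθ0 : 0 ≤ θ) (hθ1 : θ < 1) (hb0 : 0 ≤ b) (hb : b < 1) (hθb : θ + b ≤ 1) (hM : 0 ≤ M)
    (ht : 0 < t) (ht1 : t ≤ 1)
    (hI : IntervalIntegrable (fun s => oseen β c (t - s) (G s)) volume 0 t)
    (hGM : ∀ s ∈ Ioc (0 : ℝ) 1, ‖G s‖ ≤ M * s ^ (-b)) (k : Fin d) (j : ℤ) :
    ‖blockCLM hφ j (duhamel β c G t k)‖ ≤ C * M * betaConst θ b * ((2 : ℝ) ^ j) ^ s := by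
  set L : Field d →L[ℂ] C(Torus d, ℂ) := blockCLM hφ j ∘L ContinuousLinearMap.proj (R := ℂ) k
  have h : blockCLM hφ j (duhamel β c G t k) = ∫ s in (0 : ℝ)..t, L (oseen β c (t - s) (G s)) :=
    (L.intervalIntegral_comp_comm hI).symm
  rw [h]
  have h1 := norm_integral_le_beta (f := fun s => L (oseen β c (t - s) (G s)))
    (A := C * ((2 : ℝ) ^ j) ^ s * M) hθ0 hθ1 hb0 hb ht fun σ hσ => by
      refine (hC _ k j _ (sub_pos.2 hσ.2)).trans ?_
      have := hGM σ ⟨hσ.1, hσ.2.le.trans ht1⟩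
      have p : 0 ≤ (t - σ) ^ (-θ) := Real.rpow_nonneg (sub_pos.2 hσ.2).le _
      calc _ ≤ C * ((2 : ℝ) ^ j) ^ s * (t - σ) ^ (-θ) * (M * σ ^ (-b)) := by gcongr
        _ = _ := by ring
  refine h1.trans ?_
  have h2 : t ^ (1 - θ - b) ≤ 1 := Real.rpow_le_one ht.le ht1 (by linarith)
  have h3 := betaConst_nonneg θ b
  calc _ ≤ C * ((2 : ℝ) ^ j) ^ s * M * (1 * betaConst θ b) := by gcongr
    _ = _ := by ring

/-! ### Mean and fluctuation -/

/-- The mean of the initial datum. -/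
def meanValue {d : ℕ} (v₀ : Fin d → Distribution d) (k : Fin d) : ℝ := ((v₀ k).fourierCoeff 0).re

/-- The Fourier coefficients of the mean-free part of the initial datum. -/
def fluctuation {d : ℕ} (v₀ : Fin d → Distribution d) (k : Fin d) (l : Fin d → ℤ) : ℂ :=
  if l = 0 then 0 else (v₀ k).fourierCoeff l

theorem fluctuation_add_mean {d : ℕ} (v₀ : Fin d → Distribution d) (k : Fin d) (l : Fin d → ℤ) :
    fluctuation v₀ k l + (if l = 0 then (meanValue v₀ k : ℂ) else 0) = (v₀ k).fourierCoeff l := by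
  by_cases hl : l = 0
  · subst hl
    simp only [fluctuation, if_pos, zero_add, meanValue]
    exact Complex.ext (by simp) (by simp [im_fourierCoeff_zero])
  · simp [fluctuation, hl]

theorem fluctuation_neg {d : ℕ} (v₀ : Fin d → Distribution d) (k : Fin d) (l : Fin d → ℤ) :
    fluctuation v₀ k (-l) = starRingEnd ℂ (fluctuation v₀ k l) := by
  by_cases hl : l = 0
  · simp [fluctuation, hl]
  · simp [fluctuation, hl, fourierCoeff_neg]

theorem blockCoeff_congr {d : ℕ} {φ : Vec d → ℝ} (hφ : IsDyadicBump φ) (j : ℤ)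
    {a b : (Fin d → ℤ) → ℂ} (h : ∀ l ≠ 0, a l = b l) : blockCoeff φ j a = blockCoeff φ j b := by
  funext l
  by_cases hl : l = 0
  · subst hl
    simp [blockCoeff, freq_zero, bump_zero hφ]
  · simp [blockCoeff, h l hl]

theorem growthLE_fluctuation {d : ℕ} {φ : Vec d → ℝ} (hφ : IsDyadicBump φ) {s M : ℝ} (hs : 0 ≤ s)
    (hM : 0 ≤ M) {a : (Fin d → ℤ) → ℂ} (ha0 : a 0 = 0)
    (h : ∀ j : ℤ, ‖synth (blockCoeff φ j a)‖ ≤ M * ((2 : ℝ) ^ j) ^ s) :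
    GrowthLE s (3 * M * 2 ^ s) a := by
  intro l
  by_cases hl : l = 0
  · subst hl
    rw [ha0, norm_zero]; positivity
  · have h1 := norm_le_of_block_le hφ hs hM hl (z := a l) fun j => by
      have h2 := norm_mFourierCoeff_le (synth (blockCoeff φ j a)) l
      rw [mFourierCoeff_synth (summable_blockCoeff hφ j a)] at h2
      exact h2.trans (h j)
    refine h1.trans ?_
    rw [mul_assoc (3 * M), ← Real.mul_rpow (by norm_num) (by positivity)]
    gcongr
    linarith

/-! ### Fourier modes of the nonlinearity -/

/-- The Fourier coefficient of the `k`-th component of `ℙ div F` at frequency `l`. -/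
def projDivMode {d : ℕ} (F : Tensor d) (k : Fin d) (l : Fin d → ℤ) : ℂ :=
  ∑ m, ∑ j, projDivSymbol k m j (freq l) * mFourierCoeff (F j m) l

theorem continuous_projDivMode {d : ℕ} (k : Fin d) (l : Fin d → ℤ) :
    Continuous fun F : Tensor d => projDivMode F k l := by
  refine continuous_finsetSum _ fun m _ => continuous_finsetSum _ fun j _ => ?_
  have hF : Continuous fun F : Tensor d => F j m := by fun_prop
  exact continuous_const.mul ((coeffCLM l).continuous.comp hF)

theorem norm_projDivMode_le {d : ℕ} (F : Tensor d) (k : Fin d) (l : Fin d → ℤ) :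
    ‖projDivMode F k l‖ ≤ d * (d * (4 * Real.pi * (1 + ‖freq l‖))) * ‖F‖ := by
  have h : ∀ m j : Fin d, ‖projDivSymbol k m j (freq l) * mFourierCoeff (F j m) l‖ ≤
      4 * Real.pi * (1 + ‖freq l‖) * ‖F‖ := fun m j => by
    refine (growthLE_projDivSymbol k m j (F j m) l).trans ?_
    rw [Real.rpow_one, mul_right_comm]
    gcongr
    exact norm_tensor_apply_le F j m
  refine (norm_sum_le_of_le _ fun m _ => norm_sum_le_of_le _ fun j _ => h m j).trans_eq ?_
  simp only [Finset.sum_const, Finset.card_univ, Fintype.card_fin, nsmul_eq_mul]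
  ring

theorem norm_freq_sq {d : ℕ} (l : Fin d → ℤ) : ‖freq l‖ ^ 2 = ∑ i, (l i : ℝ) * l i := by
  rw [EuclideanSpace.norm_sq_eq]
  exact Finset.sum_congr rfl fun i _ => by
    rw [Real.norm_eq_abs, sq_abs, pow_two]; rfl

/-- The Leray projection fixes divergence-free modes. -/
theorem sum_leraySymbol_mul {d : ℕ} (l : Fin d → ℤ) {a : Fin d → ℂ}
    (ha : ∑ m, (l m : ℂ) * a m = 0) (k : Fin d) : ∑ m, (leraySymbol l k m : ℂ) * a m = a k := by
  have h : ∀ m, (leraySymbol l k m : ℂ) * a m = (if k = m then a m else 0) -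
      (l k : ℂ) / ((‖freq l‖ ^ 2 : ℝ) : ℂ) * ((l m : ℂ) * a m) := fun m => by
    simp only [leraySymbol]
    split_ifs <;> push_cast <;> ring
  simp only [h, Finset.sum_sub_distrib, ← Finset.mul_sum, ha]
  simp

/-- The Leray projection annihilates gradients. -/
theorem sum_mul_leraySymbol {d : ℕ} (l : Fin d → ℤ) (m : Fin d) :
    ∑ k, (l k : ℂ) * (leraySymbol l k m : ℂ) = 0 := by
  have h : ∑ k, (l k : ℝ) * leraySymbol l k m = 0 := by
    by_cases hl : l = 0
    · simp [hl]
    have h0 : ‖freq l‖ ^ 2 ≠ 0 := pow_ne_zero 2 (norm_ne_zero_iff.2 (freq_ne_zero hl))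
    have h1 : ∀ k, (l k : ℝ) * leraySymbol l k m = (if k = m then (l k : ℝ) else 0) -
        ((l k : ℝ) * l k) * ((l m : ℝ) / ‖freq l‖ ^ 2) := fun k => by
      simp only [leraySymbol]
      split_ifs <;> ring
    simp only [h1, Finset.sum_sub_distrib, ← Finset.sum_mul, ← norm_freq_sq]
    rw [mul_div_cancel₀ _ h0]
    simp
  exact_mod_cast h

theorem projDivMode_eq {d : ℕ} (F : Tensor d) (k : Fin d) (l : Fin d → ℤ) :
    projDivMode F k l = ∑ m, (leraySymbol l k m : ℂ) *
      ∑ j, 2 * Real.pi * Complex.I * (l j : ℂ) * mFourierCoeff (F j m) l := by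
  simp only [projDivMode, projDivSymbol_freq, Finset.mul_sum, mul_assoc]

theorem sum_mul_projDivMode {d : ℕ} (F : Tensor d) (l : Fin d → ℤ) :
    ∑ k, (l k : ℂ) * projDivMode F k l = 0 := by
  set D : Fin d → ℂ := fun m => ∑ j, 2 * Real.pi * Complex.I * (l j : ℂ) * mFourierCoeff (F j m) l
  have h : ∀ k, (l k : ℂ) * projDivMode F k l =
      ∑ m, ((l k : ℂ) * (leraySymbol l k m : ℂ)) * D m := fun k => by
    rw [projDivMode_eq, Finset.mul_sum]
    exact Finset.sum_congr rfl fun m _ => (mul_assoc _ _ _).symm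
  simp only [h]
  rw [Finset.sum_comm]
  simp only [← Finset.sum_mul, sum_mul_leraySymbol, zero_mul, Finset.sum_const_zero]

/-- The field `u + c`. -/
def addConst {d : ℕ} (c : Fin d → ℝ) (u : Field d) : Field d := fun k => u k + (c k : ℂ) • 1

theorem mFourierCoeff_one {d : ℕ} (l : Fin d → ℤ) :
    mFourierCoeff (1 : C(Torus d, ℂ)) l = if l = 0 then 1 else 0 := by
  have h : (1 : C(Torus d, ℂ)) = mFourier 0 := mFourier_zero.symm
  rw [h, mFourierCoeff_mFourier]

theorem mFourierCoeff_addConst {d : ℕ} (c : Fin d → ℝ) (u : Field d) (k : Fin d) (l : Fin d → ℤ) :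
    mFourierCoeff (addConst c u k) l = mFourierCoeff (u k) l + if l = 0 then (c k : ℂ) else 0 := by
  rw [← coeffCLM_apply, addConst, map_add, map_smul, coeffCLM_apply, coeffCLM_apply,
    mFourierCoeff_one]
  simp

/-- **Galilean drift.** For divergence-free `w`, the nonlinearity of `w + c` is that of `w` plus
`c·∇w`. -/
theorem projDivMode_addConst {d : ℕ} (c : Fin d → ℝ) (w : Field d) (k : Fin d) (l : Fin d → ℤ)
    (hw : ∑ m, (l m : ℂ) * mFourierCoeff (w m) l = 0) :
    projDivMode (tensor (addConst c w) (addConst c w)) k l = projDivMode (tensor w w) k l +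
      2 * Real.pi * Complex.I * (∑ i, (l i : ℂ) * (c i : ℂ)) * mFourierCoeff (w k) l := by
  have h1 : ∀ j m, mFourierCoeff (tensor (addConst c w) (addConst c w) j m) l =
      mFourierCoeff (tensor w w j m) l + c j * mFourierCoeff (w m) l + c m * mFourierCoeff (w j) l +
        c j * c m * (if l = 0 then 1 else 0) := fun j m => by
    have e : tensor (addConst c w) (addConst c w) j m = tensor w w j m + (c j : ℂ) • w m +
        (c m : ℂ) • w j + ((c j : ℂ) * c m) • (1 : C(Torus d, ℂ)) := by
      ext x
      simp [tensor, addConst]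
      ring
    rw [← coeffCLM_apply, e, map_add, map_add, map_add, map_smul, map_smul, map_smul]
    simp only [coeffCLM_apply, mFourierCoeff_one, smul_eq_mul]
  have h2 : ∀ j, (l j : ℂ) * (if l = 0 then 1 else 0) = 0 := fun j => by
    split_ifs with h <;> simp [h]
  have h3 : ∀ m, ∑ j, 2 * Real.pi * Complex.I * (l j : ℂ) *
      mFourierCoeff (tensor (addConst c w) (addConst c w) j m) l =
      ∑ j, 2 * Real.pi * Complex.I * (l j : ℂ) * mFourierCoeff (tensor w w j m) l +
        2 * Real.pi * Complex.I * (∑ i, (l i : ℂ) * (c i : ℂ)) * mFourierCoeff (w m) l := by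
    intro m
    have h4 : ∀ j, 2 * Real.pi * Complex.I * (l j : ℂ) *
        mFourierCoeff (tensor (addConst c w) (addConst c w) j m) l =
        2 * Real.pi * Complex.I * (l j : ℂ) * mFourierCoeff (tensor w w j m) l +
        2 * Real.pi * Complex.I * ((l j : ℂ) * (c j : ℂ)) * mFourierCoeff (w m) l +
        2 * Real.pi * Complex.I * c m * ((l j : ℂ) * mFourierCoeff (w j) l) := fun j => by
      rw [h1]
      linear_combination (2 * Real.pi * Complex.I * c j * c m) * h2 j
    simp only [h4, Finset.sum_add_distrib]
    rw [← Finset.mul_sum, hw, mul_zero, add_zero, ← Finset.sum_mul, ← Finset.mul_sum]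
  generalize hκ : 2 * Real.pi * Complex.I * (∑ i, (l i : ℂ) * (c i : ℂ)) = κ at h3 ⊢
  simp only [projDivMode_eq, h3, mul_add, Finset.sum_add_distrib]
  rw [← sum_leraySymbol_mul l hw k]
  congr 1
  rw [Finset.mul_sum]
  exact Finset.sum_congr rfl fun m _ => by ring

/-! ### From the drift equation back to the original one -/

theorem mFourierCoeff_heatField {d : ℕ} {β : ℝ} (c : Fin d → ℝ) {a : Fin d → (Fin d → ℤ) → ℂ}
    {t : ℝ} (k : Fin d) (ha : Summable fun l => propagator β c t l * a k l) (l : Fin d → ℤ) :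
    mFourierCoeff (heatField β c a t k) l = propagator β c t l * a k l := by
  rw [heatField, mFourierCoeff_synth ha]

theorem mFourierCoeff_duhamel {d : ℕ} {β : ℝ} (hβ : 0 < β) {c : Fin d → ℝ} {G : ℝ → Tensor d}
    {t : ℝ} (ht : 0 < t) (hI : IntervalIntegrable (fun s => oseen β c (t - s) (G s)) volume 0 t)
    (k : Fin d) (l : Fin d → ℤ) : mFourierCoeff (duhamel β c G t k) l =
      ∫ s in (0 : ℝ)..t, propagator β c (t - s) l * projDivMode (G s) k l := by
  set L : Field d →L[ℂ] ℂ := coeffCLM l ∘L ContinuousLinearMap.proj (R := ℂ) k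
  have h : mFourierCoeff (duhamel β c G t k) l = ∫ s in (0 : ℝ)..t, L (oseen β c (t - s) (G s)) :=
    (L.intervalIntegral_comp_comm hI).symm
  rw [h]
  refine intervalIntegral.integral_congr_ae ?_
  rw [uIoc_of_le ht.le]
  exact ae_mem_Ioo_of_mem_Ioc 0 t fun s hs => mFourierCoeff_oseen hβ c (sub_pos.2 hs.2) (G s) k l

theorem sum_mul_duhamel {d : ℕ} {β : ℝ} (hβ : 0 < β) {c : Fin d → ℝ} {G : ℝ → Tensor d}
    {t : ℝ} (ht : 0 < t) (hI : IntervalIntegrable (fun s => oseen β c (t - s) (G s)) volume 0 t)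
    (l : Fin d → ℤ) : ∑ k, (l k : ℂ) * mFourierCoeff (duhamel β c G t k) l = 0 := by
  set L : Field d →L[ℂ] ℂ :=
    ∑ k, (l k : ℂ) • (coeffCLM l ∘L ContinuousLinearMap.proj (R := ℂ) k)
  have hL : ∀ u : Field d, L u = ∑ k, (l k : ℂ) * mFourierCoeff (u k) l := fun u => by
    simp [L]
  have h : L (duhamel β c G t) = ∫ s in (0 : ℝ)..t, L (oseen β c (t - s) (G s)) :=
    (L.intervalIntegral_comp_comm hI).symm
  rw [← hL, h]
  have h0 : ∫ s in (0 : ℝ)..t, L (oseen β c (t - s) (G s)) = ∫ s in (0 : ℝ)..t, (0 : ℂ) := by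
    refine intervalIntegral.integral_congr_ae ?_
    rw [uIoc_of_le ht.le]
    refine ae_mem_Ioo_of_mem_Ioc 0 t fun s hs => ?_
    rw [hL]
    simp only [mFourierCoeff_oseen hβ c (sub_pos.2 hs.2)]
    change ∑ k, (l k : ℂ) * (propagator β c (t - s) l * projDivMode (G s) k l) = 0
    simp only [mul_left_comm _ (propagator β c (t - s) l), ← Finset.mul_sum, sum_mul_projDivMode,
      mul_zero]
  rw [h0, intervalIntegral.integral_zero]

/-- The Duhamel equation, mode by mode. -/
theorem mFourierCoeff_heatField_sub_duhamel {d : ℕ} {β : ℝ} (hβ : 0 < β) {c : Fin d → ℝ}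
    {u₀ : Fin d → (Fin d → ℤ) → ℂ} {G : ℝ → Tensor d} {t : ℝ} (ht : 0 < t)
    (hI : IntervalIntegrable (fun s => oseen β c (t - s) (G s)) volume 0 t)
    (hsum : ∀ k, Summable fun l => propagator β c t l * u₀ k l) (k : Fin d) (l : Fin d → ℤ) :
    mFourierCoeff ((heatField β c u₀ t - duhamel β c G t) k) l = propagator β c t l * u₀ k l -
      ∫ s in (0 : ℝ)..t, propagator β c (t - s) l * projDivMode (G s) k l := by
  have h : (heatField β c u₀ t - duhamel β c G t) k =
    heatField β c u₀ t k - duhamel β c G t k := rfl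
  rw [← mFourierCoeff_duhamel hβ ht hI, ← mFourierCoeff_heatField c k (hsum k), h,
    ← coeffCLM_apply, map_sub, coeffCLM_apply, coeffCLM_apply]

/-- A solution of the Duhamel equation with divergence-free data is divergence-free. -/
theorem sum_mul_mFourierCoeff_solution {d : ℕ} {β : ℝ} (hβ : 0 < β) {c : Fin d → ℝ}
    {u₀ : Fin d → (Fin d → ℤ) → ℂ} {G : ℝ → Tensor d} {t : ℝ} (ht : 0 < t)
    (hI : IntervalIntegrable (fun s => oseen β c (t - s) (G s)) volume 0 t)
    (hsum : ∀ k, Summable fun l => propagator β c t l * u₀ k l)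
    (hdiv : ∀ l, ∑ k, (l k : ℂ) * u₀ k l = 0) (l : Fin d → ℤ) :
    ∑ k, (l k : ℂ) * mFourierCoeff ((heatField β c u₀ t - duhamel β c G t) k) l = 0 := by
  have h : ∀ k, mFourierCoeff ((heatField β c u₀ t - duhamel β c G t) k) l =
      propagator β c t l * u₀ k l - mFourierCoeff (duhamel β c G t k) l := fun k => by
    rw [mFourierCoeff_heatField_sub_duhamel hβ ht hI hsum, mFourierCoeff_duhamel hβ ht hI]
  simp only [h, mul_sub, Finset.sum_sub_distrib, sum_mul_duhamel hβ ht hI,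
    mul_left_comm _ (propagator β c t l), ← Finset.mul_sum, hdiv, mul_zero, sub_zero]

theorem rate_zero {d : ℕ} {β : ℝ} (hβ : 0 < β) : rate β (0 : Fin d → ℤ) = 0 := by
  rw [rate, freq_zero, norm_zero, mul_zero, Real.zero_rpow (by positivity)]

theorem norm_addConst_le {d : ℕ} (c : Fin d → ℝ) (u : Field d) : ‖addConst c u‖ ≤ ‖u‖ + ‖c‖ := by
  refine (pi_norm_le_iff_of_nonneg (by positivity)).2 fun k => ?_
  refine (norm_add_le _ _).trans (add_le_add (norm_le_pi_norm u k) ?_)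
  rw [norm_smul, Complex.norm_real]
  exact (mul_le_of_le_one_right (norm_nonneg _) (by simp)).trans (norm_le_pi_norm c k)

theorem continuous_addConst {d : ℕ} (c : Fin d → ℝ) : Continuous (addConst (d := d) c) :=
  continuous_pi fun k => (continuous_apply k).add continuous_const

theorem summable_propagator_mul_add_mean {d : ℕ} {β : ℝ} (hβ : 0 < β) (c : Fin d → ℝ) {t : ℝ}
    (ht : 0 < t) {m B : ℝ} (hm : 0 ≤ m) {a : (Fin d → ℤ) → ℂ} (ha : GrowthLE m B a) (z : ℂ) :
    Summable fun l => propagator β c t l * (a l + if l = 0 then z else 0) := by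
  simp only [mul_add]
  refine (summable_propagator_mul hβ c ht hm ha).add ?_
  refine summable_of_ne_finset_zero (s := {0}) fun l hl => ?_
  rw [if_neg (by simpa using hl), mul_zero]

theorem sum_mul_mFourierCoeff_addConst {d : ℕ} (c : Fin d → ℝ) {u : Field d} {l : Fin d → ℤ}
    (hu : ∑ k, (l k : ℂ) * mFourierCoeff (u k) l = 0) :
    ∑ k, (l k : ℂ) * mFourierCoeff (addConst c u k) l = 0 := by
  have h : ∀ k, (l k : ℂ) * (if l = 0 then (c k : ℂ) else 0) = 0 := fun k => by
    split_ifs with hl <;> simp [hl]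
  simp only [mFourierCoeff_addConst, mul_add, h, add_zero, hu]

/-- If `w` solves the Duhamel equation with drift `c`, then `w + c` solves the original one. -/
theorem addConst_eq_heatField_sub_duhamel {d : ℕ} {β : ℝ} (hβ : 0 < β) {c : Fin d → ℝ}
    {K a γ M M' : ℝ} (hK0 : 0 ≤ K) (hK : ∀ c : Fin d → ℝ, OseenBound β c K a) (ha0 : 0 ≤ a)
    (ha : a < 1) (hγ0 : 0 ≤ γ) (hγ : 2 * γ < 1)
    {u₀ : Fin d → (Fin d → ℤ) → ℂ} {m B : ℝ} (hm : 0 ≤ m) (hu₀ : ∀ k, GrowthLE m B (u₀ k))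
    (hdiv : ∀ l, ∑ k, (l k : ℂ) * u₀ k l = 0) {w : ℝ → Field d}
    (hwc : ContinuousOn w (Ioc 0 1)) (hwM : ∀ t ∈ Ioc (0 : ℝ) 1, ‖w t‖ ≤ M * t ^ (-γ))
    (hVM : ∀ t ∈ Ioc (0 : ℝ) 1, ‖addConst c (w t)‖ ≤ M' * t ^ (-γ))
    (hw : ∀ t ∈ Ioc (0 : ℝ) 1,
      w t = heatField β c u₀ t - duhamel β c (fun s => tensor (w s) (w s)) t)
    {t : ℝ} (ht : t ∈ Ioc (0 : ℝ) 1) :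
    addConst c (w t) = heatField β 0 (fun k l => u₀ k l + if l = 0 then (c k : ℂ) else 0) t -
      duhamel β 0 (fun s => tensor (addConst c (w s)) (addConst c (w s))) t := by
  have hcw : ContinuousOn (fun s => tensor (w s) (w s)) (Ioc 0 1) :=
    continuous_tensor_self.comp_continuousOn hwc
  have hcV : ContinuousOn (fun s => tensor (addConst c (w s)) (addConst c (w s))) (Ioc 0 1) :=
    continuous_tensor_self.comp_continuousOn ((continuous_addConst c).comp_continuousOn hwc)
  have hIw : ∀ t ∈ Ioc (0 : ℝ) 1,
      IntervalIntegrable (fun s => oseen β c (t - s) (tensor (w s) (w s))) volume 0 t :=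
    fun t ht => intervalIntegrable_oseen hβ hK0 (hK c) ha0 ha (by linarith) hγ ht.1 ht.2
      hcw (norm_tensor_weight_le hwM)
  have hIV := intervalIntegrable_oseen hβ hK0 (hK 0) ha0 ha (by linarith) hγ ht.1 ht.2
      hcV (norm_tensor_weight_le hVM)
  have hsum : ∀ t ∈ Ioc (0 : ℝ) 1, ∀ k, Summable fun l => propagator β c t l * u₀ k l :=
    fun t ht k => summable_propagator_mul hβ c ht.1 hm (hu₀ k)
  have hsum0 : ∀ k, Summable fun l => propagator β 0 t l *
      (u₀ k l + if l = 0 then (c k : ℂ) else 0) := fun k =>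
    summable_propagator_mul_add_mean hβ 0 ht.1 hm (hu₀ k) _
  have hwdiv : ∀ t ∈ Ioc (0 : ℝ) 1, ∀ l, ∑ k, (l k : ℂ) * mFourierCoeff (w t k) l = 0 := by
    intro t ht l
    rw [hw t ht]
    exact sum_mul_mFourierCoeff_solution hβ ht.1 (hIw t ht) (hsum t ht) hdiv l
  funext k
  refine eq_of_mFourierCoeff_eq fun l => ?_
  set κ : ℂ := 2 * Real.pi * Complex.I * ∑ i, (l i : ℂ) * (c i : ℂ)
  set n : ℝ → ℂ := fun s => projDivMode (tensor (w s) (w s)) k l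
  have hprop : ∀ τ : ℝ, propagator β c τ l = Complex.exp (-τ * (rate β l + κ)) := fun τ =>
    propagator_eq_exp β c τ l
  have hprop0 : ∀ τ : ℝ, propagator β (0 : Fin d → ℝ) τ l = Complex.exp (-τ * rate β l) :=
    fun τ => by
      rw [propagator_eq_exp]; simp
  have hmode : ∀ t ∈ Ioc (0 : ℝ) 1, mFourierCoeff (w t k) l =
      Complex.exp (-t * (rate β l + κ)) * u₀ k l -
        ∫ s in (0 : ℝ)..t, Complex.exp (-(t - s : ℝ) * (rate β l + κ)) * n s := by
    intro t ht
    simp only [← hprop]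
    have h := mFourierCoeff_heatField_sub_duhamel hβ ht.1 (hIw t ht) (hsum t ht) k l
    rwa [← hw t ht] at h
  have hn : ContinuousOn n (Ioc 0 1) := (continuous_projDivMode k l).comp_continuousOn hcw
  have hnM : ∀ s ∈ Ioc (0 : ℝ) 1, ‖n s‖ ≤
      (d * (d * (4 * Real.pi * (1 + ‖freq l‖))) * (M * M)) * s ^ (-(2 * γ)) := fun s hs => by
    refine (norm_projDivMode_le _ k l).trans ?_
    rw [mul_assoc _ (M * M)]
    gcongr
    exact norm_tensor_weight_le hwM s hs
  have hnew := mild_change_drift (y := fun s => mFourierCoeff (w s k) l) (by linarith) hγ hn hnM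
    hmode ht
  rw [mFourierCoeff_heatField_sub_duhamel hβ ht.1 hIV hsum0, mFourierCoeff_addConst]
  have hint : ∫ s in (0 : ℝ)..t, propagator β 0 (t - s) l *
      projDivMode (tensor (addConst c (w s)) (addConst c (w s))) k l =
      ∫ s in (0 : ℝ)..t, Complex.exp (-(t - s : ℝ) * rate β l) *
        (n s + κ * mFourierCoeff (w s k) l) := by
    refine intervalIntegral.integral_congr_ae (.of_forall fun s hs => ?_)
    rw [uIoc_of_le ht.1.le] at hs
    rw [hprop0, projDivMode_addConst c (w s) k l (hwdiv s ⟨hs.1, hs.2.trans ht.2⟩ l)]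
  have hmean : propagator β 0 t l * (if l = 0 then (c k : ℂ) else 0) =
      if l = 0 then (c k : ℂ) else 0 := by
    split_ifs with hl
    · rw [hprop0, hl, rate_zero hβ]; simp
    · rw [mul_zero]
  rw [hint, mul_add, hmean, hnew, hprop0]
  ring

/-! ### Mild solutions from continuous complex fields -/

/-- The real vector field whose components are the real parts of those of `u`. -/
def realField {d : ℕ} (u : Field d) (x : Torus d) : EuclideanSpace ℝ (Fin d) :=
  WithLp.toLp 2 fun k => (u k x).re

theorem ofReal_realField {d : ℕ} {u : Field d} (hu : ∀ k x, (u k x).im = 0) (x : Torus d)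
    (k : Fin d) : ((realField u x k : ℝ) : ℂ) = u k x :=
  Complex.ext rfl (hu k x).symm

theorem funCoeffs_realField {d : ℕ} {u : Field d} (hu : ∀ k x, (u k x).im = 0) (l : Fin d → ℤ)
    (k : Fin d) : funCoeffs (realField u) l k = mFourierCoeff (u k) l :=
  congrArg (fun f => mFourierCoeff f l) (funext fun x => ofReal_realField hu x k)

theorem projDivCoeffs_realField {d : ℕ} {u : Field d} (hu : ∀ k x, (u k x).im = 0)
    (l : Fin d → ℤ) (k : Fin d) :
    projDivCoeffs (realField u) l k = projDivMode (tensor u u) k l := by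
  have h : ∀ j m, (fun x => ((realField u x j * realField u x m : ℝ) : ℂ)) = ⇑(tensor u u j m) :=
    fun j m => by
      funext x
      rw [Complex.ofReal_mul, ofReal_realField hu, ofReal_realField hu]
      rfl
  rw [projDivMode_eq]
  simp only [projDivCoeffs, h]

/-- Evaluation of a vector field at a point. -/
def evalField {d : ℕ} (x : Torus d) : Field d →L[ℂ] EuclideanSpace ℂ (Fin d) :=
  (PiLp.continuousLinearEquiv 2 ℂ fun _ : Fin d => ℂ).symm.toContinuousLinearMap ∘L
    ContinuousLinearMap.pi fun k =>
      ContinuousMap.evalCLM ℂ x ∘L ContinuousLinearMap.proj (R := ℂ) k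

theorem evalField_apply {d : ℕ} (x : Torus d) (u : Field d) :
    evalField x u = WithLp.toLp 2 fun k => u k x := rfl

theorem heat_eq {d : ℕ} {β τ : ℝ} {a : Coeffs d} (x : Torus d)
    (ha : ∀ k, Summable fun l => propagator β 0 τ l * a l k) :
    heat β τ a x = evalField x (heatField β 0 (fun k l => a l k) τ) := by
  have h : ∀ k, (fun l => (((Real.exp (-τ * (2 * Real.pi * ‖freq l‖) ^ (2 * β)) : ℝ) : ℂ) •
      a l) k) = fun l => propagator β 0 τ l * a l k := fun k => by
    funext l
    rw [PiLp.smul_apply, smul_eq_mul, propagator_eq_exp, Complex.ofReal_exp, rate]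
    simp
  rw [heat, fourierSeries_eq]
  · simp only [h, evalField_apply, heatField]
  · intro k
    rw [h]
    exact ha k

theorem summable_projDivMode {d : ℕ} {β : ℝ} (hβ : 0 < β) (c : Fin d → ℝ) {τ : ℝ} (hτ : 0 < τ)
    (F : Tensor d) (k : Fin d) : Summable fun l => propagator β c τ l * projDivMode F k l := by
  simp only [projDivMode, Finset.mul_sum]
  exact summable_sum fun m _ => summable_sum fun j _ => summable_oseen hβ c hτ k m j _

theorem heat_projDivCoeffs {d : ℕ} {β : ℝ} (hβ : 0 < β) {τ : ℝ} (hτ : 0 < τ) {u : Field d}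
    (hu : ∀ k x, (u k x).im = 0) (x : Torus d) :
    heat β τ (projDivCoeffs (realField u)) x = evalField x (oseen β 0 τ (tensor u u)) := by
  have hs := summable_projDivMode hβ 0 hτ (tensor u u)
  rw [heat_eq x fun k => by simpa only [projDivCoeffs_realField hu] using hs k]
  congr 1
  funext k
  refine eq_of_mFourierCoeff_eq fun l => ?_
  rw [mFourierCoeff_oseen hβ 0 hτ]
  simp only [projDivCoeffs_realField hu]
  exact mFourierCoeff_heatField 0 (a := projDivMode (tensor u u)) k (hs k) l

theorem continuous_realField {d : ℕ} (u : Field d) : Continuous (realField u) :=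
  (PiLp.continuous_toLp 2 _).comp
    (continuous_pi fun k => Complex.continuous_re.comp (u k).continuous)

theorem norm_realField_le {d : ℕ} (u : Field d) (x : Torus d) : ‖realField u x‖ ≤ d * ‖u‖ := by
  refine norm_toLp_le fun k => ?_
  rw [Real.norm_eq_abs]
  exact (Complex.abs_re_le_norm _).trans
    (((u k).norm_coe_le_norm x).trans (norm_le_pi_norm u k))

theorem aestronglyMeasurable_realField {d : ℕ} {V : ℝ → Field d} (hV : ContinuousOn V (Ioc 0 1)) :
    AEStronglyMeasurable (Function.uncurry fun t => realField (V t))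
      ((volume.restrict (Ioc (0 : ℝ) 1)).prod (torusMeasure d)) := by
  have h : ContinuousOn (Function.uncurry fun t => realField (V t))
      (Ioc (0 : ℝ) 1 ×ˢ (univ : Set (Torus d))) := by
    refine (PiLp.continuous_toLp 2 _).comp_continuousOn (continuousOn_pi.2 fun k => ?_)
    refine Complex.continuous_re.comp_continuousOn ?_
    have h1 : ContinuousOn (fun p : ℝ × Torus d => V p.1 k) (Ioc (0 : ℝ) 1 ×ˢ univ) :=
      (continuous_apply k).comp_continuousOn (hV.comp continuousOn_fst fun p hp => hp.1)
    exact (ContinuousEval.continuous_eval (F := C(Torus d, ℂ))).comp_continuousOn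
      (h1.prodMk continuousOn_snd)
  have e : (volume.restrict (Ioc (0 : ℝ) 1)).prod (torusMeasure d) =
      (volume.prod (torusMeasure d)).restrict (Ioc (0 : ℝ) 1 ×ˢ univ) := by
    rw [← Measure.prod_restrict, Measure.restrict_univ]
  rw [e]
  exact h.aestronglyMeasurable (measurableSet_Ioc.prod MeasurableSet.univ)

/-- A continuous real divergence-free solution of the integral equation in `C(𝕋^d)` is a mild
solution. -/
theorem isMildSolution_realField {d : ℕ} {β : ℝ} (hβ : 0 < β) {v₀ : Fin d → Distribution d}
    {V : ℝ → Field d} (hVc : ContinuousOn V (Ioc 0 1))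
    (hreal : ∀ t ∈ Ioc (0 : ℝ) 1, ∀ k x, (V t k x).im = 0)
    (hdiv : ∀ t ∈ Ioc (0 : ℝ) 1, ∀ l, ∑ k, (l k : ℂ) * mFourierCoeff (V t k) l = 0)
    (hI : ∀ t ∈ Ioc (0 : ℝ) 1,
      IntervalIntegrable (fun s => oseen β 0 (t - s) (tensor (V s) (V s))) volume 0 t)
    (hsum : ∀ t ∈ Ioc (0 : ℝ) 1, ∀ k, Summable fun l =>
      propagator β 0 t l * (v₀ k).fourierCoeff l)
    (hV : ∀ t ∈ Ioc (0 : ℝ) 1, V t = heatField β 0 (fun k l => (v₀ k).fourierCoeff l) t -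
      duhamel β 0 (fun s => tensor (V s) (V s)) t) :
    IsMildSolution β v₀ fun t => realField (V t) := by
  have hheat : ∀ t ∈ Ioc (0 : ℝ) 1, ∀ x, ∀ s ∈ Ioo 0 t,
      heat β (t - s) (projDivCoeffs (realField (V s))) x =
        evalField x (oseen β 0 (t - s) (tensor (V s) (V s))) := fun t ht x s hs =>
    heat_projDivCoeffs hβ (sub_pos.2 hs.2) (hreal s ⟨hs.1, hs.2.le.trans ht.2⟩) x
  refine ⟨aestronglyMeasurable_realField hVc, fun t ht => ?_, fun t ht => ?_, fun t ht => ?_,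
    fun t ht => ?_⟩
  · exact memLp_top_of_bound (continuous_realField _).aestronglyMeasurable _
      (.of_forall (norm_realField_le (V t)))
  · exact weakDivFree_of_coeff (fun k x => (ofReal_realField (hreal t ht) x k).symm) (hdiv t ht)
  · refine .of_forall fun x => ?_
    have h1 : IntervalIntegrable
        (fun s => evalField x (oseen β 0 (t - s) (tensor (V s) (V s)))) volume 0 t :=
      ⟨(evalField x).integrable_comp (hI t ht).1, (evalField x).integrable_comp (hI t ht).2⟩
    refine h1.congr_ae ?_
    rw [uIoc_of_le ht.1.le]
    refine (ae_restrict_iff' measurableSet_Ioc).2 (ae_mem_Ioo_of_mem_Ioc 0 t fun s hs => ?_)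
    exact (hheat t ht x s hs).symm
  · refine .of_forall fun x => ?_
    have h1 : complexify (realField (V t) x) = evalField x (V t) := by
      rw [evalField_apply, complexify]
      simp only [ofReal_realField (hreal t ht)]
    have h2 : evalField x (duhamel β 0 (fun s => tensor (V s) (V s)) t) =
        ∫ s in (0 : ℝ)..t, evalField x (oseen β 0 (t - s) (tensor (V s) (V s))) :=
      ((evalField x).intervalIntegral_comp_comm (hI t ht)).symm
    have h3 : ∫ s in (0 : ℝ)..t, evalField x (oseen β 0 (t - s) (tensor (V s) (V s))) =
        ∫ s in (0 : ℝ)..t, heat β (t - s) (projDivCoeffs (realField (V s))) x := by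
      refine intervalIntegral.integral_congr_ae ?_
      rw [uIoc_of_le ht.1.le]
      exact ae_mem_Ioo_of_mem_Ioc 0 t fun s hs => (hheat t ht x s hs).symm
    have h4 : heat β t (distCoeffs v₀) x =
        evalField x (heatField β 0 (fun k l => (v₀ k).fourierCoeff l) t) :=
      heat_eq x (hsum t ht)
    rw [h1, h4, ← h3, ← h2, ← map_sub, ← hV t ht]

/-! ### Membership in `L^∞` with values in the Besov space -/

/-- The Fourier coefficients of a complex field. -/
def fieldCoeffs {d : ℕ} (u : Field d) : Coeffs d :=
  fun l => WithLp.toLp 2 fun k => mFourierCoeff (u k) l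

/-- Strong measurability into the Besov space follows from that into `C(𝕋^d)`, which embeds into
it. -/
theorem memLinftyBesov_realField {d : ℕ} {φ : Vec d → ℝ} (hφ : IsDyadicBump φ) {s B : ℝ}
    (hs : 0 ≤ s) {V : ℝ → Field d} (hVc : ContinuousOn V (Ioc 0 1))
    (hreal : ∀ t ∈ Ioc (0 : ℝ) 1, ∀ k x, (V t k x).im = 0)
    (hB : ∀ t ∈ Ioc (0 : ℝ) 1, ∀ (k : Fin d) (j : ℤ),
      ‖synth (blockCoeff φ j (mFourierCoeff (V t k)))‖ ≤ B * ((2 : ℝ) ^ j) ^ s) :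
    MemLinftyBesov φ (-s) fun t => realField (V t) := by
  constructor
  · have hm : AEStronglyMeasurable V (volume.restrict (Ioc (0 : ℝ) 1)) :=
      hVc.aestronglyMeasurable measurableSet_Ioc
    obtain ⟨C, hC0, hC⟩ := exists_block_le_besov hφ hs
    refine ⟨fun n => (hm.stronglyMeasurable_mk.approx n).map fieldCoeffs, ?_⟩
    filter_upwards [hm.ae_eq_mk, ae_restrict_mem measurableSet_Ioc] with t hmk ht
    have hlim : Tendsto (fun n => hm.stronglyMeasurable_mk.approx n t) atTop (𝓝 (V t)) := by
      rw [hmk]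
      exact hm.stronglyMeasurable_mk.tendsto_approx t
    have hle : ∀ n, besovNorm φ (-s) (funCoeffs (realField (V t)) -
        (hm.stronglyMeasurable_mk.approx n).map fieldCoeffs t) ≤
        ENNReal.ofReal (d * (C * ‖V t - hm.stronglyMeasurable_mk.approx n t‖)) := fun n => by
      set u : Field d := hm.stronglyMeasurable_mk.approx n t with hu
      refine besovNorm_le hφ fun j k => ?_
      have e : (fun l => (funCoeffs (realField (V t)) -
          (hm.stronglyMeasurable_mk.approx n).map fieldCoeffs t) l k) =
          mFourierCoeff (V t k - u k : C(Torus d, ℂ)) := by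
        funext l
        rw [SimpleFunc.map_apply, ← hu, Pi.sub_apply, PiLp.sub_apply,
          funCoeffs_realField (hreal t ht), ← coeffCLM_apply l (V t k - u k), map_sub]
        rfl
      rw [e]
      refine (hC j _).trans ?_
      gcongr
      exact norm_le_pi_norm (V t - u) k
    refine tendsto_of_tendsto_of_tendsto_of_le_of_le tendsto_const_nhds ?_ (fun _ => zero_le)
      hle
    have h1 : Tendsto (fun n => d * (C * ‖V t - hm.stronglyMeasurable_mk.approx n t‖)) atTop
        (𝓝 (d * (C * ‖V t - V t‖))) :=
      ((tendsto_const_nhds.sub hlim).norm.const_mul C).const_mul (d : ℝ)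
    have h2 := ENNReal.tendsto_ofReal h1
    rwa [sub_self, norm_zero, mul_zero, mul_zero, ENNReal.ofReal_zero] at h2
  · refine ⟨Real.toNNReal (d * B), ?_⟩
    filter_upwards [ae_restrict_mem measurableSet_Ioc] with t ht
    refine besovNorm_le hφ fun j k => ?_
    simp only [funCoeffs_realField (hreal t ht)]
    exact hB t ht k j

theorem iSup_weight_lt_top {d : ℕ} {γ M : ℝ} {V : ℝ → Field d}
    (hV : ∀ t ∈ Ioc (0 : ℝ) 1, ‖V t‖ ≤ M * t ^ (-γ)) :
    (⨆ t ∈ Ioc (0 : ℝ) 1, ENNReal.ofReal (t ^ γ) *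
      eLpNorm (realField (V t)) ⊤ (torusMeasure d)) < ⊤ := by
  refine (iSup₂_le fun t ht => ?_ : _ ≤ ENNReal.ofReal (d * M)).trans_lt ENNReal.ofReal_lt_top
  have h1 : eLpNorm (realField (V t)) ⊤ (torusMeasure d) ≤
      ENNReal.ofReal (d * (M * t ^ (-γ))) := by
    rw [eLpNorm_exponent_top]
    refine eLpNormEssSup_le_of_ae_bound (.of_forall fun x => ?_)
    exact (norm_realField_le _ x).trans (by gcongr; exact hV t ht)
  have hp : 0 ≤ t ^ γ := Real.rpow_nonneg ht.1.le _
  calc _ ≤ ENNReal.ofReal (t ^ γ) * ENNReal.ofReal (d * (M * t ^ (-γ))) := by gcongr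
    _ = ENNReal.ofReal (d * M) := by
      rw [← ENNReal.ofReal_mul hp]
      congr 1
      have h2 : t ^ γ * t ^ (-γ) = 1 := by
        rw [← Real.rpow_add ht.1, add_neg_cancel, Real.rpow_zero]
      linear_combination (d * M) * h2

/-! ### The exponents and the small-data theorem -/

theorem sum_mul_fluctuation {d : ℕ} {v₀ : Fin d → Distribution d} (hv₀ : DistDivFree v₀)
    (l : Fin d → ℤ) : ∑ k, (l k : ℂ) * fluctuation v₀ k l = 0 := by
  by_cases hl : l = 0
  · simp [hl]
  · simpa only [fluctuation, if_neg hl] using sum_mul_fourierCoeff_eq_zero hv₀ l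

theorem block_fluctuation_le {d : ℕ} {φ : Vec d → ℝ} (hφ : IsDyadicBump φ) {s ε : ℝ} (hε : 0 ≤ ε)
    {v₀ : Fin d → Distribution d}
    (h : besovNorm φ (-s) (distCoeffs v₀) ≤ ENNReal.ofReal ε) (k : Fin d) (j : ℤ) :
    ‖synth (blockCoeff φ j (fluctuation v₀ k))‖ ≤ ε * ((2 : ℝ) ^ j) ^ s := by
  have e : blockCoeff φ j (fluctuation v₀ k) = blockCoeff φ j fun l => distCoeffs v₀ l k :=
    blockCoeff_congr hφ j fun l hl => if_neg hl
  rw [e]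
  exact block_le_of_besovNorm_le hφ hε h j k

/-- Adding a constant does not change the dyadic blocks. -/
theorem blockCoeff_addConst {d : ℕ} {φ : Vec d → ℝ} (hφ : IsDyadicBump φ) (j : ℤ)
    (c : Fin d → ℝ) (u : Field d) (k : Fin d) :
    blockCoeff φ j (mFourierCoeff (addConst c u k)) = blockCoeff φ j (mFourierCoeff (u k)) :=
  blockCoeff_congr hφ j fun l hl => by rw [mFourierCoeff_addConst, if_neg hl, add_zero]

/-- Solutions of the Duhamel equation of size `O(t^{-γ})` stay bounded in the Besov space of the
data. -/
theorem exists_block_solution_le {d : ℕ} {φ : Vec d → ℝ} (hφ : IsDyadicBump φ)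
    {β s γ θ : ℝ} (hβ : 0 < β) (hγ0 : 0 ≤ γ) (hγ : 2 * γ < 1) (hθ0 : 0 ≤ θ) (hθ1 : θ < 1)
    (hθγ : θ + 2 * γ ≤ 1) (hs : 1 - s ≤ 2 * β * θ) :
    ∃ C : ℝ, 0 ≤ C ∧ ∀ (c : Fin d → ℝ) (u₀ : Fin d → (Fin d → ℤ) → ℂ) (w : ℝ → Field d) (ε M t : ℝ),
      0 < t → t ≤ 1 → (∀ k, Summable fun l => propagator β c t l * u₀ k l) →
      (∀ k j, ‖synth (blockCoeff φ j (u₀ k))‖ ≤ ε * ((2 : ℝ) ^ j) ^ s) →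
      (∀ t ∈ Ioc (0 : ℝ) 1, ‖w t‖ ≤ M * t ^ (-γ)) →
      IntervalIntegrable (fun s => oseen β c (t - s) (tensor (w s) (w s))) volume 0 t →
      w t = heatField β c u₀ t - duhamel β c (fun s => tensor (w s) (w s)) t →
      ∀ k j, ‖synth (blockCoeff φ j (mFourierCoeff (w t k)))‖ ≤
        C * (ε + M * M) * ((2 : ℝ) ^ j) ^ s := by
  obtain ⟨C₁, hC₁0, hC₁⟩ := exists_heat_block_le hφ β
  obtain ⟨C₂, hC₂0, hC₂⟩ := exists_oseen_block_le hφ hβ hθ0 hθ1.le hs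
  refine ⟨C₁ + C₂ * betaConst θ (2 * γ),
    add_nonneg hC₁0 (mul_nonneg hC₂0 (betaConst_nonneg _ _)), ?_⟩
  intro c u₀ w ε M t ht ht1 hsum hu₀ hw hI heq k j
  have h1 := norm_block_duhamel_le hφ hC₂0 (hC₂ c) hθ0 hθ1 (by linarith) hγ hθγ
    (mul_self_nonneg M) ht ht1 hI (norm_tensor_weight_le hw) k j
  have h2 : ‖blockCLM hφ j (heatField β c u₀ t k)‖ ≤ C₁ * ε * ((2 : ℝ) ^ j) ^ s := by
    rw [heatField, blockCLM_synth hφ j (hsum k)]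
    refine (hC₁ c (u₀ k) j t ht.le).trans ?_
    have h3 : (1 + t * ((2 : ℝ) ^ j) ^ (2 * β))⁻¹ ≤ 1 :=
      inv_le_one_of_one_le₀ (le_add_of_nonneg_right (by positivity))
    calc _ ≤ C₁ * 1 * (ε * ((2 : ℝ) ^ j) ^ s) := by gcongr; exact hu₀ k j
      _ = _ := by ring
  have hε : 0 ≤ ε := by
    have h4 := (norm_nonneg _).trans (hu₀ k 0)
    simpa using h4
  have hN : 0 ≤ ((2 : ℝ) ^ j) ^ s := by positivity
  have hB := betaConst_nonneg θ (2 * γ)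
  rw [← blockCLM_apply hφ, heq]
  have h5 : (heatField β c u₀ t - duhamel β c (fun s => tensor (w s) (w s)) t) k =
    heatField β c u₀ t k - duhamel β c (fun s => tensor (w s) (w s)) t k := rfl
  rw [h5, map_sub]
  refine (norm_sub_le _ _).trans ((add_le_add h2 h1).trans ?_)
  have h6 : 0 ≤ C₁ * (M * M) * ((2 : ℝ) ^ j) ^ s :=
    mul_nonneg (mul_nonneg hC₁0 (mul_self_nonneg M)) hN
  have h7 : 0 ≤ C₂ * betaConst θ (2 * γ) * ε * ((2 : ℝ) ^ j) ^ s := by positivity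
  linarith

end GNS

end

theorem theorem1p2 (d : ℕ) (hd : 2 ≤ d)
    (φ : EuclideanSpace ℝ (Fin d) → ℝ) (hφ : GNS.IsDyadicBump φ)
    (β α : ℝ) (hβ : 1 / 2 < β) (hα : α < 0) (hαβ : α ≤ β - 1) (hpos : -β < α) :
    ∃ ε : ℝ, 0 < ε ∧
      ∀ v₀ : Fin d → GNS.Distribution d,
        GNS.DistDivFree v₀ →
        GNS.besovNorm φ (-β - α) (GNS.distCoeffs v₀) ≤ ENNReal.ofReal ε →
        ∃ v : ℝ → GNS.Torus d → EuclideanSpace ℝ (Fin d),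
          GNS.IsMildSolution β v₀ v ∧
          GNS.MemLinftyBesov φ (-β - α) v ∧
          (⨆ t ∈ Set.Ioc (0 : ℝ) 1,
            ENNReal.ofReal (t ^ ((β + α) / (2 * β))) *
              eLpNorm (v t) ⊤ (GNS.torusMeasure d)) < ⊤ := by
  -- `s` is the regularity loss of the data, `t^{-γ}` the size of the solution, and `t^{-θ}` the
  -- cost of mapping `ℙ div` into the Besov space
  set s : ℝ := β + α with hs
  have hs0 : 0 < s := by linarith
  have hsβ : s < β := by linarith
  have hs1 : s ≤ 2 * β - 1 := by linarith
  have hβ0 : 0 < β := by linarith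
  have h2β : 0 < 2 * β := by linarith
  set a : ℝ := 1 / (2 * β) with ha_def
  set γ : ℝ := s / (2 * β) with hγ_def
  set θ : ℝ := max 0 ((1 - s) / (2 * β)) with hθ_def
  have ha0 : 0 ≤ a := by positivity
  have ha : a < 1 := by rw [ha_def, div_lt_one h2β]; linarith
  have hγ0 : 0 ≤ γ := by positivity
  have hγ : 2 * γ < 1 := by rw [hγ_def, ← mul_div_assoc, div_lt_one h2β]; linarith
  have hγa : γ ≤ 1 - a := by
    rw [le_sub_iff_add_le, hγ_def, ha_def, ← add_div, div_le_one h2β]; linarith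
  have hθ1 : θ < 1 := max_lt one_pos (by rw [div_lt_one h2β]; linarith)
  have hθγ : θ + 2 * γ ≤ 1 := by
    have h : (1 - s) / (2 * β) ≤ 1 - 2 * γ := by
      rw [le_sub_iff_add_le, hγ_def, ← mul_div_assoc, ← add_div, div_le_one h2β]; linarith
    linarith [max_le (by linarith : (0 : ℝ) ≤ 1 - 2 * γ) h]
  have hθs : 1 - s ≤ 2 * β * θ := by
    have h := (div_le_iff₀ h2β).1 (le_max_right 0 ((1 - s) / (2 * β)))
    linarith
  have hexp : -β - α = -s := by rw [hs]; ring
  obtain ⟨K, hK0, hK⟩ := GNS.exists_oseen_le hφ hβ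
  obtain ⟨H, hH0, hH⟩ := GNS.exists_heat_le hφ hs0 (by linarith : s < 2 * β)
  obtain ⟨C, -, hC⟩ := GNS.exists_block_solution_le hφ hβ0 hγ0 hγ (le_max_left _ _) hθ1 hθγ hθs
  -- the free evolution has size `H ε`, and the fixed point needs `8 κ H ε ≤ 1`
  set κ : ℝ := K * GNS.betaConst a (2 * γ)
  have hκ : 0 ≤ κ := mul_nonneg hK0 (GNS.betaConst_nonneg _ _)
  set ε : ℝ := 1 / (8 * κ * H + 1)
  have hden : 0 < 8 * κ * H + 1 := by positivity
  have hε : 0 < ε := by positivity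
  refine ⟨ε, hε, fun v₀ hdiv₀ hv₀ => ?_⟩
  rw [hexp] at hv₀ ⊢
  have hsmall : 8 * κ * (H * ε) ≤ 1 := by
    rw [← mul_assoc, mul_one_div, div_le_one hden]; linarith
  set c : Fin d → ℝ := GNS.meanValue v₀
  have hblock := GNS.block_fluctuation_le hφ hε.le hv₀
  have hgrowth : ∀ k, GNS.GrowthLE s (3 * ε * 2 ^ s) (GNS.fluctuation v₀ k) := fun k =>
    GNS.growthLE_fluctuation hφ hs0.le hε.le (if_pos rfl) (hblock k)
  have hsum : ∀ t ∈ Ioc (0 : ℝ) 1, ∀ k,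
      Summable fun l => GNS.propagator β c t l * GNS.fluctuation v₀ k l := fun t ht k =>
    GNS.summable_propagator_mul hβ0 c ht.1 hs0.le (hgrowth k)
  have hheat : ∀ t ∈ Ioc (0 : ℝ) 1,
      ‖GNS.heatField β c (GNS.fluctuation v₀) t‖ ≤ H * ε * t ^ (-γ) := fun t ht =>
    (pi_norm_le_iff_of_nonneg (mul_nonneg (by positivity) (Real.rpow_nonneg ht.1.le _))).2 fun k =>
      hH c _ ε t ht.1 (if_pos rfl) (hsum t ht k) (hblock k)
  obtain ⟨w, hwc, hwM, hwr, hweq⟩ := GNS.exists_duhamel_solution hβ0 hK0 (hK c) ha0 ha hγ0 hγ hγa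
    (by positivity) hsmall hs0.le hgrowth (GNS.fluctuation_neg v₀) hheat
  have hVM : ∀ t ∈ Ioc (0 : ℝ) 1, ‖GNS.addConst c (w t)‖ ≤ (2 * (H * ε) + ‖c‖) * t ^ (-γ) := by
    intro t ht
    have h1 : 1 ≤ t ^ (-γ) := Real.one_le_rpow_of_pos_of_le_one_of_nonpos ht.1 ht.2 (by linarith)
    have h2 : ‖c‖ ≤ ‖c‖ * t ^ (-γ) := le_mul_of_one_le_right (norm_nonneg _) h1
    have h3 := hwM t ht
    have h4 := GNS.norm_addConst_le c (w t)
    linarith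
  have hVc : ContinuousOn (fun t => GNS.addConst c (w t)) (Ioc 0 1) :=
    (GNS.continuous_addConst c).comp_continuousOn hwc
  have hVr : ∀ t ∈ Ioc (0 : ℝ) 1, ∀ k x, (GNS.addConst c (w t) k x).im = 0 := fun t ht k x => by
    simp [GNS.addConst, hwr t ht k x]
  have hIw : ∀ t ∈ Ioc (0 : ℝ) 1, IntervalIntegrable
      (fun s => GNS.oseen β c (t - s) (GNS.tensor (w s) (w s))) volume 0 t := fun t ht =>
    GNS.intervalIntegrable_oseen hβ0 hK0 (hK c) ha0 ha (by linarith) hγ ht.1 ht.2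
      (GNS.continuous_tensor_self.comp_continuousOn hwc) (GNS.norm_tensor_weight_le hwM)
  have hmean : (fun k l => GNS.fluctuation v₀ k l + if l = 0 then (c k : ℂ) else 0) =
      fun k l => (v₀ k).fourierCoeff l :=
    funext fun k => funext fun l => GNS.fluctuation_add_mean v₀ k l
  refine ⟨fun t => GNS.realField (GNS.addConst c (w t)), ?_, ?_, GNS.iSup_weight_lt_top hVM⟩
  · refine GNS.isMildSolution_realField hβ0 hVc hVr (fun t ht l => ?_) (fun t ht => ?_)
      (fun t ht k => ?_) fun t ht => ?_
    · refine GNS.sum_mul_mFourierCoeff_addConst c ?_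
      rw [hweq t ht]
      exact GNS.sum_mul_mFourierCoeff_solution hβ0 ht.1 (hIw t ht) (hsum t ht)
        (GNS.sum_mul_fluctuation hdiv₀) l
    · exact GNS.intervalIntegrable_oseen hβ0 hK0 (hK 0) ha0 ha (by linarith) hγ ht.1 ht.2
        (GNS.continuous_tensor_self.comp_continuousOn hVc) (GNS.norm_tensor_weight_le hVM)
    · simp only [← GNS.fluctuation_add_mean]
      exact GNS.summable_propagator_mul_add_mean hβ0 0 ht.1 hs0.le (hgrowth k) _
    · rw [← hmean]
      exact GNS.addConst_eq_heatField_sub_duhamel hβ0 hK0 hK ha0 ha hγ0 hγ hs0.le hgrowth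
        (GNS.sum_mul_fluctuation hdiv₀) hwc hwM hVM hweq ht
  · refine GNS.memLinftyBesov_realField hφ
      (B := C * (ε + 2 * (H * ε) * (2 * (H * ε)))) hs0.le hVc hVr fun t ht k j => ?_
    rw [GNS.blockCoeff_addConst hφ]
    exact hC c _ w ε _ t ht.1 ht.2 (hsum t ht) hblock hwM (hIw t ht) (hweq t ht) k j
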